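/- **Setting.** Let $A$ be a finite alphabet. A nonempty string $w=w_1\dots w_n\in A^+$ is viewed as the structure with domain $\{1,\dots,n\}$, the successor relation $S(i,i+1)$, one unary predicate $P_a=\{i : w_i=a\}$ for each $a\in A$, and the constants $\min=1$ and $\max=n$. A *sample* $S=(P,N)$ consists of two disjoint finite sets of nonempty strings over $A$; its size $|S|$ is the sum of the lengths of all its strings. **EF-similarity.** In the $r$-round Ehrenfeucht–Fraïssé game on $u,v$ the Spoiler picks in each round an element of one of the two structures and the Duplicator answers in the other one; the Duplicator wins if the picked pairs define an isomorphism of the induced substructures (which contain the constants). For $u\ne v$, $\mathrm{EFsim}(u,v)$ is the least $r$ for which the Spoiler has a winning strategy. **Free occurrences.** Let $|\alpha|=2^{q}-1$ with $q=q_\alpha\ge1$. $\Gamma(\alpha,w)$ is the set of positions $i$ of $w$ on which an occurrence of $\alpha$ is centered and with $|\min-i|>2^{q-1}$, $|\max-i|>2^{q-1}$. Put $\gamma(\alpha,w)=|\Gamma(\alpha,w)|$, and let $\sigma(\alpha,w)$ be the least number of parts in a partition of $\Gamma(\alpha,w)$ whose parts have diameter at most $2^{q}$ and are convex in $\Gamma(\alpha,w)$.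 **Formulas.** A quantifier always binds a fresh variable $z$ (or $x_i$). For terms $t,t_1,t_2$ define: * $d_{\le0}(t_1,t_2):=(t_1=t_2)$; $d_{\le1}(t_1,t_2):=(t_1=t_2\vee S(t_1,t_2))$; $d_{\le n}(t_1,t_2):=\exists z\,(d_{\le\lfloor n/2\rfloor}(t_1,z)\wedge d_{\le\lceil n/2\rceil}(z,t_2))$ for $n\ge2$; $d_{>n}:=\neg d_{\le n}$; $d_{\ge n}:=d_{>n-1}$. * For a nonempty string $w=a_1\dots a_k$ let $m=\lceil k/2\rceil$. The formula $[t_1\,w\,t_2]$ is $\exists z(P_{a_1}(z)\wedge S(t_1,z)\wedge S(z,t_2))$ if $k=1$, $\exists z(P_{a_1}(z)\wedge S(t_1,z)\wedge[z\,a_2\,t_2])$ if $k=2$, and $\exists z(P_{a_m}(z)\wedge[t_1\,a_1\dots a_{m-1}\,z]\wedge[z\,a_{m+1}\dots a_k\,t_2])$ if $k\ge3$. The formula $[t\,w]$ is $\exists z(S(t,z)\wedge P_{a_1}(z))$, $\exists z(P_{a_1}(z)\wedge S(t,z)\wedge[z\,a_2])$, $\exists z(P_{a_m}(z)\wedge[t\,a_1\dots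 a_{m-1}\,z]\wedge[z\,a_{m+1}\dots a_k])$ in these three cases, and $[w\,t]$ is $\exists z(S(z,t)\wedge P_{a_1}(z))$, $\exists z(P_{a_1}(z)\wedge[z\,a_2\,t])$, $\exists z(P_{a_m}(z)\wedge[a_1\dots a_{m-1}\,z]\wedge[z\,a_{m+1}\dots a_k\,t])$. * $\mathrm{pref}_w$ is $P_{a_1}(\min)$ if $k=1$; $P_{a_1}(\min)\wedge[\min\,a_2\dots a_k]$ if $k\in\{2,3\}$; and for $k\ge4$, with $m=\lceil (k+1)/2\rceil$, it is $P_{a_1}(\min)\wedge\exists z(P_{a_m}(z)\wedge[\min\,a_2\dots a_{m-1}\,z]\wedge[z\,a_{m+1}\dots a_k])$. $\mathrm{suff}_w$ is $P_{a_k}(\max)$ if $k=1$; $P_{a_k}(\max)\wedge[a_1\dots a_{k-1}\,\max]$ if $k\in\{2,3\}$; and for $k\ge4$, with $m=\lfloor k/2\rfloor$, it is $P_{a_k}(\max)\wedge\exists z(P_{a_m}(z)\wedge[a_1\dots a_{m-1}\,z]\wedge[z\,a_{m+1}\dots a_{k-1}\,\max])$. * For $\alpha=a_1\dots a_k$ with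 $k=2^q-1$, $\mathrm{occ}_\alpha(x)$ is $P_{a_1}(x)$ if $k=1$, and otherwise $P_{a_m}(x)\wedge[a_1\dots a_{m-1}\,x]\wedge[x\,a_{m+1}\dots a_k]$ with $m=\lceil k/2\rceil$. * $\mathrm{mult}_{\alpha,\ge n}:=\exists x_1\dots\exists x_n\big(\bigwedge_{i<j}x_i\ne x_j\wedge\bigwedge_i\mathrm{occ}_\alpha(x_i)\wedge\bigwedge_i(d_{>2^{q-1}}(\min,x_i)\wedge d_{>2^{q-1}}(x_i,\max))\big)$. * $\mathrm{left}_\alpha(x):=\exists z(d_{\ge2^{q-1}}(z,x)\wedge\mathrm{occ}_\alpha(z)\wedge d_{>2^{q-1}}(\min,z)\wedge d_{>2^{q-1}}(z,\max))$. $\mathrm{scat}_{\alpha,\ge1}:=\exists x_1\,\mathrm{occ}_\alpha(x_1)$, and for $n\ge2$, $\mathrm{scat}_{\alpha,\ge n}:=\exists x_1(\mathrm{left}_\alpha(x_1)\wedge\exists x_2(d_{>2^q}(x_1,x_2)\wedge\mathrm{left}_\alpha(x_2)\wedge\dots\wedge\exists x_{n-1}(d_{>2^q}(x_{n-2},x_{n-1})\wedge\mathrm{left}_\alpha(x_{n-1})\wedge\exists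 x_n(d_{>2^{q-1}}(x_{n-1},x_n)\wedge\mathrm{occ}_\alpha(x_n)))\dots))$. **Distinguishability formulas.** For $u,v\in A^+$ and $r\in\mathbb N$, $\Phi^r_{u,v}$ is the set of the following sentences: * $d_{\le n}(\min,\max)$ if $|u|<|v|$ and $|u|-1\le n\le\min(2^r,|v|-2)$; $d_{\ge n}(\min,\max)$ if $|u|>|v|$ and $|v|\le n\le\min(2^r+1,|u|-1)$; * for each $k\le\min(2^r,|u|,|v|)$ such that the prefixes $u',v'$ of length $k$ of $u,v$ differ, $\mathrm{pref}_{u'}$ and $\neg\,\mathrm{pref}_{v'}$; likewise for suffixes, with $\mathrm{suff}_{u'}$ and $\neg\,\mathrm{suff}_{v'}$; * for each substring $\alpha$ of $u$ or $v$ with $|\alpha|=2^{q}-1$, $q\ge1$, and each $n\le r-q+1$: $\mathrm{scat}_{\alpha,\ge n}$ if $\sigma(\alpha,v)<n\le\sigma(\alpha,u)$; $\neg\,\mathrm{scat}_{\alpha,\ge n}$ if $\sigma(\alpha,u)<n\le\sigma(\alpha,v)$; $\mathrm{mult}_{\alpha,\ge n}$ if $\gamma(\alpha,v)<n\le\gamma(\alpha,u)$;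 $\neg\,\mathrm{mult}_{\alpha,\ge n}$ if $\gamma(\alpha,u)<n\le\gamma(\alpha,v)$. **Algorithm.** On input $S=(P,N)$: let $r:=\max\{\mathrm{EFsim}(u,v): u\in P,\ v\in N\}$ and return $$\varphi_S:=\bigvee_{u\in P}\ \bigwedge_{v\in N}\ \big(\textbf{choose }\varphi\in\Phi^r_{u,v}\big).$$ **Theorem.** For every finite alphabet $A$, the algorithm can be carried out in time $O(|S|^7)$: there are a deterministic multi-tape (multi-stack) Turing machine and a constant $C$ such that, on every sample $S$ over $A$ (given by listing its positive and then its negative strings), the machine halts after at most $C\,|S|^7+C$ steps with a sentence $\varphi_S$ of the above form as its output, written over a fixed finite alphabet. In particular, $\Phi^r_{u,v}\neq\emptyset$ for all $u\in P$, $v\in N$. -/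

import Mathlib

open FirstOrder FirstOrder.Language

namespace WordLearn

/-! ## First-order sentences over successor string structures -/

/-- The constants `min` and `max` (the only function symbols). -/
inductive WordFunc : ℕ → Type
  | min : WordFunc 0
  | max : WordFunc 0

/-- The successor relation `S` and one unary predicate `P_a` for each letter `a`. -/
inductive WordRel (A : Type) : ℕ → Type
  | letter (a : A) : WordRel A 1
  | succ : WordRel A 2

/-- The vocabulary `{S, (P_a)_{a ∈ A}, min, max}`. -/
def wordLang (A : Type) : Language := ⟨WordFunc, WordRel A⟩

/-- Terms in the bound variables `x_0, …, x_{k-1}`. -/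
abbrev Tm (A : Type) (k : ℕ) : Type := (wordLang A).Term (Empty ⊕ Fin k)

/-- Formulas in the bound variables `x_0, …, x_{k-1}`. -/
abbrev Fm (A : Type) (k : ℕ) : Type := (wordLang A).BoundedFormula Empty k

section Formulas

variable {A : Type}

def tMin {k : ℕ} : Tm A k :=
  Term.func (L := wordLang A) (l := 0) WordFunc.min Fin.elim0

def tMax {k : ℕ} : Tm A k :=
  Term.func (L := wordLang A) (l := 0) WordFunc.max Fin.elim0

def tVar {k : ℕ} (i : Fin k) : Tm A k := Term.var (Sum.inr i)

/-- The variable bound by the innermost quantifier. -/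
def tNew {k : ℕ} : Tm A (k + 1) := tVar (Fin.last k)

/-- The same term, below one more quantifier. -/
def up {k : ℕ} (t : Tm A k) : Tm A (k + 1) := t.relabel (Sum.map id Fin.castSucc)

/-- The atomic formula `P_a(t)`. -/
def fLetter {k : ℕ} (a : A) (t : Tm A k) : Fm A k :=
  Relations.boundedFormula₁ (L := wordLang A) (WordRel.letter a) t

/-- The atomic formula `S(t₁, t₂)`. -/
def fSucc {k : ℕ} (t₁ t₂ : Tm A k) : Fm A k :=
  Relations.boundedFormula₂ (L := wordLang A) WordRel.succ t₁ t₂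

/-- Finite conjunction. -/
def bigAnd {k : ℕ} : List (Fm A k) → Fm A k
  | [] => ⊤
  | [φ] => φ
  | φ :: ψ :: l => φ ⊓ bigAnd (ψ :: l)

/-- Finite disjunction. -/
def bigOr {k : ℕ} : List (Fm A k) → Fm A k
  | [] => ⊥
  | [φ] => φ
  | φ :: ψ :: l => φ ⊔ bigOr (ψ :: l)

/-- The formula `φ^{d(t₁,t₂)}_{≤ n}`. -/
def distLE {k : ℕ} (n : ℕ) (t₁ t₂ : Tm A k) : Fm A k :=
  match n with
  | 0 => Term.bdEqual t₁ t₂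
  | 1 => Term.bdEqual t₁ t₂ ⊔ fSucc t₁ t₂
  | m + 2 =>
    ∃' (distLE ((m + 2) / 2) (up t₁) tNew ⊓ distLE ((m + 3) / 2) tNew (up t₂))
termination_by n

/-- The formula `φ^{d(t₁,t₂)}_{> n}`. -/
def distGT {k : ℕ} (n : ℕ) (t₁ t₂ : Tm A k) : Fm A k := ∼(distLE n t₁ t₂)

/-- The formula `φ^{d(t₁,t₂)}_{≥ n}`, for `n ≥ 1`. -/
def distGE {k : ℕ} (n : ℕ) (t₁ t₂ : Tm A k) : Fm A k := distGT (n - 1) t₁ t₂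

/-- The formula `φ_{t₁ a₁…a_k t₂}`: the string strictly between `t₁` and `t₂` is `a₁…a_k`
(used for `k ≥ 1` only). -/
def between {k : ℕ} (t₁ : Tm A k) (w : List A) (t₂ : Tm A k) : Fm A k :=
  match w with
  | [] => fSucc t₁ t₂
  | [a] => ∃' (fLetter a tNew ⊓ fSucc (up t₁) tNew ⊓ fSucc tNew (up t₂))
  | [a, b] => ∃' (fLetter a tNew ⊓ fSucc (up t₁) tNew ⊓ between tNew [b] (up t₂))
  | a :: b :: c :: l =>
    let w : List A := a :: b :: c :: l
    let m : ℕ := (w.length + 1) / 2 - 1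
    ∃' (fLetter (w[m]'(by grind)) tNew ⊓ between (up t₁) (w.take m) tNew
        ⊓ between tNew (w.drop (m + 1)) (up t₂))
termination_by w.length
decreasing_by all_goals grind

/-- The formula `φ_{t a₁…a_k}`: the string `a₁…a_k` occurs immediately to the right of `t`
(used for `k ≥ 1` only). -/
def after {k : ℕ} (t : Tm A k) (w : List A) : Fm A k :=
  match w with
  | [] => ⊤
  | [a] => ∃' (fSucc (up t) tNew ⊓ fLetter a tNew)
  | [a, b] => ∃' (fLetter a tNew ⊓ fSucc (up t) tNew ⊓ after tNew [b])
  | a :: b :: c :: l =>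
    let w : List A := a :: b :: c :: l
    let m : ℕ := (w.length + 1) / 2 - 1
    ∃' (fLetter (w[m]'(by grind)) tNew ⊓ between (up t) (w.take m) tNew
        ⊓ after tNew (w.drop (m + 1)))
termination_by w.length
decreasing_by all_goals grind

/-- The formula `φ_{a₁…a_k t}`: the string `a₁…a_k` occurs immediately to the left of `t`
(used for `k ≥ 1` only). -/
def before {k : ℕ} (w : List A) (t : Tm A k) : Fm A k :=
  match w with
  | [] => ⊤
  | [a] => ∃' (fSucc tNew (up t) ⊓ fLetter a tNew)
  | [a, b] => ∃' (fLetter a tNew ⊓ between tNew [b] (up t))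
  | a :: b :: c :: l =>
    let w : List A := a :: b :: c :: l
    let m : ℕ := (w.length + 1) / 2 - 1
    ∃' (fLetter (w[m]'(by grind)) tNew ⊓ before (w.take m) tNew
        ⊓ between tNew (w.drop (m + 1)) (up t))
termination_by w.length
decreasing_by all_goals grind

/-- The sentence `φ_{pref_k = a₁…a_k}` (used for `k ≥ 1` only). -/
def prefEq (w : List A) : Fm A 0 :=
  match w with
  | [] => ⊤
  | [a] => fLetter a tMin
  | [a, b] => fLetter a tMin ⊓ after tMin [b]
  | [a, b, c] => fLetter a tMin ⊓ after tMin [b, c]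
  | a :: b :: c :: d :: l =>
    let w : List A := a :: b :: c :: d :: l
    let m : ℕ := (w.length + 2) / 2 - 1
    fLetter a tMin ⊓
      ∃' (fLetter (w[m]'(by grind)) tNew ⊓ between tMin ((w.take m).drop 1) tNew
        ⊓ after tNew (w.drop (m + 1)))

/-- The sentence `φ_{suff_k = a₁…a_k}` (used for `k ≥ 1` only). -/
def suffEq (w : List A) : Fm A 0 :=
  match w with
  | [] => ⊤
  | [a] => fLetter a tMax
  | [a, b] => fLetter b tMax ⊓ before [a] tMax
  | [a, b, c] => fLetter c tMax ⊓ before [a, b] tMax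
  | a :: b :: c :: d :: l =>
    let w : List A := a :: b :: c :: d :: l
    let m : ℕ := w.length / 2 - 1
    fLetter (w[w.length - 1]'(by grind)) tMax ⊓
      ∃' (fLetter (w[m]'(by grind)) tNew ⊓ before (w.take m) tNew
        ⊓ between tNew (w.dropLast.drop (m + 1)) tMax)

/-- The formula `φ_α(x)`: the string `α`, of odd length, occurs centered on `x`. -/
def occ {k : ℕ} (α : List A) (x : Tm A k) : Fm A k :=
  match α with
  | [] => ⊤
  | [a] => fLetter a x
  | a :: b :: l =>
    let w : List A := a :: b :: l
    let m : ℕ := (w.length + 1) / 2 - 1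
    fLetter (w[m]'(by grind)) x ⊓ before (w.take m) x ⊓ after x (w.drop (m + 1))

/-- The sentence `φ_{γ(α) ≥ n}`, where `|α| = 2 ^ q - 1`. -/
def multGE (q : ℕ) (α : List A) (n : ℕ) : Fm A 0 :=
  BoundedFormula.exs (n := n) <| bigAnd <|
    ((List.finRange n).flatMap fun i =>
      ((List.finRange n).filter fun j => i < j).map fun j =>
        ∼(Term.bdEqual (tVar i : Tm A n) (tVar j))) ++
    ((List.finRange n).map fun i => occ α (tVar i)) ++
    ((List.finRange n).map fun i =>
      distGT (2 ^ (q - 1)) tMin (tVar i) ⊓ distGT (2 ^ (q - 1)) (tVar i) tMax)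

/-- The formula `φ_α^{d(x) ≥ 2 ^ (q - 1)}`. -/
def occLeft {k : ℕ} (q : ℕ) (α : List A) (x : Tm A k) : Fm A k :=
  ∃' (distGE (2 ^ (q - 1)) tNew (up x) ⊓ occ α tNew ⊓
    distGT (2 ^ (q - 1)) tMin tNew ⊓ distGT (2 ^ (q - 1)) tNew tMax)

/-- The part of `φ_{σ(α) ≥ n}` that follows the variable `x = x_i`, where `i = n - 1 - m`. -/
def scatTail {k : ℕ} (q : ℕ) (α : List A) (m : ℕ) (x : Tm A k) : Fm A k :=
  match m with
  | 0 => ∃' (distGT (2 ^ (q - 1)) (up x) tNew ⊓ occ α tNew)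
  | m + 1 => ∃' (distGT (2 ^ q) (up x) tNew ⊓ occLeft q α tNew ⊓ scatTail q α m tNew)

/-- The sentence `φ_{σ(α) ≥ n}`, where `|α| = 2 ^ q - 1` (used for `n ≥ 1` only). -/
def scatGE (q : ℕ) (α : List A) (n : ℕ) : Fm A 0 :=
  match n with
  | 0 => ⊤
  | 1 => ∃' (occ α tNew)
  | m + 2 => ∃' (occLeft q α tNew ⊓ scatTail q α m tNew)

end Formulas

/-! ## Free multiplicity and free scattering -/

section Occurrences

open Classical in
/-- The set `Γ(α, w)` of (centers of) free occurrences of `α` in `w`, where `|α| = 2 ^ q - 1`;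
positions are counted from `0`. -/
noncomputable def freeOcc {A : Type} (q : ℕ) (α w : List A) : Finset ℕ :=
  (Finset.range w.length).filter fun i =>
    2 ^ (q - 1) < i ∧ 2 ^ (q - 1) < w.length - 1 - i ∧
      (w.drop (i - (2 ^ (q - 1) - 1))).take (2 ^ q - 1) = α

/-- All parts of the partition have diameter at most `l` and are convex within `s`. -/
def IsSegmented (l : ℕ) {s : Finset ℕ} (p : Finpartition s) : Prop :=
  ∀ X ∈ p.parts, ∀ i ∈ X, ∀ j ∈ X, Nat.dist i j ≤ l ∧ ∀ h ∈ s, i ≤ h → h ≤ j → h ∈ X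

/-- The number of segments of an `l`-segmentation of `s`. -/
noncomputable def numSegments (l : ℕ) (s : Finset ℕ) : ℕ :=
  sInf {c | ∃ p : Finpartition s, IsSegmented l p ∧ p.parts.card = c}

/-- The free multiplicity `γ(α, w)`. -/
noncomputable def freeMult {A : Type} (q : ℕ) (α w : List A) : ℕ := (freeOcc q α w).card

/-- The free scattering `σ(α, w)`. -/
noncomputable def freeScat {A : Type} (q : ℕ) (α w : List A) : ℕ :=
  numSegments (2 ^ q) (freeOcc q α w)

end Occurrences

/-! ## Ehrenfeucht–Fraïssé games on strings -/

section Games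

variable {A : Type}

/-- The elements of the structure of `w` named by `min`, by `max`, or picked in a play. -/
def named (w : List A) (a : List (Fin w.length)) : List ℕ :=
  0 :: (w.length - 1) :: a.map Fin.val

/-- The picked elements, in the order of the play, define an isomorphism between the induced
substructures (which contain the constants `min` and `max`). -/
def IsPartialIso (u v : List A) (a : List (Fin u.length)) (b : List (Fin v.length)) : Prop :=
  (named u a).length = (named v b).length ∧
  ∀ i < (named u a).length, ∀ j < (named u a).length,
    let x := (named u a).getD i 0
    let x' := (named u a).getD j 0
    let y := (named v b).getD i 0
    let y' := (named v b).getD j 0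
    (x = x' ↔ y = y') ∧ (x' = x + 1 ↔ y' = y + 1) ∧ u[x]? = v[y]?

/-- The Spoiler has a winning strategy in the remaining `r` rounds on `u` and `v`, after the
elements `a` and `b` have been picked. -/
def SpoilerWinsFrom (u v : List A) :
    ℕ → List (Fin u.length) → List (Fin v.length) → Prop
  | 0, a, b => ¬ IsPartialIso u v a b
  | r + 1, a, b =>
    (∃ x, ∀ y, SpoilerWinsFrom u v r (a ++ [x]) (b ++ [y])) ∨
    (∃ y, ∀ x, SpoilerWinsFrom u v r (a ++ [x]) (b ++ [y]))

/-- The Spoiler has a winning strategy in the game `G_r(u, v)`. -/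
def SpoilerWins (r : ℕ) (u v : List A) : Prop := SpoilerWinsFrom u v r [] []

/-- The EF-similarity of two distinct strings: the least number of rounds for which the Spoiler
has a winning strategy. -/
noncomputable def EFsim (u v : List A) : ℕ := sInf {r | SpoilerWins r u v}

end Games

/-! ## Distinguishability formulas -/

section Distinguishability

variable {A : Type}

/-- The suffix of length `k`. -/
def suff (k : ℕ) (w : List A) : List A := w.drop (w.length - k)

def PhiLength (r : ℕ) (u v : List A) : Set (Fm A 0) :=
  {φ | ∃ n, u.length < v.length ∧ u.length - 1 ≤ n ∧ n ≤ 2 ^ r ∧ n ≤ v.length - 2 ∧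
      φ = distLE n tMin tMax} ∪
  {φ | ∃ n, v.length < u.length ∧ v.length ≤ n ∧ n ≤ 2 ^ r + 1 ∧ n ≤ u.length - 1 ∧
      φ = distGE n tMin tMax}

def PhiPref (r : ℕ) (u v : List A) : Set (Fm A 0) :=
  {φ | ∃ k, u.take k ≠ v.take k ∧ k ≤ 2 ^ r ∧ k ≤ u.length ∧ k ≤ v.length ∧
      (φ = prefEq (u.take k) ∨ φ = ∼(prefEq (v.take k)))}

def PhiSuff (r : ℕ) (u v : List A) : Set (Fm A 0) :=
  {φ | ∃ k, suff k u ≠ suff k v ∧ k ≤ 2 ^ r ∧ k ≤ u.length ∧ k ≤ v.length ∧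
      (φ = suffEq (suff k u) ∨ φ = ∼(suffEq (suff k v)))}

/-- The bound `n ≤ r - q + 1` between integers is written `n + q ≤ r + 1`. -/
def PhiSub (r : ℕ) (u v : List A) : Set (Fm A 0) :=
  {φ | ∃ (q : ℕ) (α : List A) (n : ℕ), 0 < q ∧ α.length = 2 ^ q - 1 ∧ (α <:+: u ∨ α <:+: v) ∧
      n + q ≤ r + 1 ∧
      ((freeScat q α v < n ∧ n ≤ freeScat q α u ∧ φ = scatGE q α n) ∨
       (freeScat q α u < n ∧ n ≤ freeScat q α v ∧ φ = ∼(scatGE q α n)) ∨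
       (freeMult q α v < n ∧ n ≤ freeMult q α u ∧ φ = multGE q α n) ∨
       (freeMult q α u < n ∧ n ≤ freeMult q α v ∧ φ = ∼(multGE q α n)))}

/-- The set `Φ^r_{u,v}` of distinguishability formulas. -/
def Phi (r : ℕ) (u v : List A) : Set (Fm A 0) :=
  PhiLength r u v ∪ PhiPref r u v ∪ PhiSuff r u v ∪ PhiSub r u v

end Distinguishability

/-! ## Samples and the algorithm -/

/-- A sample: two disjoint finite sets of (nonempty) strings, each given by a listing without
repetitions. -/
structure Sample (A : Type) where
  pos : List (List A)
  neg : List (List A)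
  pos_nodup : pos.Nodup
  neg_nodup : neg.Nodup
  disjoint : pos.Disjoint neg
  pos_ne_nil : ∀ w ∈ pos, w ≠ []
  neg_ne_nil : ∀ w ∈ neg, w ≠ []

namespace Sample

variable {A : Type} (S : Sample A)

/-- The size of a sample: the sum of the lengths of its strings. -/
def size : ℕ := (S.pos.map List.length).sum + (S.neg.map List.length).sum

/-- The number `max {EFsim(u, v) | u ∈ P, v ∈ N}`. -/
noncomputable def rank : ℕ :=
  (S.pos.map fun u => (S.neg.map fun v => EFsim u v).foldr max 0).foldr max 0

/-- The sentences `⋁_{u ∈ P} ⋀_{v ∈ N} (choose φ ∈ Φ^r_{u,v})`, one for each way to choose,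
where `r = max {EFsim(u, v) | u ∈ P, v ∈ N}`. -/
def IsOutput (φ : (wordLang A).Sentence) : Prop :=
  ∃ c : List A → List A → Fm A 0,
    (∀ u ∈ S.pos, ∀ v ∈ S.neg, c u v ∈ Phi S.rank u v) ∧
    φ = bigOr (S.pos.map fun u => bigAnd (S.neg.map fun v => c u v))

end Sample

/-! ## Input and output of the machine -/

/-- The input alphabet: the letters, an end marker for strings, and an end marker for the list of
positive strings. -/
inductive InSym (A : Type) : Type
  | letter (a : A)
  | endString
  | endPos

/-- The output alphabet. -/
inductive OutSym (A : Type) : Type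
  | letter (a : A)
  | succ
  | eq
  | bot
  | imp
  | all
  | min
  | max
  | tick
  | var

section Coding

variable {A : Type}

def encodeStrings (l : List (List A)) : List (InSym A) :=
  l.flatMap fun w => w.map InSym.letter ++ [InSym.endString]

/-- The word over the input alphabet that presents a sample. -/
def encodeSample (S : Sample A) : List (InSym A) :=
  encodeStrings S.pos ++ [InSym.endPos] ++ encodeStrings S.neg

def encodeFunc {l : ℕ} : WordFunc l → List (OutSym A)
  | WordFunc.min => [OutSym.min]
  | WordFunc.max => [OutSym.max]

def encodeRel {l : ℕ} (R : WordRel A l) (ts : Fin l → List (OutSym A)) : List (OutSym A) :=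
  match R, ts with
  | WordRel.letter a, ts => OutSym.letter a :: ts 0
  | WordRel.succ, ts => OutSym.succ :: (ts 0 ++ ts 1)

/-- The variable `x_i` is written as `i` ticks followed by the symbol `var`. -/
def encodeTerm {k : ℕ} : Tm A k → List (OutSym A)
  | Term.var (Sum.inl e) => e.elim
  | Term.var (Sum.inr i) => List.replicate i OutSym.tick ++ [OutSym.var]
  | Term.func f _ => encodeFunc f

/-- Formulas in Polish notation. A quantifier below `i` others binds the variable `x_i`. -/
def encodeFormula {k : ℕ} : Fm A k → List (OutSym A)
  | BoundedFormula.falsum => [OutSym.bot]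
  | BoundedFormula.equal s t => OutSym.eq :: (encodeTerm s ++ encodeTerm t)
  | BoundedFormula.rel R ts => encodeRel R fun i => encodeTerm (ts i)
  | BoundedFormula.imp φ ψ => OutSym.imp :: (encodeFormula φ ++ encodeFormula ψ)
  | BoundedFormula.all φ => OutSym.all :: encodeFormula φ

end Coding

end WordLearn

/-! The machine never computes an EF-similarity and never uses a multiplicity formula. For a pair of
strings `u`, `v` it determines the least `r` for which `Feature r u v` holds, that is, for which the
strings differ visibly in length, in the prefix or suffix of length `radius r u v`, or in whether
some `α` of length `2 ^ q - 1` has `n` free occurrences with gaps above `2 ^ q`, where `n + q = r +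
1`. By `le_numSegments_iff` the last condition says `σ(α) ≥ n`: the minimal number of segments
equals the maximal number of points with large gaps. Each feature at level `r` directly names an
element of `Phi r u v`.

The central point is `Feature.of_spoilerWins`: without a feature at level `r` the Duplicator
survives `r` rounds. Hence the least feature level of a pair is at most `EFsim u v`, hence at most
the rank of the sample, and by `Phi_mono` the formula found for the pair lies in the set for the
global `r`. So every pair can be treated on its own, and all sets are nonempty.

The strategy keeps distances up to `2 ^ m` and neighbourhoods of radius `2 ^ m - 1` equal when `m`
rounds remain (`Inv`). A pick near an old one is answered by translation. In `Inv.step`, a pick `x`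
far from all old ones is a free occurrence of its neighbourhood `α`, and a far free occurrence of
`α` in the other string is a good answer. If there is none, the occurrences in `v` cluster around
the old picks, so their scattering is small. Then it is small in `u` as well, and all occurrences in
`u` are covered by a few intervals. The induction hypothesis lets the Duplicator answer the centers
of these intervals in an auxiliary play, which injects the occurrences in `u` into those in `v`. The
actual play injects the occurrences in `v` into those in `u` other than `x`, a contradiction by
counting. This is why scattering alone suffices.

For the running time, let `N` be the input length plus one and `l` its logarithm. Testing one center
for an occurrence takes `N ^ 2` steps, a search for the next center `N ^ 3`, and a greedy test of
scattering makes at most about `l` such searches, because only `n ≤ l` matter. Ranging over all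
start positions, over the exponents `q` and over the levels `r` contributes factors `N`, `l` and
`l`, so a pair costs `N ^ 4 * l ^ 3`. Its formula is written from a work list, as a leftmost
derivation in a grammar, in time `N ^ 4`. At most `N ^ 2` pairs give `N ^ 6 * l ^ 3`, which is `O(N
^ 7)`. These bounds are proved compositionally by the predicates `Comp` and `Emit` for register
programs, which compile to machines by `Cmd.exists_machine`. -/

namespace WordLearn

/-! ## A structured language of stack programs, and its translation to Turing machines -/

/-- Structured programs over stacks indexed by `K`. -/
inductive Cmd {K : Type} (Γ : K → Type) : Type
  | skip : Cmd Γ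
  | push (k : K) (a : Γ k) : Cmd Γ
  | pop (k : K) : Cmd Γ
  | seq (c₁ c₂ : Cmd Γ) : Cmd Γ
  | cases (k : K) (f : Option (Γ k) → Cmd Γ) : Cmd Γ
  | loop (k : K) (p : Option (Γ k) → Bool) (c : Cmd Γ) : Cmd Γ

namespace Cmd

variable {K : Type} {Γ : K → Type}

/-- `Exec c s s' t`: the program `c` transforms the stacks `s` into `s'` in `t` steps. -/
inductive Exec [DecidableEq K] : Cmd Γ → (∀ k, List (Γ k)) → (∀ k, List (Γ k)) → ℕ → Prop
  | skip {s} : Exec skip s s 1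
  | push {s} {k : K} {a : Γ k} : Exec (push k a) s (Function.update s k (a :: s k)) 1
  | pop {s} {k : K} : Exec (pop k) s (Function.update s k (s k).tail) 1
  | seq {c₁ c₂ : Cmd Γ} {s₁ s₂ s₃ t₁ t₂} (h₁ : Exec c₁ s₁ s₂ t₁) (h₂ : Exec c₂ s₂ s₃ t₂) :
      Exec (seq c₁ c₂) s₁ s₃ (t₂ + t₁)
  | cases {k : K} {f : Option (Γ k) → Cmd Γ} {s s' t} (h : Exec (f (s k).head?) s s' t) :
      Exec (cases k f) s s' (t + 1)
  | loop_false {k : K} {p : Option (Γ k) → Bool} {c : Cmd Γ} {s} (hp : p (s k).head? = false) :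
      Exec (loop k p c) s s 1
  | loop_true {k : K} {p : Option (Γ k) → Bool} {c : Cmd Γ} {s₁ s₂ s₃ t₁ t₂}
      (hp : p (s₁ k).head? = true) (h₁ : Exec c s₁ s₂ t₁) (h₂ : Exec (loop k p c) s₂ s₃ t₂) :
      Exec (loop k p c) s₁ s₃ (t₂ + (t₁ + 1))

/-- A step pushes at most one symbol. This bounds the length of the output by the running time, and
so the cost of reversing it at the end. -/
theorem Exec.length_le [DecidableEq K] {c : Cmd Γ} {s s' t} (h : Exec c s s' t) (k : K) :
    (s' k).length ≤ (s k).length + t := by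
  induction h with
  | skip => simp
  | @push s k' a => by_cases h : k = k'
                    · subst h; simp
                    · simp [h]
  | @pop s k' => by_cases h : k = k'
                 · subst h; simp; omega
                 · simp [h]
  | seq _ _ ih₁ ih₂ => omega
  | cases _ ih => omega
  | loop_false => omega
  | loop_true _ _ _ ih₁ ih₂ => omega

/-- All stacks that the program touches satisfy `P`. -/
def Within (P : K → Prop) : Cmd Γ → Prop
  | skip => True
  | push k _ => P k
  | pop k => P k
  | seq c₁ c₂ => c₁.Within P ∧ c₂.Within P
  | cases k f => P k ∧ ∀ o, (f o).Within P
  | loop k _ c => P k ∧ c.Within P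

theorem Within.mono {P Q : K → Prop} (h : ∀ k, P k → Q k) {c : Cmd Γ} (hc : c.Within P) :
    c.Within Q := by
  induction c with
  | skip => trivial
  | push k _ => exact h _ hc
  | pop k => exact h _ hc
  | seq c₁ c₂ ih₁ ih₂ => exact ⟨ih₁ hc.1, ih₂ hc.2⟩
  | cases k f ih => exact ⟨h _ hc.1, fun o => ih o (hc.2 o)⟩
  | loop k p c ih => exact ⟨h _ hc.1, ih hc.2⟩

/-- A machine has finitely many stacks, whereas registers are indexed by all natural numbers.
Finiteness of the alphabets is needed because a case distinction has one branch for each symbol. -/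
theorem exists_within [DecidableEq K] [∀ k, Finite (Γ k)] (c : Cmd Γ) :
    ∃ F : Finset K, c.Within (· ∈ F) := by
  induction c with
  | skip => exact ⟨∅, trivial⟩
  | push k _ => exact ⟨{k}, by simp [Within]⟩
  | pop k => exact ⟨{k}, by simp [Within]⟩
  | seq c₁ c₂ ih₁ ih₂ =>
    obtain ⟨F₁, h₁⟩ := ih₁
    obtain ⟨F₂, h₂⟩ := ih₂
    exact ⟨F₁ ∪ F₂, h₁.mono (by simp +contextual), h₂.mono (by simp +contextual)⟩
  | cases k f ih =>
    choose F hF using ih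
    have := Fintype.ofFinite (Option (Γ k))
    refine ⟨insert k (Finset.univ.biUnion F), by simp, fun o => (hF o).mono fun x hx => ?_⟩
    exact Finset.mem_insert_of_mem (Finset.mem_biUnion.2 ⟨o, Finset.mem_univ _, hx⟩)
  | loop k p c ih =>
    obtain ⟨F, h⟩ := ih
    exact ⟨insert k F, by simp, h.mono (by simp +contextual)⟩

/-- The labels of the translation of a program. -/
def Lab : Cmd Γ → Type
  | skip => Unit
  | push _ _ => Unit
  | pop _ => Unit
  | seq c₁ c₂ => c₁.Lab ⊕ c₂.Lab
  | cases _ f => Option (Σ o, (f o).Lab)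
  | loop _ _ c => Option c.Lab

theorem finite_lab [∀ k, Finite (Γ k)] : ∀ c : Cmd Γ, Finite c.Lab
  | skip => inferInstanceAs (Finite Unit)
  | push _ _ => inferInstanceAs (Finite Unit)
  | pop _ => inferInstanceAs (Finite Unit)
  | seq c₁ c₂ =>
    have := finite_lab c₁
    have := finite_lab c₂
    inferInstanceAs (Finite (c₁.Lab ⊕ c₂.Lab))
  | cases _ f =>
    have := fun o => finite_lab (f o)
    inferInstanceAs (Finite (Option (Σ o, (f o).Lab)))
  | loop _ _ c =>
    have := finite_lab c
    inferInstanceAs (Finite (Option c.Lab))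

/-- The label at which the translation of a program is entered. -/
def entry : ∀ c : Cmd Γ, c.Lab
  | skip => ()
  | push _ _ => ()
  | pop _ => ()
  | seq c₁ _ => Sum.inl c₁.entry
  | cases _ _ => none
  | loop _ _ _ => none

/-! ### Translation of structured programs to multi-stack machines. -/

section Compile

variable [DecidableEq K] (F : Finset K)

/-- The stacks of the machine. -/
abbrev MStk (F : Finset K) : Type := {k : K // k ∈ F}

abbrev MSym (Γ : K → Type) (F : Finset K) (k : MStk F) : Type := Γ k.1

/-- The local state of the machine: the last symbol seen. -/
abbrev MSt (Γ : K → Type) (F : Finset K) : Type := Option (Σ k : MStk F, MSym Γ F k)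

/-- A jump of the machine depends on its local state only, so a branch first records the inspected
symbol there by `saw` and then reads it back by `seen`, all in one step. -/
def seen (v : MSt Γ F) (k : MStk F) : Option (Γ k.1) :=
  match v with
  | none => none
  | some ⟨k', a⟩ => if h : k' = k then some (h ▸ a) else none

def saw (k : MStk F) (o : Option (Γ k.1)) : MSt Γ F := o.map (Sigma.mk k)

theorem seen_saw (k : MStk F) (o : Option (Γ k.1)) : seen F (saw F k o) k = o := by
  cases o <;> simp [seen, saw]

open Turing.TM2.Stmt in
/-- The statement of the machine at a label of `c`, when `c` exits to `ret`. -/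
def comp {Λ : Type} : ∀ (c : Cmd Γ) (_ : Λ) (_ : c.Lab → Λ) (_ : c.Lab),
    Turing.TM2.Stmt (MSym Γ F) Λ (MSt Γ F)
  | skip, ret, _, _ => goto fun _ => ret
  | push k a, ret, _, _ =>
    if h : k ∈ F then Turing.TM2.Stmt.push ⟨k, h⟩ (fun _ => a) (goto fun _ => ret) else halt
  | pop k, ret, _, _ =>
    if h : k ∈ F then Turing.TM2.Stmt.pop ⟨k, h⟩ (fun v _ => v) (goto fun _ => ret) else halt
  | seq c₁ c₂, _, emb, Sum.inl l =>
    comp c₁ (emb (Sum.inr c₂.entry)) (fun l => emb (Sum.inl l)) l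
  | seq _ c₂, ret, emb, Sum.inr l => comp c₂ ret (fun l => emb (Sum.inr l)) l
  | cases k f, _, emb, none =>
    if h : k ∈ F then peek ⟨k, h⟩ (fun _ o => saw F ⟨k, h⟩ o)
      (goto fun v => emb (some ⟨seen F v ⟨k, h⟩, (f (seen F v ⟨k, h⟩)).entry⟩)) else halt
  | cases _ f, ret, emb, some ⟨o, l⟩ => comp (f o) ret (fun l => emb (some ⟨o, l⟩)) l
  | loop k p c, ret, emb, none =>
    if h : k ∈ F then peek ⟨k, h⟩ (fun _ o => saw F ⟨k, h⟩ o)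
      (goto fun v => if p (seen F v ⟨k, h⟩) then emb (some c.entry) else ret) else halt
  | loop _ _ c, _, emb, some l => comp c (emb none) (fun l => emb (some l)) l

/-- The stacks of the machine that correspond to the stacks of the program. -/
def mstk (s : ∀ k, List (Γ k)) (k : MStk F) : List (Γ k.1) := s k.1

theorem mstk_update (s : ∀ k, List (Γ k)) (k : K) (h : k ∈ F) (x : List (Γ k)) :
    mstk F (Function.update s k x) = Function.update (mstk F s) ⟨k, h⟩ x := by
  funext ⟨k', h'⟩
  by_cases e : k' = k
  · subst e; simp [mstk]
  · simp [mstk, e]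

/-- By induction on the execution, with the exit label and the embedding of labels left arbitrary so
that sequences and loops can be glued. The initial local state is arbitrary because it is always
overwritten before it is used, and step counts agree exactly. -/
theorem comp_reaches {Λ : Type} (M : Λ → Turing.TM2.Stmt (MSym Γ F) Λ (MSt Γ F)) {c : Cmd Γ}
    {s s' t} (h : Exec c s s' t) :
    ∀ (ret : Λ) (emb : c.Lab → Λ), c.Within (· ∈ F) → (∀ l, M (emb l) = comp F c ret emb l) →
    ∀ v, ∃ v', (flip bind (Turing.TM2.step M))^[t]
      (some ⟨some (emb c.entry), v, mstk F s⟩) = some ⟨some ret, v', mstk F s'⟩ := by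
  induction h with
  | skip => 
    intro ret emb hw hM v
    exact ⟨v, by simp [flip, hM, comp]⟩
  | @push s k a =>
    intro ret emb hw hM v
    have hk : k ∈ F := hw
    refine ⟨v, ?_⟩
    simp [flip, hM, comp, hk, mstk_update F s k hk]
    rfl
  | @pop s k =>
    intro ret emb hw hM v
    have hk : k ∈ F := hw
    refine ⟨v, ?_⟩
    simp [flip, hM, comp, hk, mstk_update F s k hk]
    rfl
  | @seq c₁ c₂ s₁ s₂ s₃ t₁ t₂ _ _ ih₁ ih₂ =>
    intro ret emb hw hM v
    obtain ⟨v₁, h₁⟩ := ih₁ (emb (Sum.inr c₂.entry)) (fun l => emb (Sum.inl l)) hw.1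
      (fun l => hM (Sum.inl l)) v
    obtain ⟨v₂, h₂⟩ := ih₂ ret (fun l => emb (Sum.inr l)) hw.2 (fun l => hM (Sum.inr l)) v₁
    refine ⟨v₂, ?_⟩
    rw [Function.iterate_add_apply]
    exact (congrArg _ h₁).trans h₂
  | @cases k f s s' t _ ih =>
    intro ret emb hw hM v
    have hk : k ∈ F := hw.1
    obtain ⟨v₁, h₁⟩ := ih ret (fun l => emb (some ⟨_, l⟩)) (hw.2 _) (fun l => hM (some ⟨_, l⟩))
      (saw F ⟨k, hk⟩ (s k).head?)
    refine ⟨v₁, ?_⟩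
    rw [Function.iterate_succ_apply, ← h₁]
    congr 1
    have := hM none
    simp only [comp, hk, dif_pos] at this
    change some (Turing.TM2.stepAux (M (emb none)) _ _) = _
    rw [this]
    simp only [Turing.TM2.stepAux]
    exact congrArg (fun o => some (Turing.TM2.Cfg.mk (some (emb (some ⟨o, (f o).entry⟩)))
      (saw F ⟨k, hk⟩ (s k).head?) (mstk F s))) (seen_saw F ⟨k, hk⟩ (s k).head?)
  | @loop_false k p c s hp =>
    intro ret emb hw hM v
    have hk : k ∈ F := hw.1
    refine ⟨saw F ⟨k, hk⟩ (s k).head?, ?_⟩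
    have := hM none
    simp only [comp, hk, dif_pos] at this
    change some (Turing.TM2.stepAux (M (emb none)) _ _) = _
    rw [this]
    simp only [Turing.TM2.stepAux]
    change some (Turing.TM2.Cfg.mk
      (some (if p (seen F (saw F ⟨k, hk⟩ (s k).head?) ⟨k, hk⟩) = true then _ else _))
      _ _) = _
    have e := seen_saw F ⟨k, hk⟩ (s k).head?
    rw [e, hp]
    simp only [Bool.false_eq_true, if_false]
    rfl
  | @loop_true k p c s₁ s₂ s₃ t₁ t₂ hp _ _ ih₁ ih₂ =>
    intro ret emb hw hM v
    have hk : k ∈ F := hw.1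
    obtain ⟨v₁, h₁⟩ := ih₁ (emb none) (fun l => emb (some l)) hw.2
      (fun l => hM (some l)) (saw F ⟨k, hk⟩ (s₁ k).head?)
    obtain ⟨v₂, h₂⟩ := ih₂ ret emb hw hM v₁
    refine ⟨v₂, ?_⟩
    rw [Function.iterate_add_apply, ← h₂]
    congr 1
    rw [Function.iterate_succ_apply]
    refine Eq.trans ?_ h₁
    congr 1
    have := hM none
    simp only [comp, hk, dif_pos] at this
    change some (Turing.TM2.stepAux (M (emb none)) _ _) = _
    rw [this]
    simp only [Turing.TM2.stepAux]
    change some (Turing.TM2.Cfg.mk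
      (some (if p (seen F (saw F ⟨k, hk⟩ (s₁ k).head?) ⟨k, hk⟩) = true then _ else _))
      _ _) = _
    have e := seen_saw F ⟨k, hk⟩ (s₁ k).head?
    rw [e, hp]
    simp only [if_true]
    rfl

end Compile

/-- A program that turns the input on the stack `k₀` into the output on the stack `k₁`, and
leaves all other stacks empty, gives a Turing machine. -/
theorem exists_machine [DecidableEq K] [∀ k, Finite (Γ k)] (c : Cmd Γ) (k₀ k₁ : K) :
    ∃ M : Turing.TM2ComputableAux (Γ k₀) (Γ k₁), ∀ x y t,
      Exec c (Function.update (fun _ => []) k₀ x) (Function.update (fun _ => []) k₁ y) t →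
      Nonempty (Turing.TM2OutputsInTime M.tm (x.map M.inputAlphabet.symm)
        (some (y.map M.outputAlphabet.symm)) (t + 1)) := by
  obtain ⟨F₀, hF₀⟩ := exists_within c
  let F : Finset K := F₀ ∪ {k₀, k₁}
  have hF : c.Within (· ∈ F) := hF₀.mono (by simp +contextual [F])
  have h₀ : k₀ ∈ F := by simp [F]
  have h₁ : k₁ ∈ F := by simp [F]
  have := finite_lab c
  let m : Option c.Lab → Turing.TM2.Stmt (MSym Γ F) (Option c.Lab) (MSt Γ F) := fun l =>
    match l with
    -- A halting configuration must carry the initial local state, so the exit label resets it; this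
    -- is the one additional step in the time bound.
    | none => Turing.TM2.Stmt.load (fun _ => none) Turing.TM2.Stmt.halt
    | some l => comp F c none some l
  let tm : Turing.FinTM2 :=
    { K := MStk F
      k₀ := ⟨k₀, h₀⟩
      k₁ := ⟨k₁, h₁⟩
      Γ := MSym Γ F
      Λ := Option c.Lab
      main := some c.entry
      ΛFin := Fintype.ofFinite _
      σ := MSt Γ F
      initialState := none
      σFin := Fintype.ofFinite _
      Γk₀Fin := Fintype.ofFinite _
      m := m }
  refine ⟨⟨tm, Equiv.refl _, Equiv.refl _⟩, fun x y t h => ?_⟩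
  obtain ⟨v, hv⟩ := comp_reaches F m h none some hF (fun l => rfl) none
  have ini : ∀ (k : K) (hk : k ∈ F) (z : List (Γ k)), (fun k' : MStk F => @dite (List (MSym Γ F k')) (k' = ⟨k, hk⟩) (tm.kDecidableEq k' _)
      (fun h => by rw [h]; exact z) fun _ => []) = mstk F (Function.update (fun _ => []) k z) := by
    intro k hk z
    funext ⟨k', hk'⟩
    by_cases e : k' = k
    · subst e; simp [mstk]
    · simp [mstk, e]
  refine ⟨⟨⟨t + 1, ?_⟩, le_rfl⟩⟩
  rw [Function.iterate_succ_apply']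
  have e₀ : Turing.initList tm (x.map (Equiv.refl (Γ k₀)).symm) =
      ⟨some (some c.entry), none, mstk F (Function.update (fun _ => []) k₀ x)⟩ := by
    simp only [Turing.initList]
    congr 1
    rw [← ini k₀ h₀ x]
    simp; rfl
  have e₁ : Turing.haltList tm (y.map (Equiv.refl (Γ k₁)).symm) =
      ⟨none, none, mstk F (Function.update (fun _ => []) k₁ y)⟩ := by
    simp only [Turing.haltList]
    congr 1
    rw [← ini k₁ h₁ y]
    simp; rfl
  refine (congrArg (flip bind tm.step) ((congrArg (fun z => (flip bind tm.step)^[t] (some z)) e₀).trans hv)).trans ?_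
  refine Eq.trans ?_ (congrArg some e₁.symm)
  rfl

end Cmd

/-! ## Register programs -/

/-- The stacks of register programs: the input and a scratch stack for it, two sinks for symbols,
the output of the machine, and registers in unary. -/
inductive Stk : Type
  | inp
  | aux
  | sink (g : Bool)
  | res
  | reg (i : ℕ)
  deriving DecidableEq

abbrev Sym (A : Type) : Stk → Type
  | .inp => InSym A
  | .aux => InSym A
  | .sink _ => OutSym A
  | .res => OutSym A
  | .reg _ => Unit

/-- The states of register programs. -/
@[ext]
structure St (A : Type) where
  inp : List (InSym A)
  aux : List (InSym A)
  sink : Bool → List (OutSym A)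
  reg : ℕ → ℕ

namespace St

variable {A : Type}

/-- The output stack is not a component of the state: it stays empty until the final `flush`. -/
def toStk (s : St A) : ∀ k, List (Sym A k)
  | .inp => s.inp
  | .aux => s.aux
  | .sink g => s.sink g
  | .res => []
  | .reg i => List.replicate (s.reg i) ()

/-- Change the value of a register. -/
def set (s : St A) (i x : ℕ) : St A := { s with reg := Function.update s.reg i x }

@[simp] theorem set_inp (s : St A) (i x : ℕ) : (s.set i x).inp = s.inp := rfl
@[simp] theorem set_aux (s : St A) (i x : ℕ) : (s.set i x).aux = s.aux := rfl
@[simp] theorem set_sink (s : St A) (i x : ℕ) : (s.set i x).sink = s.sink := rfl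
theorem set_reg (s : St A) (i x j : ℕ) :
    (s.set i x).reg j = if j = i then x else s.reg j := by
  simp [set, Function.update_apply]

theorem toStk_set (s : St A) (i x : ℕ) :
    (s.set i x).toStk = Function.update s.toStk (.reg i) (List.replicate x ()) := by
  funext k
  cases k with
  | reg j =>
    by_cases h : j = i
    · subst h; simp [toStk, set]
    · simp [toStk, set, h]
  | _ => simp [toStk, set]

/-- Append a list of symbols to a sink; the last symbol is on top. -/
def emit (s : St A) (g : Bool) (l : List (OutSym A)) : St A :=
  { s with sink := Function.update s.sink g (l.reverse ++ s.sink g) }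

@[simp] theorem emit_inp (s : St A) (g l) : (s.emit g l).inp = s.inp := rfl
@[simp] theorem emit_aux (s : St A) (g l) : (s.emit g l).aux = s.aux := rfl
@[simp] theorem emit_reg (s : St A) (g l) : (s.emit g l).reg = s.reg := rfl

@[simp] theorem emit_nil (s : St A) (g) : s.emit g [] = s := by
  simp [emit]

theorem emit_emit (s : St A) (g l l') : (s.emit g l).emit g l' = s.emit g (l ++ l') := by
  simp [emit]

theorem emit_set (s : St A) (g l i x) : (s.set i x).emit g l = (s.emit g l).set i x := rfl

theorem set_self (s : St A) {i x : ℕ} (h : s.reg i = x) : s.set i x = s := by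
  subst h; simp [set]

end St

section Runs

variable {A : Type}

/-- The program `c` leads from `s` to `s'` in at most `n` steps. -/
def Run (c : Cmd (Sym A)) (s s' : St A) (n : ℕ) : Prop :=
  ∃ t ≤ n, c.Exec s.toStk s'.toStk t

variable {c c₁ c₂ : Cmd (Sym A)} {s s₁ s₂ s₃ : St A} {n m : ℕ}

theorem Run.mono (h : Run c s₁ s₂ n) (hn : n ≤ m) : Run c s₁ s₂ m :=
  let ⟨t, ht, e⟩ := h
  ⟨t, ht.trans hn, e⟩

theorem Run.seq (h₁ : Run c₁ s₁ s₂ n) (h₂ : Run c₂ s₂ s₃ m) :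
    Run (.seq c₁ c₂) s₁ s₃ (n + m) :=
  let ⟨t₁, ht₁, e₁⟩ := h₁
  let ⟨t₂, ht₂, e₂⟩ := h₂
  ⟨t₂ + t₁, by omega, .seq e₁ e₂⟩

theorem Run.skip : Run .skip s s 1 := ⟨1, le_rfl, .skip⟩

def inc (i : ℕ) : Cmd (Sym A) := .push (.reg i) ()

theorem Run.inc (i : ℕ) : Run (inc i) s (s.set i (s.reg i + 1)) 1 := by
  refine ⟨1, le_rfl, ?_⟩
  rw [St.toStk_set]
  exact Cmd.Exec.push (s := s.toStk) (k := .reg i) (a := ())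

def dec (i : ℕ) : Cmd (Sym A) := .pop (.reg i)

theorem Run.dec (i : ℕ) : Run (dec i) s (s.set i (s.reg i - 1)) 1 := by
  refine ⟨1, le_rfl, ?_⟩
  rw [St.toStk_set, ← List.tail_replicate]
  exact Cmd.Exec.pop (s := s.toStk) (k := .reg i)

def ifPos (i : ℕ) (c₁ c₂ : Cmd (Sym A)) : Cmd (Sym A) :=
  .cases (.reg i) fun o => if o.isSome then c₁ else c₂

theorem Run.ifPos_pos {i : ℕ} (hi : 0 < s.reg i) (h : Run c₁ s s₂ n) :
    Run (ifPos i c₁ c₂) s s₂ (n + 1) := by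
  obtain ⟨t, ht, e⟩ := h
  refine ⟨t + 1, by omega, .cases ?_⟩
  have : (s.toStk (.reg i)).head?.isSome = true := by
    simpa [St.toStk, Nat.pos_iff_ne_zero] using hi
  simpa only [this, if_true] using e

theorem Run.ifPos_zero {i : ℕ} (hi : s.reg i = 0) (h : Run c₂ s s₂ n) :
    Run (ifPos i c₁ c₂) s s₂ (n + 1) := by
  obtain ⟨t, ht, e⟩ := h
  refine ⟨t + 1, by omega, .cases ?_⟩
  have : (s.toStk (.reg i)).head?.isSome = false := by
    simp [St.toStk, hi]
  simpa only [this, Bool.false_eq_true, if_false] using e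

/-- The general rule for loops. -/
theorem Run.loop {k : Stk} {p : Option (Sym A k) → Bool} (σ : ℕ → St A) (m τ : ℕ)
    (h : ∀ x < m, p ((σ x).toStk k).head? = true ∧ Run c (σ x) (σ (x + 1)) τ)
    (h' : p ((σ m).toStk k).head? = false) :
    Run (.loop k p c) (σ 0) (σ m) (m * (τ + 1) + 1) := by
  induction m generalizing σ with
  | zero => exact ⟨1, by omega, .loop_false h'⟩
  | succ m ih =>
    obtain ⟨t₂, ht₂, e₂⟩ := ih (fun x => σ (x + 1)) (fun x hx => h (x + 1) (by omega)) h'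
    obtain ⟨hp, t₁, ht₁, e₁⟩ := h 0 (by omega)
    refine ⟨t₂ + (t₁ + 1), ?_, .loop_true hp e₁ e₂⟩
    have : (m + 1) * (τ + 1) = m * (τ + 1) + (τ + 1) := by ring
    omega

def loopPos (i : ℕ) (c : Cmd (Sym A)) : Cmd (Sym A) := .loop (.reg i) Option.isSome c

theorem Run.loopPos {i : ℕ} (σ : ℕ → St A) (m τ : ℕ)
    (h : ∀ x < m, 0 < (σ x).reg i ∧ Run c (σ x) (σ (x + 1)) τ)
    (h' : (σ m).reg i = 0) : Run (loopPos i c) (σ 0) (σ m) (m * (τ + 1) + 1) := by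
  refine Run.loop σ m τ (fun x hx => ⟨?_, (h x hx).2⟩) ?_
  · simpa [St.toStk, Nat.pos_iff_ne_zero] using (h x hx).1
  · simp [St.toStk, h']

/-- `Run` up to rewriting of states. -/
theorem Run.cast {s₁' s₂' : St A} (h : Run c s₁ s₂ n) (h₁ : s₁ = s₁') (h₂ : s₂ = s₂')
    (hn : n ≤ m) : Run c s₁' s₂' m := by
  subst h₁ h₂; exact h.mono hn

def clear (i : ℕ) : Cmd (Sym A) := loopPos i (dec i)

theorem Run.clear (i : ℕ) : Run (clear i) s (s.set i 0) (2 * s.reg i + 1) := by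
  refine (Run.loopPos (c := WordLearn.dec i) (fun x => s.set i (s.reg i - x)) (s.reg i) 1
    (fun x hx => ⟨?_, ?_⟩) ?_).cast ?_ ?_ ?_
  · simp [St.set_reg]; omega
  · refine (Run.dec i).cast rfl ?_ le_rfl
    ext1 <;> try rfl
    funext j; simp only [St.set_reg]; split_ifs <;> omega
  · simp [St.set_reg]
  · simp [St.set_self]
  · simp
  · omega

/-- Add the register `i` to the register `j` and clear it. -/
def move (i j : ℕ) : Cmd (Sym A) := loopPos i (.seq (dec i) (inc j))

theorem Run.move {i j : ℕ} (hij : i ≠ j) :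
    Run (move i j) s ((s.set i 0).set j (s.reg j + s.reg i)) (3 * s.reg i + 1) := by
  refine (Run.loopPos (c := .seq (WordLearn.dec i) (WordLearn.inc j))
    (fun x => (s.set i (s.reg i - x)).set j (s.reg j + x)) (s.reg i) 2
    (fun x hx => ⟨?_, ?_⟩) ?_).cast ?_ ?_ ?_
  · simp [St.set_reg, hij]; omega
  · refine ((Run.dec i).seq (Run.inc j)).cast rfl ?_ le_rfl
    ext1 <;> try rfl
    funext l; simp only [St.set_reg]; split_ifs <;> omega
  · simp [St.set_reg, hij]
  · ext1 <;> try rfl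
    funext l; simp only [St.set_reg]; split_ifs with h1 h2 <;> simp [*]
  · simp
  · omega

/-- Add the register `i` to the register `j`, with the help of the empty register `l`. -/
def copy (i j l : ℕ) : Cmd (Sym A) :=
  .seq (loopPos i (.seq (dec i) (.seq (inc j) (inc l)))) (move l i)

theorem Run.copy {i j l : ℕ} (hij : i ≠ j) (hil : i ≠ l) (hjl : j ≠ l) (hl : s.reg l = 0) :
    Run (copy i j l) s (s.set j (s.reg j + s.reg i)) (7 * s.reg i + 2) := by
  have h₁ : Run (WordLearn.loopPos i (.seq (WordLearn.dec i) (.seq (WordLearn.inc j)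
      (WordLearn.inc l)))) s
      (((s.set i 0).set j (s.reg j + s.reg i)).set l (s.reg i)) (4 * s.reg i + 1) := by
    refine (Run.loopPos (c := .seq (WordLearn.dec i) (.seq (WordLearn.inc j) (WordLearn.inc l)))
      (fun x => ((s.set i (s.reg i - x)).set j (s.reg j + x)).set l x) (s.reg i) 3
      (fun x hx => ⟨?_, ?_⟩) ?_).cast ?_ ?_ ?_
    · simp [St.set_reg, hij, hil]; omega
    · refine ((Run.dec i).seq ((Run.inc j).seq (Run.inc l))).cast rfl ?_ le_rfl
      ext1 <;> try rfl
      funext l; simp only [St.set_reg]; split_ifs <;> omega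
    · simp [St.set_reg, hij, hil]
    · ext1 <;> try rfl
      funext l; simp only [St.set_reg]; split_ifs with h1 h2 <;> simp [*]
    · simp
    · omega
  refine (h₁.seq (Run.move hil.symm)).cast rfl ?_ ?_
  · ext1 <;> try rfl
    funext l'; simp only [St.set_reg]; split_ifs <;> first | omega | (subst_vars; omega)
  · simp [St.set_reg]; omega

/-- Increase a register by a constant. -/
def incs (i : ℕ) : ℕ → Cmd (Sym A)
  | 0 => .skip
  | n + 1 => .seq (inc i) (incs i n)

theorem Run.incs (i n : ℕ) : Run (incs i n) s (s.set i (s.reg i + n)) (n + 1) := by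
  induction n generalizing s with
  | zero => exact Run.skip.cast rfl (by simp [St.set_self]) (by omega)
  | succ n ih =>
    refine ((Run.inc i).seq ih).cast rfl ?_ (by omega)
    ext1 <;> try rfl
    funext l; simp only [St.set_reg]; split_ifs <;> omega

end Runs

/-! ## Functions computed by register programs -/

section Comp

variable {A : Type}

/-- The length of the input, plus one. -/
def bnd (T : List (InSym A)) : ℕ := T.length + 1

/-- A logarithmic bound. -/
def lg (T : List (InSym A)) : ℕ := Nat.log 2 (bnd T) + 1

/-- The shift in the exponent makes every weight at least linear, so that copying registers and
scanning the input are absorbed at every level. -/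
def wt (k j : ℕ) (T : List (InSym A)) : ℕ := bnd T ^ (k + 1) * lg T ^ j

theorem bnd_pos (T : List (InSym A)) : 0 < bnd T := Nat.succ_pos _

theorem lg_pos (T : List (InSym A)) : 0 < lg T := Nat.succ_pos _

theorem bnd_le_wt (k j : ℕ) (T : List (InSym A)) : bnd T ≤ wt k j T :=
  calc bnd T = bnd T ^ 1 * 1 := by simp
    _ ≤ wt k j T := Nat.mul_le_mul (Nat.pow_le_pow_right (bnd_pos T) (by omega))
        (Nat.one_le_pow _ _ (lg_pos T))

theorem wt_mono {k j k' j' : ℕ} (hk : k ≤ k') (hj : j ≤ j') (T : List (InSym A)) :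
    wt k j T ≤ wt k' j' T :=
  Nat.mul_le_mul (Nat.pow_le_pow_right (bnd_pos T) (by omega))
    (Nat.pow_le_pow_right (lg_pos T) hj)

/-- Extend an environment by one variable. -/
def cons (x : ℕ) (e : ℕ → ℕ) : ℕ → ℕ
  | 0 => x
  | i + 1 => e i

@[simp] theorem cons_zero (x : ℕ) (e : ℕ → ℕ) : cons x e 0 = x := rfl
@[simp] theorem cons_succ (x : ℕ) (e : ℕ → ℕ) (i : ℕ) : cons x e (i + 1) = e i := rfl

theorem cons_le {x : ℕ} {e : ℕ → ℕ} {n : ℕ} (hx : x ≤ n) (he : ∀ i, e i ≤ n) (i : ℕ) :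
    cons x e i ≤ n := by
  cases i
  · exact hx
  · exact he _

theorem cons_lt {x : ℕ} {e : ℕ → ℕ} {n : ℕ} (hx : x < n) (he : ∀ i, e i < n) (i : ℕ) :
    cons x e i < n := by
  cases i
  · exact hx
  · exact he _

abbrev Fun (A : Type) : Type := List (InSym A) → (ℕ → ℕ) → ℕ

/-- The values of `f` are at most `M` times a constant. -/
def BddBy (M : List (InSym A) → ℕ) (f : Fun A) : Prop :=
  ∀ D, ∃ C, ∀ T e, (∀ i, e i ≤ D * bnd T) → f T e ≤ C * M T

/-- The state `s` is fit for the evaluation of a function of the registers `loc i`,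
with the registers from `b` on free for use. -/
structure Fit (loc : ℕ → ℕ) (b D : ℕ) (s : St A) : Prop where
  aux : s.aux = []
  le : ∀ i, s.reg (loc i) ≤ D * bnd s.inp
  free : ∀ i, b ≤ i → s.reg i = 0

/-- The function `f` is computed in time `O(N ^ (k + 1) * l ^ j)`, and bounded by `O(N)`. -/
structure Comp (k j : ℕ) (f : Fun A) : Prop where
  bdd : BddBy bnd f
  prog : ∀ (loc : ℕ → ℕ) (b : ℕ), (∀ i, loc i < b) → ∃ c : Cmd (Sym A), ∀ D, ∃ C, ∀ s : St A,
    Fit loc b D s → Run c s (s.set b (f s.inp (s.reg ∘ loc))) (C * wt k j s.inp)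

/-- Evaluating one function prepares the evaluation of another one. -/
theorem Fit.set {loc : ℕ → ℕ} {b D C x : ℕ} {s : St A} (h : Fit loc b D s)
    (hloc : ∀ i, loc i < b) (hx : x ≤ C * bnd s.inp) :
    Fit (cons b loc) (b + 1) (max C D) (s.set b x) := by
  refine ⟨h.aux, fun i => ?_, fun i hi => ?_⟩
  · cases i with
    | zero =>
      simp only [cons_zero, St.set_reg, if_true, St.set_inp]
      exact hx.trans (Nat.mul_le_mul_right _ (le_max_left _ _))
    | succ i =>
      simp only [cons_succ, St.set_reg, St.set_inp, (hloc i).ne, if_false]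
      exact (h.le i).trans (Nat.mul_le_mul_right _ (le_max_right _ _))
  · rw [St.set_reg, if_neg (by omega)]
    exact h.free i (by omega)

theorem set_comp_cons {loc : ℕ → ℕ} {b x : ℕ} {s : St A} (hloc : ∀ i, loc i < b) :
    (s.set b x).reg ∘ cons b loc = cons x (s.reg ∘ loc) := by
  funext i
  cases i with
  | zero => simp [St.set_reg]
  | succ i => simp [St.set_reg, (hloc i).ne]

namespace Comp

variable {k j k' j' : ℕ} {f g : Fun A}

theorem congr (h : Comp k j f) (e : ∀ T x, f T x = g T x) : Comp k j g := by
  have : f = g := by funext T x; exact e T x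
  exact this ▸ h

/-- Programs are given for every placement `loc` of the variables, so renaming variables costs
nothing. -/
theorem reindex (ρ : ℕ → ℕ) (h : Comp k j f) : Comp k j fun T e => f T (fun i => e (ρ i)) := by
  refine ⟨fun D => ?_, fun loc b hb => ?_⟩
  · obtain ⟨C, hC⟩ := h.bdd D
    exact ⟨C, fun T e he => hC T _ fun i => he _⟩
  · obtain ⟨c, hc⟩ := h.prog (loc ∘ ρ) b fun i => hb _
    refine ⟨c, fun D => ?_⟩
    obtain ⟨C, hC⟩ := hc D
    exact ⟨C, fun s hs => hC s ⟨hs.aux, fun i => hs.le _, hs.free⟩⟩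

theorem var (i : ℕ) : Comp (A := A) k j fun _ e => e i := by
  refine ⟨fun D => ⟨D, fun T e he => he i⟩, fun loc b hb => ⟨copy (loc i) b (b + 1), fun D =>
    ⟨7 * D + 2, fun s hs => ?_⟩⟩⟩
  refine (Run.copy (hb i).ne (by have := hb i; omega) (by omega) (hs.free _ (by omega))).cast
    rfl (by simp [hs.free b le_rfl]) ?_
  have h₁ := hs.le i
  have h₂ := bnd_le_wt k j s.inp
  have h₃ := bnd_pos s.inp
  nlinarith [Nat.mul_le_mul_left D h₂]

theorem const (n : ℕ) : Comp (A := A) k j fun _ _ => n := by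
  refine ⟨fun D => ⟨n, fun T e _ => Nat.le_mul_of_pos_right _ (bnd_pos T)⟩,
    fun loc b hb => ⟨incs b n, fun D => ⟨n + 1, fun s hs => ?_⟩⟩⟩
  refine (Run.incs b n).cast rfl (by simp [hs.free b le_rfl]) ?_
  exact Nat.le_mul_of_pos_right _ ((bnd_pos _).trans_le (bnd_le_wt k j s.inp))

/-- The value of `f` occupies register `b` while `g` works above it. Afterwards it is cleared and
the value of `g` is moved down, so that only register `b` has changed. Linearity of the values keeps
the environment of `g` fit. -/
theorem let_ (hf : Comp k j f) (hg : Comp k j g) :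
    Comp k j fun T e => g T (cons (f T e) e) := by
  refine ⟨fun D => ?_, fun loc b hb => ?_⟩
  · obtain ⟨C₁, h₁⟩ := hf.bdd D
    obtain ⟨C₂, h₂⟩ := hg.bdd (max C₁ D)
    refine ⟨C₂, fun T e he => h₂ T _ (cons_le ?_ fun i => ?_)⟩
    · exact (h₁ T e he).trans (Nat.mul_le_mul_right _ (le_max_left _ _))
    · exact (he i).trans (Nat.mul_le_mul_right _ (le_max_right _ _))
  · obtain ⟨cf, hcf⟩ := hf.prog loc b hb
    obtain ⟨cg, hcg⟩ := hg.prog (cons b loc) (b + 1)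
      (cons_lt (by omega) fun i => (hb i).trans (by omega))
    refine ⟨.seq cf (.seq cg (.seq (clear b) (move (b + 1) b))), fun D => ?_⟩
    obtain ⟨B₁, hB₁⟩ := hf.bdd D
    obtain ⟨B₂, hB₂⟩ := hg.bdd (max B₁ D)
    obtain ⟨C₁, hC₁⟩ := hcf D
    obtain ⟨C₂, hC₂⟩ := hcg (max B₁ D)
    refine ⟨C₁ + C₂ + 2 * B₁ + 3 * B₂ + 2, fun s hs => ?_⟩
    have hx := hB₁ s.inp (s.reg ∘ loc) hs.le
    have hs₁ := hs.set hb hx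
    have r₁ := hC₁ s hs
    have r₂ := hC₂ _ hs₁
    have hy := hB₂ _ (_ ∘ _) hs₁.le
    have r₃ := Run.clear (s := (s.set b (f s.inp (s.reg ∘ loc))).set (b + 1)
      (g s.inp (cons (f s.inp (s.reg ∘ loc)) (s.reg ∘ loc)))) b
    have r₄ := Run.move (s := ((s.set b (f s.inp (s.reg ∘ loc))).set (b + 1)
      (g s.inp (cons (f s.inp (s.reg ∘ loc)) (s.reg ∘ loc)))).set b 0) (i := b + 1) (j := b)
      (by omega)
    change g s.inp _ ≤ _ at hy
    change Run cg _ (St.set _ _ (g s.inp _)) (C₂ * wt k j s.inp) at r₂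
    rw [set_comp_cons hb] at r₂ hy
    refine (r₁.seq (r₂.seq (r₃.seq r₄))).cast rfl ?_ ?_
    · ext1 <;> try rfl
      funext l
      have := hs.free (b + 1) (by omega)
      simp only [St.set_reg]
      split_ifs <;> first | omega | (subst_vars; omega)
    · simp only [St.set_reg, St.set_inp, if_true] at hx hy ⊢
      rw [if_neg (show b ≠ b + 1 by omega), if_neg (show b + 1 ≠ b by omega)]
      have hw := bnd_le_wt k j s.inp
      have hp := bnd_pos s.inp
      have e₁ := Nat.mul_le_mul_left B₁ hw
      have e₂ := Nat.mul_le_mul_left B₂ hw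
      simp only [add_mul]
      generalize wt k j s.inp = w at *
      generalize bnd s.inp = n at *
      generalize f s.inp _ = x at *
      generalize g s.inp _ = y at *
      generalize B₁ * n = q₁ at *
      generalize B₂ * n = q₂ at *
      linarith

theorem comp₁ {G : List (InSym A) → ℕ → ℕ} (hG : Comp k j fun T e => G T (e 0))
    (hf : Comp k j f) : Comp k j fun T e => G T (f T e) :=
  let_ hf hG

/-- The latest binding has index `0`, so nested bindings list the arguments in reverse order and `1
- ·` restores it; the same pattern serves for more arguments. -/
theorem comp₂ {f₁ f₂ : Fun A} {G : List (InSym A) → ℕ → ℕ → ℕ}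
    (hG : Comp k j fun T e => G T (e 0) (e 1)) (h₁ : Comp k j f₁) (h₂ : Comp k j f₂) :
    Comp k j fun T e => G T (f₁ T e) (f₂ T e) :=
  (let_ h₁ (let_ (h₂.reindex (· + 1)) (hG.reindex (1 - ·))) :)

theorem comp₃ {f₁ f₂ f₃ : Fun A} {G : List (InSym A) → ℕ → ℕ → ℕ → ℕ}
    (hG : Comp k j fun T e => G T (e 0) (e 1) (e 2)) (h₁ : Comp k j f₁) (h₂ : Comp k j f₂)
    (h₃ : Comp k j f₃) : Comp k j fun T e => G T (f₁ T e) (f₂ T e) (f₃ T e) :=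
  (let_ h₁ (let_ (h₂.reindex (· + 1)) (let_ (h₃.reindex (· + 2)) (hG.reindex (2 - ·)))) :)

theorem comp₄ {f₁ f₂ f₃ f₄ : Fun A} {G : List (InSym A) → ℕ → ℕ → ℕ → ℕ → ℕ}
    (hG : Comp k j fun T e => G T (e 0) (e 1) (e 2) (e 3)) (h₁ : Comp k j f₁)
    (h₂ : Comp k j f₂) (h₃ : Comp k j f₃) (h₄ : Comp k j f₄) :
    Comp k j fun T e => G T (f₁ T e) (f₂ T e) (f₃ T e) (f₄ T e) :=
  (let_ h₁ (let_ (h₂.reindex (· + 1)) (let_ (h₃.reindex (· + 2)) (let_ (h₄.reindex (· + 3))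
    (hG.reindex (3 - ·))))) :)

theorem comp₅ {f₁ f₂ f₃ f₄ f₅ : Fun A} {G : List (InSym A) → ℕ → ℕ → ℕ → ℕ → ℕ → ℕ}
    (hG : Comp k j fun T e => G T (e 0) (e 1) (e 2) (e 3) (e 4)) (h₁ : Comp k j f₁)
    (h₂ : Comp k j f₂) (h₃ : Comp k j f₃) (h₄ : Comp k j f₄) (h₅ : Comp k j f₅) :
    Comp k j fun T e => G T (f₁ T e) (f₂ T e) (f₃ T e) (f₄ T e) (f₅ T e) :=
  (let_ h₁ (let_ (h₂.reindex (· + 1)) (let_ (h₃.reindex (· + 2)) (let_ (h₄.reindex (· + 3))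
    (let_ (h₅.reindex (· + 4)) (hG.reindex (4 - ·)))))) :)

theorem add_var : Comp (A := A) k j fun _ e => e 0 + e 1 := by
  refine ⟨fun D => ⟨D + D, fun T e he => ?_⟩, fun loc b hb =>
    ⟨.seq (copy (loc 0) b (b + 1)) (copy (loc 1) b (b + 1)), fun D =>
    ⟨14 * D + 4, fun s hs => ?_⟩⟩⟩
  · rw [add_mul]; exact add_le_add (he 0) (he 1)
  · have l0 := hb 0
    have l1 := hb 1
    have f0 := hs.free b le_rfl
    have f1 := hs.free (b + 1) (by omega)
    refine ((Run.copy (by omega) (by omega) (by omega) f1).seq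
      (Run.copy (by omega) (by omega) (by omega) ?_)).cast rfl ?_ ?_
    · simp [St.set_reg, f1]
    · ext1 <;> try rfl
      funext l
      simp only [St.set_reg, Function.comp]
      split_ifs <;> omega
    · have h₀ := hs.le 0
      have h₁ := hs.le 1
      have h₂ := bnd_le_wt k j s.inp
      have h₃ := bnd_pos s.inp
      simp only [St.set_reg, if_neg (show loc 1 ≠ b by omega)]
      nlinarith [Nat.mul_le_mul_left D h₂]

theorem sub_var : Comp (A := A) k j fun _ e => e 0 - e 1 := by
  refine ⟨fun D => ⟨D, fun T e he => (Nat.sub_le _ _).trans (he 0)⟩, fun loc b hb =>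
    ⟨.seq (copy (loc 0) b (b + 1)) (.seq (copy (loc 1) (b + 1) (b + 2))
      (loopPos (b + 1) (.seq (dec (b + 1)) (dec b)))), fun D =>
    ⟨17 * D + 5, fun s hs => ?_⟩⟩⟩
  have l0 := hb 0
  have l1 := hb 1
  have f0 := hs.free b le_rfl
  have f1 := hs.free (b + 1) (by omega)
  have f2 := hs.free (b + 2) (by omega)
  have r := Run.loopPos (c := .seq (dec (b + 1)) (dec b)) (i := b + 1)
    (fun x => (s.set b (s.reg (loc 0) - x)).set (b + 1) (s.reg (loc 1) - x)) (s.reg (loc 1)) 2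
    (fun x hx => ⟨by simp [St.set_reg]; omega, ((Run.dec (b + 1)).seq (Run.dec b)).cast rfl (by
      ext1 <;> try rfl
      funext l
      simp only [St.set_reg]
      split_ifs <;> omega) le_rfl⟩)
    (by simp [St.set_reg])
  refine ((Run.copy (by omega) (by omega) (by omega) f1).seq
      ((Run.copy (by omega) (by omega) (by omega) ?_).seq (r.cast ?_ rfl le_rfl))).cast rfl ?_ ?_
  · simp [St.set_reg, f2]
  · ext1 <;> try rfl
    funext l
    simp only [St.set_reg]
    split_ifs <;> omega
  · ext1 <;> try rfl
    funext l
    simp only [St.set_reg, Function.comp]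
    split_ifs <;> first | omega | (subst_vars; omega)
  · have h₀ := hs.le 0
    have h₁ := hs.le 1
    have h₂ := bnd_le_wt k j s.inp
    have h₃ := bnd_pos s.inp
    simp only [St.set_reg, if_neg (show loc 1 ≠ b by omega)]
    nlinarith [Nat.mul_le_mul_left D h₂]

theorem add (hf : Comp k j f) (hg : Comp k j g) : Comp k j fun T e => f T e + g T e :=
  comp₂ (G := fun _ x y => x + y) add_var hf hg

theorem sub (hf : Comp k j f) (hg : Comp k j g) : Comp k j fun T e => f T e - g T e :=
  comp₂ (G := fun _ x y => x - y) sub_var hf hg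

/-- Branching on whether a value is positive. -/
theorem cond {h : Fun A} (hf : Comp k j f) (hg : Comp k j g) (hh : Comp k j h) :
    Comp k j fun T e => if 0 < f T e then g T e else h T e := by
  refine ⟨fun D => ?_, fun loc b hb => ?_⟩
  · obtain ⟨C₁, h₁⟩ := hg.bdd D
    obtain ⟨C₂, h₂⟩ := hh.bdd D
    refine ⟨C₁ + C₂, fun T e he => ?_⟩
    have := h₁ T e he
    have := h₂ T e he
    rw [add_mul]
    split_ifs <;> omega
  · obtain ⟨cf, hcf⟩ := hf.prog loc b hb
    obtain ⟨cg, hcg⟩ := hg.prog loc b hb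
    obtain ⟨ch, hch⟩ := hh.prog loc b hb
    -- In the second branch the value is zero, so register `b` is already clear.
    refine ⟨.seq cf (ifPos b (.seq (clear b) cg) ch), fun D => ?_⟩
    obtain ⟨B, hB⟩ := hf.bdd D
    obtain ⟨C₁, hC₁⟩ := hcf D
    obtain ⟨C₂, hC₂⟩ := hcg D
    obtain ⟨C₃, hC₃⟩ := hch D
    refine ⟨C₁ + C₂ + C₃ + 2 * B + 2, fun s hs => ?_⟩
    have hx := hB s.inp (s.reg ∘ loc) hs.le
    have r₁ := hC₁ s hs
    have hw := bnd_le_wt k j s.inp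
    have hp := bnd_pos s.inp
    have e₁ := Nat.mul_le_mul_left B hw
    by_cases h0 : 0 < f s.inp (s.reg ∘ loc)
    · have r₂ := Run.clear (s := s.set b (f s.inp (s.reg ∘ loc))) b
      have e : (s.set b (f s.inp (s.reg ∘ loc))).set b 0 = s := by
        ext1 <;> try rfl
        funext l
        have := hs.free b le_rfl
        simp only [St.set_reg]
        split_ifs <;> first | omega | (subst_vars; omega)
      have r₃ := hC₂ s hs
      rw [e] at r₂
      refine (r₁.seq (Run.ifPos_pos (by simpa [St.set_reg] using h0) (r₂.seq r₃))).cast rfl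
        (by simp [h0]) ?_
      simp only [St.set_reg, if_true, add_mul] at hx ⊢
      have := Nat.zero_le (C₃ * wt k j s.inp)
      linarith
    · have e : s.set b (f s.inp (s.reg ∘ loc)) = s := by
        apply St.set_self
        have := hs.free b le_rfl
        omega
      rw [e] at r₁
      refine (r₁.seq (Run.ifPos_zero (hs.free b le_rfl) (hC₃ s hs))).cast rfl (by simp [h0]) ?_
      simp only [add_mul] at hx ⊢
      have := Nat.zero_le (C₂ * wt k j s.inp)
      have := Nat.zero_le (B * wt k j s.inp)
      linarith

/-- The loop of a primitive recursion: `b` holds the number of rounds to do, `b + 1` that of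
the rounds done, `b + 2` the current value. -/
def recLoop (b : ℕ) (c : Cmd (Sym A)) : Cmd (Sym A) :=
  loopPos b (.seq (dec b) (.seq c (.seq (clear (b + 2)) (.seq (move (b + 3) (b + 2))
    (inc (b + 1))))))

/-- Each round replaces the old value by the new one, which costs at most `5 * B` besides the step
function itself: clearing takes `2 * B` and moving `3 * B`, up to constants. -/
theorem run_recLoop {s : St A} {b m B τ : ℕ} {c : Cmd (Sym A)} (R : ℕ → ℕ)
    (hf : ∀ i, b ≤ i → s.reg i = 0)
    (hc : ∀ x < m, Run c (((s.set b (m - x - 1)).set (b + 1) x).set (b + 2) (R x))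
      ((((s.set b (m - x - 1)).set (b + 1) x).set (b + 2) (R x)).set (b + 3) (R (x + 1))) τ)
    (hR : ∀ x ≤ m, R x ≤ B) :
    Run (recLoop b c) ((s.set b m).set (b + 2) (R 0)) (((s.set b 0).set (b + 1) m).set (b + 2) (R m))
      (m * (τ + 5 * B + 5) + 1) := by
  have f1 := hf (b + 1) (by omega)
  have f3 := hf (b + 3) (by omega)
  refine (Run.loopPos (fun x => ((s.set b (m - x)).set (b + 1) x).set (b + 2) (R x)) m
    (τ + 5 * B + 4) (fun x hx => ⟨?_, ?_⟩) ?_).cast ?_ ?_ le_rfl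
  · simp [St.set_reg]; omega
  · refine ((Run.dec b).seq (((hc x hx).cast ?_ rfl le_rfl).seq ((Run.clear (b + 2)).seq
      ((Run.move (by omega)).seq (Run.inc (b + 1)))))).cast rfl ?_ ?_
    · ext1 <;> try rfl
      funext l
      rcases (show l = b ∨ l = b + 1 ∨ l = b + 2 ∨ l ≠ b ∧ l ≠ b + 1 ∧ l ≠ b + 2 by omega) with
        rfl | rfl | rfl | ⟨h₀, h₁, h₂⟩ <;> simp [St.set_reg, *]
    · ext1 <;> try rfl
      funext l
      rcases (show l = b ∨ l = b + 1 ∨ l = b + 2 ∨ l = b + 3 ∨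
        l ≠ b ∧ l ≠ b + 1 ∧ l ≠ b + 2 ∧ l ≠ b + 3 by omega) with
        rfl | rfl | rfl | rfl | ⟨h₀, h₁, h₂, h₃⟩ <;> simp [St.set_reg, *]
      omega
    · have h₁ := hR x hx.le
      have h₂ := hR (x + 1) (by omega)
      simp [St.set_reg]
      omega
  · simp [St.set_reg]
  · ext1 <;> try rfl
    funext l
    rcases (show l = b ∨ l = b + 1 ∨ l = b + 2 ∨ l ≠ b ∧ l ≠ b + 1 ∧ l ≠ b + 2 by omega) with
      rfl | rfl | rfl | ⟨h₀, h₁, h₂⟩ <;> simp [St.set_reg, *]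
  · simp

/-- Primitive recursion, where `M` bounds the number of iterations. -/
theorem rec_core {M : List (InSym A) → ℕ} {n a : Fun A} {S : List (InSym A) → (ℕ → ℕ) → ℕ → ℕ → ℕ}
    (hM : ∀ T, M T * wt k j T ≤ wt k' j' T) (hn : BddBy M n)
    (hn' : Comp k' j' n) (ha : Comp k' j' a)
    (hS : Comp k j fun T v => S T (fun i => v (i + 2)) (v 0) (v 1))
    (hA : ∀ D, ∃ C, ∀ T e, (∀ i, e i ≤ D * bnd T) → ∀ i ≤ n T e,
      Nat.rec (motive := fun _ => ℕ) (a T e) (fun i x => S T e i x) i ≤ C * bnd T) :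
    Comp k' j' fun T e =>
      Nat.rec (motive := fun _ => ℕ) (a T e) (fun i x => S T e i x) (n T e) := by
  refine ⟨fun D => ?_, fun loc b hb => ?_⟩
  · obtain ⟨C, hC⟩ := hA D
    exact ⟨C, fun T e he => hC T e he _ le_rfl⟩
  obtain ⟨cn, hcn⟩ := hn'.prog loc b hb
  obtain ⟨ca, hca⟩ := ha.prog loc (b + 2) fun i => (hb i).trans (by omega)
  obtain ⟨cS, hcS⟩ := hS.prog (cons (b + 1) (cons (b + 2) loc)) (b + 3)
    (cons_lt (by omega) (cons_lt (by omega) fun i => (hb i).trans (by omega)))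
  refine ⟨.seq cn (.seq ca (.seq (recLoop b cS) (.seq (clear (b + 1)) (move (b + 2) b)))),
    fun D => ?_⟩
  obtain ⟨C₀, hC₀⟩ := hA D
  obtain ⟨Bn, hBn⟩ := hn'.bdd D
  obtain ⟨B', hB'⟩ := hn D
  obtain ⟨Cn, hCn⟩ := hcn D
  obtain ⟨Ca, hCa⟩ := hca (D + Bn)
  obtain ⟨CS, hCS⟩ := hcS (D + Bn + C₀)
  refine ⟨Cn + Ca + B' * (CS + 5 * C₀ + 5) + 2 * Bn + 3 * C₀ + 3, fun s hs => ?_⟩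
  have f0 := hs.free b le_rfl
  have f1 := hs.free (b + 1) (by omega)
  have f2 := hs.free (b + 2) (by omega)
  have hnb := hBn s.inp (s.reg ∘ loc) hs.le
  have hnM := hB' s.inp (s.reg ∘ loc) hs.le
  have hAb := hC₀ s.inp (s.reg ∘ loc) hs.le
  have r₁ := hCn s hs
  generalize hm : n s.inp (s.reg ∘ loc) = m at *
  obtain ⟨R, hR, eS, e0⟩ : ∃ R : ℕ → ℕ, (∀ i, Nat.rec (motive := fun _ => ℕ)
      (a s.inp (s.reg ∘ loc)) (fun i x => S s.inp (s.reg ∘ loc) i x) i = R i) ∧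
      (∀ x, R (x + 1) = S s.inp (s.reg ∘ loc) x (R x)) ∧ R 0 = a s.inp (s.reg ∘ loc) :=
    ⟨_, fun _ => rfl, fun _ => rfl, rfl⟩
  simp only [hR] at hAb ⊢
  have hloc : ∀ i l, b ≤ l → loc i ≠ l := fun i l hl => by have := hb i; omega
  have hs₁ : Fit loc (b + 2) (D + Bn) (s.set b m) := by
    refine ⟨hs.aux, fun i => ?_, fun i hi => ?_⟩
    · have := hs.le i
      simp only [St.set_reg, St.set_inp, if_neg (hloc i b le_rfl), add_mul]
      omega
    · rw [St.set_reg, if_neg (by omega)]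
      exact hs.free i (by omega)
  have r₂ := hCa _ hs₁
  have ereg : (s.set b m).reg ∘ loc = s.reg ∘ loc := by
    funext i
    simp [St.set_reg, hloc i b le_rfl]
  rw [ereg, St.set_inp, ← e0] at r₂
  have r₃ := run_recLoop (m := m) (B := C₀ * bnd s.inp) (τ := CS * wt k j s.inp) (c := cS) R
    hs.free (fun x hx => ?_) hAb
  · have r₄ := Run.clear (s := ((s.set b 0).set (b + 1) m).set (b + 2) (R m)) (b + 1)
    have r₅ := Run.move (s := (((s.set b 0).set (b + 1) m).set (b + 2) (R m)).set (b + 1) 0)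
      (i := b + 2) (j := b) (by omega)
    refine (r₁.seq (r₂.seq (r₃.seq (r₄.seq r₅)))).cast rfl ?_ ?_
    · ext1 <;> try rfl
      funext l
      rcases (show l = b ∨ l = b + 1 ∨ l = b + 2 ∨ l ≠ b ∧ l ≠ b + 1 ∧ l ≠ b + 2 by omega) with
        rfl | rfl | rfl | ⟨h₀, h₁, h₂⟩ <;> simp [St.set_reg, *]
    · have hw := bnd_le_wt k j s.inp
      have hw' := bnd_le_wt k' j' s.inp
      have hp := bnd_pos s.inp
      have hMw := hM s.inp
      have h₂ := hAb m le_rfl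
      simp [St.set_reg]
      -- The number of rounds is `O(M)` and a round costs `O(wt k j)`, the transport of linear
      -- values being absorbed.
      have e₁ : m * (CS * wt k j s.inp + 5 * (C₀ * bnd s.inp) + 5) ≤
          B' * (CS + 5 * C₀ + 5) * wt k' j' s.inp := by
        calc _ ≤ (B' * M s.inp) * ((CS + 5 * C₀ + 5) * wt k j s.inp) := by
              refine Nat.mul_le_mul hnM ?_
              have := Nat.mul_le_mul_left C₀ hw
              simp only [add_mul]
              linarith
          _ = B' * (CS + 5 * C₀ + 5) * (M s.inp * wt k j s.inp) := by ring
          _ ≤ _ := Nat.mul_le_mul_left _ hMw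
      have e₂ := Nat.mul_le_mul_left Bn hw'
      have e₃ := Nat.mul_le_mul_left C₀ hw'
      simp only [add_mul] at e₁ ⊢
      linarith
  · have hs₂ : Fit (cons (b + 1) (cons (b + 2) loc)) (b + 3) (D + Bn + C₀)
        (((s.set b (m - x - 1)).set (b + 1) x).set (b + 2) (R x)) := by
      refine ⟨hs.aux, fun i => ?_, fun i hi => ?_⟩
      · have := hAb x hx.le
        match i with
        | 0 => simp [St.set_reg, add_mul]; omega
        | 1 => simp [St.set_reg, add_mul]; omega
        | i + 2 =>
          have := hs.le i
          simp only [cons_succ, St.set_reg, St.set_inp, hloc i _ (show b ≤ b from le_rfl),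
            hloc i (b + 1) (by omega), hloc i (b + 2) (by omega), if_false, add_mul]
          omega
      · simp only [St.set_reg]
        rw [if_neg (by omega), if_neg (by omega), if_neg (by omega)]
        exact hs.free i (by omega)
    have q₂ := hCS _ hs₂
    have e₂ : ((((s.set b (m - x - 1)).set (b + 1) x).set (b + 2) (R x))).reg ∘
        (cons (b + 1) (cons (b + 2) loc)) = cons x (cons (R x) (s.reg ∘ loc)) := by
      funext i
      match i with
      | 0 => simp [St.set_reg]
      | 1 => simp [St.set_reg]
      | i + 2 => simp [St.set_reg, hloc i _ (show b ≤ b from le_rfl),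
            hloc i (b + 1) (by omega), hloc i (b + 2) (by omega)]
    rw [e₂] at q₂
    exact q₂.cast rfl (congrArg _ (eS x).symm) le_rfl

end Comp

end Comp

/-! ### Boolean functions, bounded search and access to the input. -/

section Comp

variable {A : Type}

theorem bnd_mul_wt (k j : ℕ) (T : List (InSym A)) : bnd T * wt k j T = wt (k + 1) j T := by
  simp only [wt]; ring

theorem lg_mul_wt (k j : ℕ) (T : List (InSym A)) : lg T * wt k j T = wt k (j + 1) T := by
  simp only [wt]; ring

theorem BddBy.mono_left {M : List (InSym A) → ℕ} {f g : Fun A} (hg : BddBy M g)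
    (h : ∀ T e, f T e ≤ g T e) : BddBy M f := fun D =>
  let ⟨C, hC⟩ := hg D
  ⟨C, fun T e he => (h T e).trans (hC T e he)⟩

/-- Boolean functions that are computed in time `O(N ^ (k + 1) * l ^ j)`. -/
def CompB (k j : ℕ) (p : List (InSym A) → (ℕ → ℕ) → Bool) : Prop :=
  Comp k j fun T e => (p T e).toNat

namespace CompB

variable {k j : ℕ} {f g : Fun A} {p q r : List (InSym A) → (ℕ → ℕ) → Bool}

theorem ite (hp : CompB k j p) (hf : Comp k j f) (hg : Comp k j g) :
    Comp k j fun T e => if p T e then f T e else g T e :=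
  (Comp.cond hp hf hg).congr fun T e => by cases h : p T e <;> simp

theorem lt (hf : Comp k j f) (hg : Comp k j g) : CompB k j fun T e => decide (f T e < g T e) :=
  (Comp.cond (hg.sub hf) (Comp.const 1) (Comp.const 0)).congr fun T e => by
    by_cases h : f T e < g T e <;> simp [h]

theorem le (hf : Comp k j f) (hg : Comp k j g) : CompB k j fun T e => decide (f T e ≤ g T e) :=
  (Comp.cond (hf.sub hg) (Comp.const 0) (Comp.const 1)).congr fun T e => by
    by_cases h : f T e ≤ g T e <;> simp [h, Nat.lt_of_not_le]

theorem eq (hf : Comp k j f) (hg : Comp k j g) : CompB k j fun T e => decide (f T e = g T e) :=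
  (Comp.cond ((hf.sub hg).add (hg.sub hf)) (Comp.const 0) (Comp.const 1)).congr fun T e => by
    by_cases h : f T e = g T e
    · simp [h]
    · simp [h]; omega

theorem not (hp : CompB k j p) : CompB k j fun T e => !p T e :=
  (ite hp (Comp.const 0) (Comp.const 1)).congr fun T e => by cases h : p T e <;> simp [h]

theorem and (hp : CompB k j p) (hq : CompB k j q) : CompB k j fun T e => p T e && q T e :=
  (ite hp hq (Comp.const 0)).congr fun T e => by cases h : p T e <;> simp [h]

theorem or (hp : CompB k j p) (hq : CompB k j q) : CompB k j fun T e => p T e || q T e :=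
  (ite hp (Comp.const 1) hq).congr fun T e => by cases h : p T e <;> simp [h]

theorem xor (hp : CompB k j p) (hq : CompB k j q) : CompB k j fun T e => p T e ^^ q T e :=
  (ite hp (not hq) hq).congr fun T e => by cases h : p T e <;> simp [h]

theorem reindex (ρ : ℕ → ℕ) (h : CompB k j p) : CompB k j fun T e => p T (fun i => e (ρ i)) :=
  Comp.reindex ρ h

theorem comp₃ {P : List (InSym A) → ℕ → ℕ → ℕ → Bool} {f₁ f₂ f₃ : Fun A}
    (hP : CompB k j fun T e => P T (e 0) (e 1) (e 2)) (h₁ : Comp k j f₁) (h₂ : Comp k j f₂)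
    (h₃ : Comp k j f₃) : CompB k j fun T e => P T (f₁ T e) (f₂ T e) (f₃ T e) :=
  Comp.comp₃ (G := fun T x y z => (P T x y z).toNat) hP h₁ h₂ h₃

theorem comp₅ {P : List (InSym A) → ℕ → ℕ → ℕ → ℕ → ℕ → Bool} {f₁ f₂ f₃ f₄ f₅ : Fun A}
    (hP : CompB k j fun T e => P T (e 0) (e 1) (e 2) (e 3) (e 4)) (h₁ : Comp k j f₁)
    (h₂ : Comp k j f₂) (h₃ : Comp k j f₃) (h₄ : Comp k j f₄) (h₅ : Comp k j f₅) :
    CompB k j fun T e => P T (f₁ T e) (f₂ T e) (f₃ T e) (f₄ T e) (f₅ T e) :=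
  Comp.comp₅ (G := fun T x y z w v => (P T x y z w v).toNat) hP h₁ h₂ h₃ h₄ h₅

end CompB

/-- The least `i < n` with `p i`, or else `n`. -/
def lfind (p : ℕ → Bool) (n : ℕ) : ℕ :=
  Nat.rec (motive := fun _ => ℕ) 0 (fun i x => if x < i then x else if p i then i else i + 1) n

section lfind

variable {p : ℕ → Bool} {n : ℕ}

theorem lfind_succ (p : ℕ → Bool) (n : ℕ) : lfind p (n + 1) =
    if lfind p n < n then lfind p n else if p n then n else n + 1 := rfl

theorem lfind_le (p : ℕ → Bool) (n : ℕ) : lfind p n ≤ n := by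
  induction n with
  | zero => exact le_rfl
  | succ n ih => rw [lfind_succ]; split_ifs <;> omega

theorem lfind_spec (h : lfind p n < n) : p (lfind p n) = true := by
  induction n with
  | zero => omega
  | succ n ih =>
    rw [lfind_succ] at h ⊢
    split_ifs at h ⊢ with h₁ h₂
    · exact ih h₁
    · exact h₂
    · omega

theorem lfind_min {i : ℕ} (h : i < lfind p n) : p i = false := by
  induction n with
  | zero => simp [lfind] at h
  | succ n ih =>
    have := lfind_le p n
    rw [lfind_succ] at h
    split_ifs at h with h₁ h₂
    · exact ih h
    · exact ih (by omega)
    · rcases (show i < n ∨ i = n by omega) with h | rfl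
      · exact ih (by omega)
      · simpa using h₂

theorem lfind_lt_iff : lfind p n < n ↔ ∃ i < n, p i = true := by
  refine ⟨fun h => ⟨_, h, lfind_spec h⟩, fun ⟨i, hi, h⟩ => ?_⟩
  by_contra hn
  have := lfind_min (p := p) (n := n) (i := i) (by omega)
  simp [h] at this

theorem lfind_eq {i : ℕ} (hi : i ≤ n) (h : i < n → p i = true) (h' : ∀ x < i, p x = false) :
    lfind p n = i := by
  rcases lt_trichotomy (lfind p n) i with hl | hl | hl
  · have := lfind_spec (p := p) (n := n) (by omega)
    simp [h' _ hl] at this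
  · exact hl
  · have := lfind_min hl
    have := lfind_le p n
    simp [h (by omega)] at *

end lfind

/-- Bounded quantification. -/
def bex (p : ℕ → Bool) (n : ℕ) : Bool := decide (lfind p n < n)

@[simp] theorem bex_eq_true {p : ℕ → Bool} {n : ℕ} : bex p n = true ↔ ∃ i < n, p i = true := by
  simp [bex, lfind_lt_iff]

def ball (p : ℕ → Bool) (n : ℕ) : Bool := !bex (fun i => !p i) n

@[simp] theorem ball_eq_true {p : ℕ → Bool} {n : ℕ} : ball p n = true ↔ ∀ i < n, p i = true := by
  rw [ball, Bool.not_eq_true', ← Bool.not_eq_true, bex_eq_true]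
  simp

namespace Comp

variable {k j : ℕ} {f g n : Fun A}

/-- The search is a primitive recursion whose intermediate values never exceed the bound of the
search, hence remain linear. It runs through the whole range without an early exit. -/
theorem lfind_core {M : List (InSym A) → ℕ} {k' j' : ℕ} {p : List (InSym A) → (ℕ → ℕ) → ℕ → Bool}
    (hM : ∀ T, M T * wt k j T ≤ wt k' j' T) (hn : BddBy M n) (hn' : Comp k' j' n)
    (hp : CompB k j fun T v => p T (fun i => v (i + 1)) (v 0)) :
    Comp k' j' fun T e => lfind (p T e) (n T e) := by
  refine rec_core (S := fun T e i x => if x < i then x else if p T e i then i else i + 1)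
    hM hn hn' (const 0) ?_ ?_
  · have h := CompB.ite (CompB.lt (var 1) (var 0)) (var 1)
      -- Variable `0` is the counter and variable `1` the accumulator, which the predicate does not
      -- see.
      (CompB.ite (CompB.reindex (fun i => Nat.casesOn i 0 (fun i => i + 2)) hp) (var 0)
        ((var 0).add (const 1)))
    simpa using h
  · intro D
    obtain ⟨C, hC⟩ := hn'.bdd D
    exact ⟨C, fun T e he i hi => (lfind_le (p T e) i).trans (hi.trans (hC T e he))⟩

theorem find {p : List (InSym A) → (ℕ → ℕ) → ℕ → Bool} (hn : Comp (k + 1) j n)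
    (hp : CompB k j fun T v => p T (fun i => v (i + 1)) (v 0)) :
    Comp (k + 1) j fun T e => lfind (p T e) (n T e) :=
  lfind_core (fun T => (bnd_mul_wt k j T).le) hn.bdd hn hp

/-- A search through a logarithmic range raises only the power of the logarithm. Using this for
levels, exponents and scattering numbers keeps the exponent of the input length at `6` before
logarithms are absorbed. -/
theorem find_log {p : List (InSym A) → (ℕ → ℕ) → ℕ → Bool} (hn : Comp k (j + 1) n)
    (hn' : BddBy lg n) (hp : CompB k j fun T v => p T (fun i => v (i + 1)) (v 0)) :
    Comp k (j + 1) fun T e => lfind (p T e) (n T e) :=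
  lfind_core (fun T => (lg_mul_wt k j T).le) hn' hn hp

end Comp

namespace CompB

variable {k j : ℕ} {n : Fun A} {p : List (InSym A) → (ℕ → ℕ) → ℕ → Bool}

theorem bex (hn : Comp (k + 1) j n) (hp : CompB k j fun T v => p T (fun i => v (i + 1)) (v 0)) :
    CompB (k + 1) j fun T e => bex (p T e) (n T e) :=
  lt (Comp.find hn hp) hn

theorem ball (hn : Comp (k + 1) j n) (hp : CompB k j fun T v => p T (fun i => v (i + 1)) (v 0)) :
    CompB (k + 1) j fun T e => ball (p T e) (n T e) :=
  not (bex hn (not hp))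

end CompB

/-! ### Reading the input -/

/-- A number for each letter. -/
noncomputable def letterNum [Finite A] (a : A) : ℕ := Finite.equivFin A a

theorem letterNum_injective [Finite A] : Function.Injective (letterNum (A := A)) := fun _ _ h =>
  (Finite.equivFin A).injective (Fin.ext h)

/-- The values up to `2` mean that no letter is present, so one comparison detects the end of a
string. -/
noncomputable def symNum [Finite A] : Option (InSym A) → ℕ
  | none => 0
  | some .endString => 1
  | some .endPos => 2
  | some (.letter a) => letterNum a + 3

/-- The number of the symbol at position `i` of the input. -/
noncomputable def sym [Finite A] (T : List (InSym A)) (i : ℕ) : ℕ := symNum T[i]?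

/-- Move one symbol from the input to the scratch stack. -/
def advance : Cmd (Sym A) :=
  .cases .inp fun o => match o with
    | none => .skip
    | some a => .seq (.push .aux a) (.pop .inp)

def restore : Cmd (Sym A) :=
  .loop .aux Option.isSome (.cases .aux fun o => match o with
    | none => .skip
    | some a => .seq (.push .inp a) (.pop .aux))

theorem toStk_inp_aux (s : St A) (x y : List (InSym A)) :
    ({ s with inp := x, aux := y } : St A).toStk =
      Function.update (Function.update s.toStk .aux y) .inp x := by
  funext k
  cases k <;> simp [St.toStk]

/-- This also holds beyond the end of the input, where nothing moves; so positions need not be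
checked before reading. -/
theorem run_advance {s : St A} (T : List (InSym A)) (x : ℕ) (h₁ : s.inp = T.drop x)
    (h₂ : s.aux = (T.take x).reverse) :
    Run advance s { s with inp := T.drop (x + 1), aux := (T.take (x + 1)).reverse } 3 := by
  by_cases hx : x < T.length
  · refine ⟨3, le_rfl, .cases (t := 2) ?_⟩
    have e : (s.toStk .inp).head? = some T[x] := by
      simp [St.toStk, h₁]
    rw [e]
    refine Cmd.Exec.seq (t₁ := 1) (t₂ := 1) Cmd.Exec.push ?_
    have := Cmd.Exec.pop (s := Function.update s.toStk .aux (T[x] :: s.toStk .aux)) (k := .inp)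
    convert! this using 1
    rw [toStk_inp_aux]
    have e₁ : (T.take (x + 1)).reverse = T[x] :: s.aux := by
      rw [List.take_add_one, h₂]; simp [hx]
    have e₂ : T.drop (x + 1) = s.inp.tail := by simp [h₁]
    rw [e₁, e₂]
    simp [St.toStk]
  · refine ⟨2, by omega, .cases (t := 1) ?_⟩
    have e : (s.toStk .inp).head? = none := by
      simp [St.toStk, h₁]; omega
    rw [e]
    convert! Cmd.Exec.skip (s := s.toStk) using 1
    congr 1
    rw [List.drop_of_length_le (by omega), List.take_of_length_le (by omega)]
    rw [List.drop_of_length_le (by omega)] at h₁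
    rw [List.take_of_length_le (by omega)] at h₂
    cases s
    simp_all

theorem run_restore {s : St A} : Run restore s
    { s with inp := s.aux.reverse ++ s.inp, aux := [] } (4 * s.aux.length + 1) := by
  generalize h : s.aux = l
  induction l generalizing s with
  | nil =>
    refine ⟨1, by omega, ?_⟩
    have : ({ s with inp := ([] : List (InSym A)).reverse ++ s.inp, aux := [] } : St A) = s := by
      cases s
      simp_all
    rw [this]
    exact .loop_false (by simp [St.toStk, h])
  | cons a l ih =>
    obtain ⟨t, ht, e⟩ := ih (s := { s with inp := a :: s.inp, aux := l }) rfl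
    have ea : (s.toStk .aux).head? = some a := by simp [St.toStk, h]
    refine ⟨t + ((2 + 1) + 1), by simp; omega, .loop_true (by simp [ea]) (.cases (t := 2) ?_)
      (by simpa [restore] using e)⟩
    rw [ea]
    refine Cmd.Exec.seq (t₁ := 1) (t₂ := 1) Cmd.Exec.push ?_
    have := Cmd.Exec.pop (s := Function.update s.toStk .inp (a :: s.toStk .inp)) (k := .aux)
    convert! this using 1
    rw [toStk_inp_aux, Function.update_comm (by simp)]
    simp [St.toStk, h]

/-- Replace the number in register `b` by the number of the symbol at that position. -/
noncomputable def read [Finite A] (b : ℕ) : Cmd (Sym A) :=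
  .seq (loopPos b (.seq (dec b) advance))
    (.seq (.cases .inp fun o => incs b (symNum o)) restore)

theorem run_read [Finite A] {s : St A} {b : ℕ} (h : s.aux = []) :
    Run (read b) s (s.set b (sym s.inp (s.reg b)))
      (5 * s.reg b + 4 * s.inp.length + sym s.inp (s.reg b) + 4) := by
  have r₁ : Run (loopPos b (.seq (dec b) advance)) s { s.set b 0 with
      inp := s.inp.drop (s.reg b), aux := (s.inp.take (s.reg b)).reverse }
      (s.reg b * (4 + 1) + 1) := by
    refine (Run.loopPos (fun x => { s.set b (s.reg b - x) with
      inp := s.inp.drop x, aux := (s.inp.take x).reverse }) (s.reg b) 4 (fun x hx => ⟨?_, ?_⟩)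
      ?_).cast ?_ ?_ le_rfl
    · simp [St.set]; omega
    · refine ((Run.dec b).seq (run_advance s.inp x rfl rfl)).cast rfl ?_ le_rfl
      ext1 <;> try rfl
      funext l
      simp only [St.set, Function.update_apply]
      split_ifs <;> omega
    · simp [St.set]
    · cases s
      simp_all [St.set]
    · simp
  set s₁ : St A := { s.set b 0 with
      inp := s.inp.drop (s.reg b), aux := (s.inp.take (s.reg b)).reverse } with hs₁
  have e : symNum (s₁.toStk .inp).head? = sym s.inp (s.reg b) := by
    simp [St.toStk, hs₁, sym]
  have r₂ : Run (.cases .inp fun o => incs b (symNum o)) s₁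
      (s₁.set b (sym s.inp (s.reg b))) (sym s.inp (s.reg b) + 1 + 1) := by
    obtain ⟨t, ht, r⟩ := Run.incs (A := A) (s := s₁) b (sym s.inp (s.reg b))
    refine ⟨t + 1, by omega, .cases ?_⟩
    rw [e]
    convert! r using 2
    simp [hs₁, St.set]
  refine (r₁.seq (r₂.seq run_restore)).cast rfl ?_ ?_
  · ext1
    · simp [hs₁]
    · simp [h]
    · rfl
    · funext l
      simp only [hs₁, St.set, Function.update_apply]
      split_ifs <;> simp
  · simp [hs₁]
    have := Nat.min_le_right (s.reg b) s.inp.length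
    omega

theorem symNum_le [Finite A] (o : Option (InSym A)) : symNum o ≤ Nat.card A + 3 := by
  rcases o with _ | (a | _ | _) <;> simp [symNum, letterNum]

theorem Comp.sym_var [Finite A] {k j : ℕ} : Comp (A := A) k j fun T e => sym T (e 0) := by
  refine ⟨fun D => ⟨Nat.card A + 3, fun T e _ => ?_⟩, fun loc b hb =>
    ⟨.seq (copy (loc 0) b (b + 1)) (read b), fun D =>
    ⟨12 * D + Nat.card A + 13, fun s hs => ?_⟩⟩⟩
  · exact (symNum_le _).trans (Nat.le_mul_of_pos_right _ (bnd_pos T))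
  · have l0 := hb 0
    refine ((Run.copy (by omega) (by omega) (by omega) (hs.free _ (by omega))).seq
      (run_read hs.aux)).cast rfl ?_ ?_
    · ext1 <;> try rfl
      funext l
      have := hs.free b le_rfl
      simp [St.set_reg, this]
      split_ifs <;> rfl
    · have h₀ := hs.le 0
      have h₂ := bnd_le_wt k j s.inp
      have h₃ := bnd_pos s.inp
      have f0 := hs.free b le_rfl
      have h₄ : s.inp.length + 1 = bnd s.inp := rfl
      have h₅ := symNum_le s.inp[s.reg (loc 0)]?
      simp only [St.set_reg, if_true, f0, zero_add, St.set_inp, sym]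
      have := Nat.mul_le_mul_left D h₂
      generalize symNum s.inp[s.reg (loc 0)]? = x at *
      nlinarith

theorem Comp.symAt [Finite A] {k j : ℕ} {f : Fun A} (hf : Comp k j f) :
    Comp k j fun T e => sym T (f T e) :=
  Comp.comp₁ (G := sym) Comp.sym_var hf

end Comp

/-! ## Output of register programs -/

section Emit

variable {A : Type}

abbrev Text (A : Type) : Type := List (InSym A) → (ℕ → ℕ) → List (OutSym A)

/-- The text `f` is appended to the sink `g` in time `O(N ^ (k + 1) * l ^ j)`, whenever the input
and the registers satisfy `P`. -/
def Emit (P : List (InSym A) → (ℕ → ℕ) → Prop) (k j : ℕ) (g : Bool) (f : Text A) : Prop :=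
  ∀ (loc : ℕ → ℕ) (b : ℕ), (∀ i, loc i < b) → ∃ c : Cmd (Sym A), ∀ D, ∃ C, ∀ s : St A,
    Fit loc b D s → P s.inp (s.reg ∘ loc) →
    Run c s (s.emit g (f s.inp (s.reg ∘ loc))) (C * wt k j s.inp)

theorem Fit.emit {loc : ℕ → ℕ} {b D : ℕ} {s : St A} (h : Fit loc b D s) (g l) :
    Fit loc b D (s.emit g l) := ⟨h.aux, h.le, h.free⟩

theorem St.toStk_emit_singleton (s : St A) (g : Bool) (a : OutSym A) :
    (s.emit g [a]).toStk = Function.update s.toStk (.sink g) (a :: s.toStk (.sink g)) := by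
  funext k
  cases k with
  | sink g' =>
    by_cases h : g' = g
    · subst h; simp [St.toStk, St.emit]
    · simp [St.toStk, St.emit, h]
  | _ => simp [St.toStk, St.emit]

def emits (g : Bool) : List (OutSym A) → Cmd (Sym A)
  | [] => .skip
  | a :: l => .seq (.push (.sink g) a) (emits g l)

theorem run_emits {s : St A} (g : Bool) (l : List (OutSym A)) :
    Run (emits g l) s (s.emit g l) (l.length + 1) := by
  induction l generalizing s with
  | nil => exact (Run.skip (s := s)).cast rfl (by simp) le_rfl
  | cons a l ih =>
    have h : Run (.push (.sink g) a) s (s.emit g [a]) 1 := by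
      refine ⟨1, le_rfl, ?_⟩
      rw [St.toStk_emit_singleton]
      exact .push
    exact (h.seq ih).cast rfl (by simp [St.emit_emit]) (by simp; omega)

namespace Emit

variable {P Q : List (InSym A) → (ℕ → ℕ) → Prop} {k j k' j' : ℕ} {g : Bool} {f f₁ f₂ : Text A}

theorem congr (h : Emit P k j g f₁) (e : ∀ T x, P T x → f₁ T x = f₂ T x) : Emit P k j g f₂ := by
  intro loc b hb
  obtain ⟨c, hc⟩ := h loc b hb
  refine ⟨c, fun D => ?_⟩
  obtain ⟨C, hC⟩ := hc D
  exact ⟨C, fun s hs hP => e _ _ hP ▸ hC s hs hP⟩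

theorem weaken (h : Emit P k j g f) (hQ : ∀ T e, Q T e → P T e) : Emit Q k j g f := by
  intro loc b hb
  obtain ⟨c, hc⟩ := h loc b hb
  refine ⟨c, fun D => ?_⟩
  obtain ⟨C, hC⟩ := hc D
  exact ⟨C, fun s hs hP => hC s hs (hQ _ _ hP)⟩

theorem reindex (ρ : ℕ → ℕ) (h : Emit P k j g f) :
    Emit (fun T e => P T fun i => e (ρ i)) k j g fun T e => f T fun i => e (ρ i) := by
  intro loc b hb
  obtain ⟨c, hc⟩ := h (loc ∘ ρ) b fun i => hb _
  refine ⟨c, fun D => ?_⟩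
  obtain ⟨C, hC⟩ := hc D
  exact ⟨C, fun s hs => hC s ⟨hs.aux, fun i => hs.le _, hs.free⟩⟩

theorem const (l : List (OutSym A)) : Emit P k j g fun _ _ => l := by
  refine fun loc b hb => ⟨emits g l, fun D => ⟨l.length + 1, fun s hs _ => ?_⟩⟩
  exact (run_emits g l).mono (Nat.le_mul_of_pos_right _ ((bnd_pos _).trans_le (bnd_le_wt k j _)))

theorem append (h₁ : Emit P k j g f₁) (h₂ : Emit P k j g f₂) :
    Emit P k j g fun T e => f₁ T e ++ f₂ T e := by
  intro loc b hb
  obtain ⟨c₁, h₁⟩ := h₁ loc b hb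
  obtain ⟨c₂, h₂⟩ := h₂ loc b hb
  refine ⟨.seq c₁ c₂, fun D => ?_⟩
  obtain ⟨C₁, h₁⟩ := h₁ D
  obtain ⟨C₂, h₂⟩ := h₂ D
  refine ⟨C₁ + C₂, fun s hs hP => ?_⟩
  exact ((h₁ s hs hP).seq (h₂ _ (hs.emit _ _) hP)).cast rfl (St.emit_emit ..)
    (by simp [add_mul])

/-- Each branch may rely on the outcome of the test in addition to the promise `P`. -/
theorem cond {h : Fun A} (hh : Comp k j h) (h₁ : Emit (fun T e => P T e ∧ 0 < h T e) k j g f₁)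
    (h₂ : Emit (fun T e => P T e ∧ h T e = 0) k j g f₂) :
    Emit P k j g fun T e => if 0 < h T e then f₁ T e else f₂ T e := by
  intro loc b hb
  obtain ⟨c, hc⟩ := hh.prog loc b hb
  obtain ⟨c₁, h₁⟩ := h₁ loc b hb
  obtain ⟨c₂, h₂⟩ := h₂ loc b hb
  refine ⟨.seq c (ifPos b (.seq (clear b) c₁) c₂), fun D => ?_⟩
  obtain ⟨B, hB⟩ := hh.bdd D
  obtain ⟨C, hC⟩ := hc D
  obtain ⟨C₁, h₁⟩ := h₁ D
  obtain ⟨C₂, h₂⟩ := h₂ D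
  refine ⟨C + C₁ + C₂ + 2 * B + 2, fun s hs hP => ?_⟩
  have hx := hB s.inp (s.reg ∘ loc) hs.le
  have r₁ := hC s hs
  have hw := bnd_le_wt k j s.inp
  have hp := bnd_pos s.inp
  have e₁ := Nat.mul_le_mul_left B hw
  by_cases h0 : 0 < h s.inp (s.reg ∘ loc)
  · have r₂ := Run.clear (s := s.set b (h s.inp (s.reg ∘ loc))) b
    have e : (s.set b (h s.inp (s.reg ∘ loc))).set b 0 = s := by
      ext1 <;> try rfl
      funext l
      have := hs.free b le_rfl
      simp only [St.set_reg]
      split_ifs <;> first | omega | (subst_vars; omega)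
    rw [e] at r₂
    refine (r₁.seq (Run.ifPos_pos (by simpa [St.set_reg] using h0)
      (r₂.seq (h₁ s hs ⟨hP, h0⟩)))).cast rfl (by simp [h0]) ?_
    simp only [St.set_reg, if_true, add_mul] at hx ⊢
    have := Nat.zero_le (C₂ * wt k j s.inp)
    linarith
  · have e : s.set b (h s.inp (s.reg ∘ loc)) = s := by
      apply St.set_self
      have := hs.free b le_rfl
      omega
    rw [e] at r₁
    refine (r₁.seq (Run.ifPos_zero (hs.free b le_rfl) (h₂ s hs ⟨hP, by omega⟩))).cast rfl
      (by simp [h0]) ?_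
    simp only [add_mul] at hx ⊢
    have := Nat.zero_le (C₁ * wt k j s.inp)
    have := Nat.zero_le (B * wt k j s.inp)
    linarith

theorem ite {p : List (InSym A) → (ℕ → ℕ) → Bool} (hp : CompB k j p)
    (h₁ : Emit (fun T e => P T e ∧ p T e = true) k j g f₁)
    (h₂ : Emit (fun T e => P T e ∧ p T e = false) k j g f₂) :
    Emit P k j g fun T e => if p T e then f₁ T e else f₂ T e :=
  (cond (P := P) hp (h₁.weaken fun T e h => ⟨h.1, by
      have := h.2
      cases h : p T e <;> simp [h] at *⟩)
    (h₂.weaken fun T e h => ⟨h.1, by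
      have := h.2
      cases h : p T e <;> simp [h] at *⟩)).congr fun T e _ => by
    cases h : p T e <;> simp

theorem let_ {h : Fun A} (hh : Comp k j h) (hf : Emit P k j g f) :
    Emit (fun T e => P T (cons (h T e) e)) k j g fun T e => f T (cons (h T e) e) := by
  intro loc b hb
  obtain ⟨c, hc⟩ := hh.prog loc b hb
  obtain ⟨cf, hf⟩ := hf (cons b loc) (b + 1)
    (cons_lt (by omega) fun i => (hb i).trans (by omega))
  refine ⟨.seq c (.seq cf (clear b)), fun D => ?_⟩
  obtain ⟨B, hB⟩ := hh.bdd D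
  obtain ⟨C, hC⟩ := hc D
  obtain ⟨C', hf⟩ := hf (max B D)
  refine ⟨C + C' + 2 * B + 1, fun s hs hP => ?_⟩
  have hx := hB s.inp (s.reg ∘ loc) hs.le
  have r₂ := hf _ (hs.set hb hx)
  rw [set_comp_cons hb] at r₂
  refine ((hC s hs).seq ((r₂ hP).seq (Run.clear b))).cast rfl ?_ ?_
  · rw [← St.emit_set]
    congr 1
    ext1 <;> try rfl
    funext l
    have := hs.free b le_rfl
    simp only [St.set_reg]
    split_ifs <;> first | omega | (subst_vars; omega)
  · have hw := bnd_le_wt k j s.inp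
    have hp := bnd_pos s.inp
    have e₁ := Nat.mul_le_mul_left B hw
    simp only [St.set_reg, St.emit_reg, if_true, add_mul, St.set_inp]
    linarith

theorem comp₂ {R : List (InSym A) → ℕ → ℕ → Prop} {G : List (InSym A) → ℕ → ℕ → List (OutSym A)}
    {h₁ h₂ : Fun A} (hG : Emit (fun T e => R T (e 0) (e 1)) k j g fun T e => G T (e 0) (e 1))
    (hh₁ : Comp k j h₁) (hh₂ : Comp k j h₂) :
    Emit (fun T e => R T (h₁ T e) (h₂ T e)) k j g fun T e => G T (h₁ T e) (h₂ T e) :=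
  (let_ hh₁ (let_ (hh₂.reindex (· + 1)) (hG.reindex (1 - ·))) :)

/-- The range is linear, which costs one factor `N`. The body may assume that its index is in range.
-/
theorem range {n : Fun A} {F : List (InSym A) → (ℕ → ℕ) → ℕ → List (OutSym A)}
    (hn : Comp (k + 1) j n)
    (hF : Emit (fun T v => P T (fun i => v (i + 1)) ∧ v 0 < n T (fun i => v (i + 1))) k j g
      fun T v => F T (fun i => v (i + 1)) (v 0)) :
    Emit P (k + 1) j g fun T e => (List.range (n T e)).flatMap (F T e) := by
  intro loc b hb
  obtain ⟨cn, hcn⟩ := hn.prog loc b hb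
  obtain ⟨c, hc⟩ := hF (cons (b + 1) loc) (b + 2)
    (cons_lt (by omega) fun i => (hb i).trans (by omega))
  refine ⟨.seq cn (.seq (loopPos b (.seq (dec b) (.seq c (inc (b + 1))))) (clear (b + 1))),
    fun D => ?_⟩
  obtain ⟨B, hB⟩ := hn.bdd D
  obtain ⟨Cn, hCn⟩ := hcn D
  obtain ⟨C, hC⟩ := hc (D + B)
  refine ⟨Cn + B * (C + 3) + 2 * B + 2, fun s hs hP => ?_⟩
  have hx := hB s.inp (s.reg ∘ loc) hs.le
  have r₁ := hCn s hs
  generalize hm : n s.inp (s.reg ∘ loc) = m at *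
  have f1 := hs.free (b + 1) (by omega)
  have hloc : ∀ i l, b ≤ l → loc i ≠ l := fun i l hl => by have := hb i; omega
  let σ : ℕ → St A := fun x => ((s.set b (m - x)).set (b + 1) x).emit g
    ((List.range x).flatMap (F s.inp (s.reg ∘ loc)))
  have r₂ : Run (loopPos b (.seq (dec b) (.seq c (inc (b + 1))))) (σ 0) (σ m)
      (m * ((1 + (C * wt k j s.inp + 1)) + 1) + 1) := by
    refine Run.loopPos σ m _ (fun x hx => ⟨?_, ?_⟩) ?_
    · simp [σ, St.set_reg]; omega
    · have hs₂ : Fit (cons (b + 1) loc) (b + 2) (D + B) ((σ x).set b ((σ x).reg b - 1)) := by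
        refine ⟨hs.aux, fun i => ?_, fun i hi => ?_⟩
        · match i with
          | 0 => simp [σ, St.set_reg, add_mul]; omega
          | i + 1 =>
            have := hs.le i
            simp only [cons_succ, σ, St.set_reg, St.set_inp, hloc i _ (show b ≤ b from le_rfl),
              hloc i (b + 1) (by omega), if_false, add_mul, St.emit_reg, St.emit_inp]
            omega
        · simp only [σ, St.set_reg, St.emit_reg]
          rw [if_neg (by omega), if_neg (by omega), if_neg (by omega)]
          exact hs.free i (by omega)
      have e : ((σ x).set b ((σ x).reg b - 1)).reg ∘ cons (b + 1) loc =
          cons x (s.reg ∘ loc) := by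
        funext i
        match i with
        | 0 => simp [σ, St.set_reg]
        | i + 1 => simp [σ, St.set_reg, hloc i _ (show b ≤ b from le_rfl),
              hloc i (b + 1) (by omega)]
      have q := hC _ hs₂
      rw [e] at q
      have q := q ⟨hP, by
        change x < n s.inp (s.reg ∘ loc)
        omega⟩
      refine ((Run.dec b).seq (q.seq (Run.inc (b + 1)))).cast rfl ?_ le_rfl
      have el : (List.range (x + 1)).flatMap (F s.inp (s.reg ∘ loc)) =
          (List.range x).flatMap (F s.inp (s.reg ∘ loc)) ++ F s.inp (s.reg ∘ loc) x := by
        rw [List.range_succ]; simp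
      simp only [σ, el, ← St.emit_emit]
      ext1 <;> try rfl
      funext l
      simp only [St.set_reg, St.emit_reg]
      split_ifs <;> omega
    · simp [σ, St.set_reg]
  refine (r₁.seq ((r₂.cast ?_ rfl le_rfl).seq (Run.clear (b + 1)))).cast rfl ?_ ?_
  · simp only [σ, List.range_zero, List.flatMap_nil, St.emit_nil]
    ext1 <;> try rfl
    funext l
    simp only [St.set_reg]
    split_ifs <;> first | omega | (subst_vars; omega)
  · ext1 <;> try rfl
    · simp [σ, St.emit, hm, St.set]
    · funext l
      have f0 := hs.free b le_rfl
      simp only [σ, St.set_reg, St.emit_reg]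
      split_ifs <;> first | omega | (subst_vars; omega)
  · have hw := bnd_le_wt k j s.inp
    have hw' := bnd_le_wt (k + 1) j s.inp
    have hp := bnd_pos s.inp
    have e₁ : m * ((1 + (C * wt k j s.inp + 1)) + 1) ≤ B * (C + 3) * wt (k + 1) j s.inp := by
      rw [← bnd_mul_wt]
      calc _ ≤ (B * bnd s.inp) * ((C + 3) * wt k j s.inp) := by
            refine Nat.mul_le_mul hx ?_
            simp only [add_mul]
            linarith
        _ = _ := by ring
    have e₂ := Nat.mul_le_mul_left B hw'
    simp only [σ, St.set_reg, St.emit_reg, if_true, add_mul] at e₁ ⊢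
    linarith

theorem replicate {n : Fun A} (hn : Comp (k + 1) j n) (a : OutSym A) :
    Emit P (k + 1) j g fun T e => List.replicate (n T e) a :=
  (range (P := P) (F := fun _ _ _ => [a]) hn (const _)).congr fun T e _ => by
    generalize n T e = m
    induction m with
    | zero => rfl
    | succ m ih => rw [List.range_succ, List.flatMap_append, ih, List.replicate_succ']; rfl

end Emit

/-! ### Work lists -/

/-- The entries of work lists. -/
structure Item where
  kind : ℕ
  d : ℕ
  a : ℕ
  b : ℕ
  x : ℕ
  y : ℕ

namespace Item

/-- The environment given by an item. -/
def env (t : Item) : ℕ → ℕ :=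
  cons t.kind (cons t.d (cons t.a (cons t.b (cons t.x (cons t.y fun _ => 0)))))

def of (e : ℕ → ℕ) : Item := ⟨e 0, e 1, e 2, e 3, e 4, e 5⟩

theorem env_of_six_le (t : Item) {i : ℕ} (h : 6 ≤ i) : t.env i = 0 := by
  obtain ⟨i, rfl⟩ := Nat.exists_eq_add_of_le' h
  rfl

end Item

def encNum (n : ℕ) : List (OutSym A) := List.replicate n .tick ++ [.var]

def Item.enc (t : Item) : List (OutSym A) :=
  encNum t.kind ++ (encNum t.d ++ (encNum t.a ++ (encNum t.b ++ (encNum t.x ++ encNum t.y))))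

/-- Put a list of items in front of the work list. -/
def EmitItems (P : List (InSym A) → (ℕ → ℕ) → Prop) (k j : ℕ)
    (f : List (InSym A) → (ℕ → ℕ) → List Item) : Prop :=
  Emit P k j true fun T e => ((f T e).flatMap Item.enc).reverse

namespace EmitItems

variable {P : List (InSym A) → (ℕ → ℕ) → Prop} {k j : ℕ}

theorem nil : EmitItems P k j fun _ _ => [] := Emit.const []

theorem emit_encNum {n : Fun A} (hn : Comp (k + 1) j n) :
    Emit P (k + 1) j true fun T e => (encNum (n T e)).reverse :=
  ((Emit.const [.var]).append (Emit.replicate hn .tick)).congr fun T e _ => by simp [encNum]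

/-- The work list is a stack: the tail is written first, then the fields of the head from last to
first. -/
theorem cons {h₀ h₁ h₂ h₃ h₄ h₅ : Fun A} {f : List (InSym A) → (ℕ → ℕ) → List Item}
    (hh₀ : Comp (k + 1) j h₀) (hh₁ : Comp (k + 1) j h₁) (hh₂ : Comp (k + 1) j h₂)
    (hh₃ : Comp (k + 1) j h₃) (hh₄ : Comp (k + 1) j h₄) (hh₅ : Comp (k + 1) j h₅)
    (hf : EmitItems P (k + 1) j f) :
    EmitItems P (k + 1) j fun T e =>
      ⟨h₀ T e, h₁ T e, h₂ T e, h₃ T e, h₄ T e, h₅ T e⟩ :: f T e :=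
  (Emit.append hf (((((emit_encNum hh₅).append (emit_encNum hh₄)).append
    (emit_encNum hh₃)).append (emit_encNum hh₂)).append (emit_encNum hh₁)|>.append
    (emit_encNum hh₀))).congr fun T e _ => by simp [Item.enc]

theorem ite {p : List (InSym A) → (ℕ → ℕ) → Bool} {f₁ f₂ : List (InSym A) → (ℕ → ℕ) → List Item}
    (hp : CompB k j p) (h₁ : EmitItems P k j f₁) (h₂ : EmitItems P k j f₂) :
    EmitItems P k j fun T e => if p T e then f₁ T e else f₂ T e :=
  (Emit.ite (P := P) hp (h₁.weaken fun _ _ h => h.1) (h₂.weaken fun _ _ h => h.1)).congr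
    fun T e _ => by dsimp only; split_ifs <;> rfl

end EmitItems

/-- `Der out sub B l o n`: the work list `l` yields the text `o` in `n` rounds, in each of which the
first item `t` is replaced by the items `sub t`, and the text `out t` is written. All numbers in
the items are bounded by `B`. -/
inductive Der (out : Item → List (OutSym A)) (sub : Item → List Item) (B : ℕ) :
    List Item → List (OutSym A) → ℕ → Prop
  | nil : Der out sub B [] [] 0
  | cons {t l o n} (ht : ∀ i, t.env i ≤ B) (h : Der out sub B (sub t ++ l) o n) :
      Der out sub B (t :: l) (out t ++ o) (n + 1)

/-- The expansion of an item ignores its context, as in leftmost derivations of a context-free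
grammar, so derivations can be concatenated. -/
theorem Der.append {out : Item → List (OutSym A)} {sub : Item → List Item} {B n n' : ℕ} {l l' o o'}
    (h : Der out sub B l o n) (h' : Der out sub B l' o' n') :
    Der out sub B (l ++ l') (o ++ o') (n + n') := by
  induction h with
  | nil => simpa using h'
  | cons ht _ ih =>
    rw [List.append_assoc, show ∀ a b : ℕ, a + 1 + b = a + b + 1 by omega]
    exact .cons ht (by simpa using ih)

/-- Replace the contents of a sink. -/
def St.setSink (s : St A) (g : Bool) (l : List (OutSym A)) : St A :=
  { s with sink := Function.update s.sink g l }

theorem St.toStk_setSink (s : St A) (g : Bool) (l : List (OutSym A)) :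
    (s.setSink g l).toStk = Function.update s.toStk (.sink g) l := by
  funext k
  cases k with
  | sink g' =>
    by_cases h : g' = g
    · subst h; simp [St.toStk, St.setSink]
    · simp [St.toStk, St.setSink, h]
  | _ => simp [St.toStk, St.setSink]

theorem run_pop_sink {s : St A} (g : Bool) :
    Run (.pop (.sink g)) s (s.setSink g (s.sink g).tail) 1 := by
  refine ⟨1, le_rfl, ?_⟩
  rw [St.toStk_setSink]
  exact Cmd.Exec.pop (s := s.toStk) (k := .sink g)

def isTick : Option (OutSym A) → Bool
  | some .tick => true
  | _ => false

def isBot : Option (OutSym A) → Bool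
  | some .bot => true
  | _ => false

/-- Read a number from the work list. -/
def readNum (i : ℕ) : Cmd (Sym A) :=
  .seq (.loop (.sink true) isTick (.seq (.pop (.sink true)) (inc i))) (.pop (.sink true))

theorem run_readNum {s : St A} {i n : ℕ} {l : List (OutSym A)}
    (hs : s.sink true = encNum n ++ l) (hi : s.reg i = 0) :
    Run (readNum i) s ((s.setSink true l).set i n) (3 * n + 2) := by
  have r : Run (.loop (.sink true) isTick (.seq (.pop (.sink true)) (inc i))) s
      ((s.setSink true (.var :: l)).set i n) (n * (2 + 1) + 1) := by
    refine (Run.loop (fun x => (s.setSink true (List.replicate (n - x) .tick ++ .var :: l)).set i x)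
      n 2 (fun x hx => ⟨?_, ?_⟩) ?_).cast ?_ ?_ le_rfl
    · obtain ⟨m, hm⟩ : ∃ m, n - x = m + 1 := ⟨n - x - 1, by omega⟩
      simp [St.toStk, St.setSink, hm, List.replicate_succ, isTick]
    · refine ((run_pop_sink true).seq (Run.inc i)).cast rfl ?_ le_rfl
      obtain ⟨m, hm⟩ : ∃ m, n - x = m + 1 := ⟨n - x - 1, by omega⟩
      have hm' : n - (x + 1) = m := by omega
      simp [St.setSink, St.set, hm, hm', List.replicate_succ]
    · simp [St.toStk, St.setSink, isTick]
    · have : s.setSink true (List.replicate (n - 0) .tick ++ .var :: l) = s := by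
        rw [St.setSink]
        simp only [encNum, List.append_assoc, List.singleton_append] at hs
        simp [← hs]
      rw [this, St.set_self _ hi]
    · simp
  refine (r.seq (run_pop_sink true)).cast rfl ?_ (by omega)
  simp [St.setSink, St.set]

/-- Put an item into the registers from `b` on. -/
def St.load (s : St A) (b : ℕ) (t : Item) : St A :=
  { s with reg := fun i => if b ≤ i then t.env (i - b) else s.reg i }

def St.loads (s : St A) (b : ℕ) : List ℕ → St A
  | [] => s
  | n :: l => (s.set b n).loads (b + 1) l

def readNums (b : ℕ) : ℕ → Cmd (Sym A)
  | 0 => .skip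
  | n + 1 => .seq (readNum b) (readNums (b + 1) n)

theorem run_readNums {s : St A} {b : ℕ} {l : List (OutSym A)} (ns : List ℕ)
    (hs : s.sink true = ns.flatMap encNum ++ l) (hb : ∀ i, b ≤ i → s.reg i = 0) :
    Run (readNums b ns.length) s ((s.setSink true l).loads b ns) (3 * ns.sum + 2 * ns.length + 1) := by
  induction ns generalizing s b with
  | nil =>
    refine Run.skip.cast rfl ?_ (by simp)
    simp only [List.flatMap_nil, List.nil_append] at hs
    simp [St.loads, St.setSink, ← hs]
  | cons n ns ih =>
    simp only [List.flatMap_cons, List.append_assoc] at hs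
    refine ((run_readNum hs (hb b le_rfl)).seq (ih (b := b + 1) (by simp [St.setSink])
      fun i hi => ?_)).cast rfl ?_ ?_
    · rw [St.set_reg, if_neg (by omega)]
      exact hb i (by omega)
    · rw [St.loads]
      congr 1
      simp [St.setSink, St.set]
    · simp; omega

theorem load_eq {s : St A} {b : ℕ} {t : Item} (hb : ∀ i, b ≤ i → s.reg i = 0) :
    s.load b t = s.loads b [t.kind, t.d, t.a, t.b, t.x, t.y] := by
  simp only [St.loads]
  ext1 <;> try rfl
  funext l
  simp only [St.load, St.set_reg]
  by_cases h : b ≤ l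
  · obtain ⟨l, rfl⟩ := Nat.exists_eq_add_of_le h
    match l with
    | 0 | 1 | 2 | 3 | 4 | 5 => simp [Item.env, add_assoc]
    | l + 6 => simp [Item.env, hb, cons, add_assoc]
  · rw [if_neg h, if_neg (by omega), if_neg (by omega), if_neg (by omega), if_neg (by omega),
      if_neg (by omega), if_neg (by omega)]

theorem run_readItem {s : St A} {b B : ℕ} {t : Item} {l : List (OutSym A)}
    (hs : s.sink true = t.enc ++ l) (hb : ∀ i, b ≤ i → s.reg i = 0) (hB : ∀ i, t.env i ≤ B) :
    Run (readNums b 6) s ((s.setSink true l).load b t) (18 * B + 13) := by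
  rw [load_eq (s := s.setSink true l) hb]
  refine (run_readNums [t.kind, t.d, t.a, t.b, t.x, t.y] (by simpa [Item.enc] using hs) hb).mono ?_
  have h0 := hB 0
  have h1 := hB 1
  have h2 := hB 2
  have h3 := hB 3
  have h4 := hB 4
  have h5 := hB 5
  simp only [Item.env, cons] at h0 h1 h2 h3 h4 h5
  simp
  omega

def clearNums (b : ℕ) : ℕ → Cmd (Sym A)
  | 0 => .skip
  | n + 1 => .seq (clearNums (b + 1) n) (clear b)

theorem run_clearNums {s : St A} {b : ℕ} (ns : List ℕ) (hb : ∀ i, b ≤ i → s.reg i = 0) :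
    Run (clearNums b ns.length) (s.loads b ns) s (2 * ns.sum + ns.length + 1) := by
  induction ns generalizing s b with
  | nil => exact Run.skip.cast rfl rfl (by simp)
  | cons n ns ih =>
    have := hb b le_rfl
    refine ((ih (s := s.set b n) (b := b + 1) fun i hi => ?_).seq (Run.clear b)).cast rfl ?_ ?_
    · rw [St.set_reg, if_neg (by omega)]
      exact hb i (by omega)
    · ext1 <;> try rfl
      funext l
      simp only [St.set_reg]
      split_ifs <;> first | omega | (subst_vars; omega)
    · simp [St.set_reg]; omega

theorem run_clearItem {s : St A} {b B : ℕ} {t : Item} (hb : ∀ i, b ≤ i → s.reg i = 0)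
    (hB : ∀ i, t.env i ≤ B) : Run (clearNums b 6) (s.load b t) s (12 * B + 7) := by
  rw [load_eq hb]
  refine (run_clearNums [t.kind, t.d, t.a, t.b, t.x, t.y] hb).mono ?_
  have h0 := hB 0
  have h1 := hB 1
  have h2 := hB 2
  have h3 := hB 3
  have h4 := hB 4
  have h5 := hB 5
  simp only [Item.env, cons] at h0 h1 h2 h3 h4 h5
  simp
  omega

theorem Run.loop_step {k : Stk} {p : Option (Sym A k) → Bool} {c : Cmd (Sym A)} {s s₁ s₂ : St A}
    {n m : ℕ} (hp : p (s.toStk k).head? = true) (h : Run c s s₁ n)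
    (h' : Run (.loop k p c) s₁ s₂ m) : Run (.loop k p c) s s₂ (m + (n + 1)) :=
  let ⟨t, ht, e⟩ := h
  let ⟨t', ht', e'⟩ := h'
  ⟨t' + (t + 1), by omega, .loop_true hp e e'⟩

/-- Work through the work list, down to the marker `bot`. -/
def drain (b : ℕ) (c₁ c₂ : Cmd (Sym A)) : Cmd (Sym A) :=
  .loop (.sink true) (fun o => !isBot o) (.seq (readNums b 6) (.seq c₁ (.seq c₂ (clearNums b 6))))

/-- By induction on the derivation. After each round the registers are again `r`, since the loaded
item is cleared, so the hypotheses on the two programs apply in every round. -/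
theorem run_drain {out : Item → List (OutSym A)} {sub : Item → List Item} {b B τ : ℕ}
    {c₁ c₂ : Cmd (Sym A)} {T : List (InSym A)} {r : ℕ → ℕ} (hb : ∀ i, b ≤ i → r i = 0)
    (h₁ : ∀ (s : St A) (t : Item), s.aux = [] → s.inp = T → (∀ i, t.env i ≤ B) → s.reg = r →
      Run c₁ (s.load b t) ((s.load b t).emit false (out t)) τ)
    (h₂ : ∀ (s : St A) (t : Item), s.aux = [] → s.inp = T → (∀ i, t.env i ≤ B) → s.reg = r →
      Run c₂ (s.load b t) ((s.load b t).emit true ((sub t).flatMap Item.enc).reverse) τ)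
    {l : List Item} {o : List (OutSym A)} {n : ℕ} (h : Der out sub B l o n) {s : St A}
    {l' : List (OutSym A)} (ha : s.aux = []) (hi : s.inp = T) (hr : s.reg = r)
    (hs : s.sink true = l.flatMap Item.enc ++ .bot :: l') :
    Run (drain b c₁ c₂) s ((s.setSink true (.bot :: l')).emit false o)
      (n * (30 * B + 2 * τ + 21) + 1) := by
  induction h generalizing s with
  | nil =>
    refine ⟨1, by omega, ?_⟩
    have : (s.setSink true (.bot :: l')).emit false [] = s := by
      simp only [List.flatMap_nil, List.nil_append] at hs
      simp [St.setSink, ← hs]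
    rw [this]
    exact .loop_false (by simp [St.toStk, hs, isBot])
  | @cons t l o n ht _ ih =>
    have hs' : s.sink true = t.enc ++ (l.flatMap Item.enc ++ .bot :: l') := by
      simpa using hs
    have r₁ := run_readItem hs' (by rw [hr]; exact hb) ht
    have r₂ := h₁ (s.setSink true (l.flatMap Item.enc ++ .bot :: l')) t ha hi ht hr
    have r₃ := h₂ ((s.setSink true (l.flatMap Item.enc ++ .bot :: l')).emit false (out t)) t ha hi
      ht hr
    have r₄ := run_clearItem (s := ((s.setSink true (l.flatMap Item.enc ++ .bot :: l')).emit false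
      (out t)).emit true ((sub t).flatMap Item.enc).reverse) (b := b) (t := t)
      (by simp only [St.emit_reg]; exact fun i hi' => by rw [← hb i hi', ← hr]; rfl) ht
    have r₅ := ih (s := ((s.setSink true (l.flatMap Item.enc ++ .bot :: l')).emit false
      (out t)).emit true ((sub t).flatMap Item.enc).reverse) ha hi hr
      (by simp [St.emit, St.setSink])
    refine (Run.loop_step ?_ (r₁.seq (r₂.seq (r₃.seq r₄))) r₅).cast rfl ?_ ?_
    · simp only [St.toStk, hs', Item.enc, encNum]
      cases t.kind <;> simp [List.replicate_succ, isBot]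
    · ext1 <;> try rfl
      funext g
      cases g <;> simp [St.emit, St.setSink]
    · rw [add_mul]
      omega

/-- A work list replaces recursion, which register programs lack. With `O(M)` rounds of cost `O(wt k
j)` the total is the product; linear item fields keep each round within its bound. -/
theorem Emit.drain {P : List (InSym A) → (ℕ → ℕ) → Prop} {M : List (InSym A) → ℕ} {k j k' j' : ℕ}
    {out : List (InSym A) → Item → List (OutSym A)} {sub : List (InSym A) → Item → List Item}
    {ini : List (InSym A) → (ℕ → ℕ) → List Item} {f : Text A}
    (hM : ∀ T, M T * wt k j T ≤ wt k' j' T)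
    (hout : Emit (fun _ _ => True) k j false fun T e => out T (Item.of e))
    (hsub : EmitItems (fun _ _ => True) k j fun T e => sub T (Item.of e))
    (hini : EmitItems P k' j' ini)
    (hf : ∀ D, ∃ C, ∀ T e, (∀ i, e i ≤ D * bnd T) → P T e → ∃ n ≤ C * M T,
      Der (out T) (sub T) (C * bnd T) (ini T e) (f T e) n) : Emit P k' j' false f := by
  intro loc b hb
  -- Registers `b` to `b + 5` hold the item; register `b + 6`, which is zero, stands for all further
  -- variables.
  have hb' : ∀ i, b + min i 6 < b + 7 := fun i => by omega
  obtain ⟨c₁, h₁⟩ := hout (fun i => b + min i 6) (b + 7) hb'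
  obtain ⟨c₂, h₂⟩ := hsub (fun i => b + min i 6) (b + 7) hb'
  obtain ⟨c₀, h₀⟩ := hini loc b hb
  -- The marker separates the work list from whatever already lies on this stack, and is removed at
  -- the end.
  refine ⟨.seq (emits true [.bot]) (.seq c₀ (.seq (WordLearn.drain b c₁ c₂) (.pop (.sink true)))),
    fun D => ?_⟩
  obtain ⟨C, hC⟩ := hf D
  obtain ⟨C₀, h₀⟩ := h₀ D
  obtain ⟨C₁, h₁⟩ := h₁ C
  obtain ⟨C₂, h₂⟩ := h₂ C
  refine ⟨C₀ + C * (30 * C + 2 * (C₁ + C₂) + 21) + 4, fun s hs hP => ?_⟩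
  obtain ⟨n, hn, hd⟩ := hC s.inp (s.reg ∘ loc) hs.le hP
  have hfit : ∀ (s' : St A) (t : Item), s'.aux = [] → s'.inp = s.inp →
      (∀ i, t.env i ≤ C * bnd s.inp) → Fit (fun i => b + min i 6) (b + 7) C (s'.load b t) := by
    intro s' t ha hi ht
    refine ⟨ha, fun i => ?_, fun i hi => ?_⟩
    · have := ht (min i 6)
      simpa [St.load, hi] using this
    · simp only [St.load]
      rw [if_pos (by omega)]
      exact t.env_of_six_le (by omega)
  have henv : ∀ (s' : St A) (t : Item), Item.of ((s'.load b t).reg ∘ fun i => b + min i 6) = t := by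
    intro s' t
    simp [Item.of, St.load, Item.env]
  have r₁ := run_emits (s := s) true [.bot]
  have r₂ := h₀ _ (hs.emit true [.bot]) hP
  have r₃ := run_drain (c₁ := c₁) (c₂ := c₂) (T := s.inp) (τ := (C₁ + C₂) * wt k j s.inp)
    (r := s.reg) hs.free
    (fun s' t ha hi ht _ => by
      have := h₁ _ (hfit s' t ha hi ht) trivial
      beta_reduce at this
      rw [henv] at this
      simp only [show (s'.load b t).inp = s.inp from hi] at this
      exact this.mono (Nat.mul_le_mul_right _ (by omega)))
    (fun s' t ha hi ht _ => by
      have := h₂ _ (hfit s' t ha hi ht) trivial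
      beta_reduce at this
      rw [henv] at this
      simp only [show (s'.load b t).inp = s.inp from hi] at this
      exact this.mono (Nat.mul_le_mul_right _ (by omega)))
    hd (s := (s.emit true [.bot]).emit true ((ini s.inp (s.reg ∘ loc)).flatMap Item.enc).reverse)
    (l' := s.sink true) hs.aux rfl rfl (by simp [St.emit])
  refine (r₁.seq (r₂.seq (r₃.seq (run_pop_sink true)))).cast rfl ?_ ?_
  · ext1 <;> try rfl
    funext g
    cases g <;> simp [St.emit, St.setSink]
  · have hw := bnd_le_wt k j s.inp
    have hw' := bnd_le_wt k' j' s.inp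
    have hp := bnd_pos s.inp
    have e₁ : n * (30 * (C * bnd s.inp) + 2 * ((C₁ + C₂) * wt k j s.inp) + 21) ≤
        C * (30 * C + 2 * (C₁ + C₂) + 21) * wt k' j' s.inp := by
      calc _ ≤ (C * M s.inp) * ((30 * C + 2 * (C₁ + C₂) + 21) * wt k j s.inp) := by
            refine Nat.mul_le_mul hn ?_
            have := Nat.mul_le_mul_left C hw
            simp only [add_mul]
            linarith
        _ = C * (30 * C + 2 * (C₁ + C₂) + 21) * (M s.inp * wt k j s.inp) := by ring
        _ ≤ _ := Nat.mul_le_mul_left _ (hM _)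
    simp only [List.length_singleton, St.emit_inp]
    rw [add_mul, add_mul]
    linarith

end Emit

/-! ### From register programs to Turing machines. -/

section Machine

variable {A : Type}

/-- The sink has the last symbol of the text on top; transferring it to `res` puts the text into
reading order. -/
def flush : Cmd (Sym A) :=
  .loop (.sink false) Option.isSome (.cases (.sink false) fun o => match o with
    | none => .skip
    | some a => .seq (.push .res a) (.pop (.sink false)))

theorem exec_flush (l : List (OutSym A)) (s : ∀ k, List (Sym A k)) (h : s (.sink false) = l) :
    Cmd.Exec flush s (Function.update (Function.update s (.sink false) []) .res
      (l.reverse ++ s .res)) (4 * l.length + 1) := by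
  induction l generalizing s with
  | nil =>
    have : Function.update (Function.update s (.sink false) []) .res ([].reverse ++ s .res) = s := by
      funext k
      rcases k with _ | _ | (_ | _) | _ | _ <;> simp [h]
    rw [this]
    exact .loop_false (by simp [h])
  | cons a l ih =>
    have ha : (s (.sink false)).head? = some a := by simp [h]
    have h₁ : Cmd.Exec (.cases (.sink false) fun o => match o with
        | none => .skip
        | some a => .seq (.push .res a) (.pop (.sink false))) s
        (Function.update (Function.update s .res (a :: s .res)) (.sink false) l) 3 := by
      refine .cases (t := 2) ?_
      rw [ha]
      have := Cmd.Exec.pop (s := Function.update s .res (a :: s .res)) (k := .sink false)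
      refine .seq (t₁ := 1) (t₂ := 1) .push (s₂ := Function.update s .res (a :: s .res)) ?_
      convert! this using 1
      simp [h]
    have h₂ := ih (Function.update (Function.update s .res (a :: s .res)) (.sink false) l) (by simp)
    have := Cmd.Exec.loop_true (p := Option.isSome) (by simp [ha]) h₁ h₂
    convert! this using 1
    · funext k
      rcases k with _ | _ | (_ | _) | _ | _ <;> simp

theorem exec_clear_inp (l : List (InSym A)) (s : ∀ k, List (Sym A k)) (h : s .inp = l) :
    Cmd.Exec (.loop .inp Option.isSome (.pop .inp)) s (Function.update s .inp [])
      (2 * l.length + 1) := by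
  induction l generalizing s with
  | nil =>
    have : Function.update s .inp [] = s := by simp [← h]
    rw [this]
    exact .loop_false (by simp [h])
  | cons a l ih =>
    have h₁ : Cmd.Exec (.pop .inp) s (Function.update s .inp l) 1 := by
      have := Cmd.Exec.pop (s := s) (k := .inp)
      rwa [h] at this
    have h₂ := ih (Function.update s .inp l) (by simp)
    have := Cmd.Exec.loop_true (p := Option.isSome) (by simp [h]) h₁ h₂
    simpa [mul_add] using this

theorem finite_inSym [Finite A] : Finite (InSym A) := by
  refine Finite.of_injective (fun x => match x with
    | .letter a => some (some a)
    | .endString => some none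
    | .endPos => none : InSym A → Option (Option A)) fun x y h => ?_
  cases x <;> cases y <;> simp_all

theorem finite_outSym [Finite A] : Finite (OutSym A) := by
  refine Finite.of_injective (fun x => match x with
    | .letter a => .inl a
    | .succ => .inr 0
    | .eq => .inr 1
    | .bot => .inr 2
    | .imp => .inr 3
    | .all => .inr 4
    | .min => .inr 5
    | .max => .inr 6
    | .tick => .inr 7
    | .var => .inr 8 : OutSym A → A ⊕ Fin 9) fun x y h => ?_
  cases x <;> cases y <;> simp_all

/-- A text that register programs can write is the output of a Turing machine. -/
theorem Emit.exists_machine [Finite A] {P : List (InSym A) → (ℕ → ℕ) → Prop} {k j : ℕ}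
    {f : Text A} (h : Emit P k j false f) :
    ∃ (M : Turing.TM2ComputableAux (InSym A) (OutSym A)) (C : ℕ), ∀ T, P T (fun _ => 0) →
      Nonempty (Turing.TM2OutputsInTime M.tm (T.map M.inputAlphabet.symm)
        (some ((f T fun _ => 0).map M.outputAlphabet.symm)) (C * wt k j T)) := by
  obtain ⟨c, hc⟩ := h (fun _ => 0) 1 (by simp)
  obtain ⟨C, hC⟩ := hc 0
  have hfin : ∀ k : Stk, Finite (Sym A k)
    | .inp => finite_inSym
    | .aux => finite_inSym
    | .sink _ => finite_outSym
    | .res => finite_outSym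
    | .reg _ => inferInstanceAs (Finite Unit)
  obtain ⟨M, hM⟩ := Cmd.exists_machine
    (.seq c (.seq (.loop .inp Option.isSome (.pop .inp)) flush)) Stk.inp Stk.res
  refine ⟨M, 5 * C + 5, fun T hT => ?_⟩
  let s : St A := ⟨T, [], fun _ => [], fun _ => 0⟩
  obtain ⟨t, ht, r₁⟩ := hC s ⟨rfl, by simp [s], fun _ _ => rfl⟩ hT
  set s₁ := s.emit false (f s.inp (s.reg ∘ fun _ => 0)) with hs₁
  have r₂ := exec_clear_inp T s₁.toStk rfl
  have e₃ : Function.update s₁.toStk .inp [] (.sink false) = (f T fun _ => 0).reverse := by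
    simp [s₁, St.toStk, St.emit, s]; rfl
  have r₃ := exec_flush _ (Function.update s₁.toStk .inp []) e₃
  -- The text is no longer than the time spent on it, so the final reversal multiplies the time by a
  -- constant only.
  have hl := r₁.length_le (.sink false)
  have hl' : (f T fun _ => 0).length ≤ t := by
    have e₁ : s₁.toStk (.sink false) = (f T fun _ => 0).reverse := by
      simp [s₁, St.toStk, St.emit, s]; rfl
    rw [e₁] at hl
    simpa [St.toStk, s] using hl
  have r := Cmd.Exec.seq r₁ (Cmd.Exec.seq r₂ r₃)
  have ei : s.toStk = Function.update (β := fun k => List (Sym A k)) (fun _ => []) Stk.inp T := by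
    funext k
    cases k <;> simp [St.toStk, s]
  have eo : Function.update (Function.update (Function.update s₁.toStk .inp []) (.sink false) [])
      .res ((f T fun _ => 0).reverse.reverse ++ Function.update s₁.toStk .inp [] .res) =
      Function.update (β := fun k => List (Sym A k)) (fun _ => []) Stk.res (f T fun _ => 0) := by
    funext k
    rcases k with _ | _ | (_ | _) | _ | _ <;> simp [St.toStk, s₁, s, St.emit]
  rw [ei, eo] at r
  obtain ⟨out⟩ := hM T (f T fun _ => 0) _ r
  refine ⟨⟨out.toEvalsTo, out.steps_le_m.trans ?_⟩⟩
  have hw := bnd_le_wt k j T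
  have hb : bnd T = T.length + 1 := rfl
  change t ≤ C * wt k j T at ht
  simp only [List.length_reverse]
  rw [add_mul, mul_assoc]
  omega

end Machine

/-! ## Segmentations -/

/-- There are `n` elements of `s` with gaps larger than `l`. -/
def Spread (l n : ℕ) (s : Finset ℕ) : Prop :=
  ∃ f : ℕ → ℕ, (∀ i < n, f i ∈ s) ∧ ∀ i, i + 1 < n → f i + l < f (i + 1)

theorem Spread.lt {l n : ℕ} {f : ℕ → ℕ} (h : ∀ i, i + 1 < n → f i + l < f (i + 1)) {i j : ℕ}
    (hij : i < j) (hj : j < n) : f i + l < f j := by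
  induction j with
  | zero => omega
  | succ j ih =>
    have := h j hj
    rcases (show i < j ∨ i = j by omega) with h' | rfl
    · have := ih h' (by omega)
      omega
    · exact this

theorem Spread.filter {l n c : ℕ} {s : Finset ℕ} (hc : c ∈ s)
    (h : Spread l n (s.filter (c + l < ·))) : Spread l (n + 1) s := by
  obtain ⟨f, hf, hf'⟩ := h
  refine ⟨fun i => Nat.casesOn i c f, fun i hi => ?_, fun i hi => ?_⟩
  · cases i with
    | zero => exact hc
    | succ i => exact (Finset.mem_filter.1 (hf i (by omega))).1
  · cases i with
    | zero => exact (Finset.mem_filter.1 (hf 0 (by omega))).2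
    | succ i => exact hf' i (by omega)

/-- A set without `n + 1` elements with large gaps is covered by `n` short intervals. -/
theorem exists_cover {l n : ℕ} {s : Finset ℕ} (h : ¬ Spread l (n + 1) s) :
    ∃ cs : List ℕ, cs.length ≤ n ∧ (∀ c ∈ cs, c ∈ s) ∧ ∀ x ∈ s, ∃ c ∈ cs, c ≤ x ∧ x ≤ c + l := by
  induction n generalizing s with
  | zero =>
    refine ⟨[], le_rfl, by simp, fun x hx => (h ⟨fun _ => x, fun _ _ => hx, by omega⟩).elim⟩
  | succ n ih =>
    rcases s.eq_empty_or_nonempty with rfl | hs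
    · exact ⟨[], by simp, by simp, by simp⟩
    · obtain ⟨cs, h₁, h₂, h₃⟩ := ih fun h' => h (h'.filter (s.min'_mem hs))
      refine ⟨s.min' hs :: cs, by simpa using h₁, ?_, fun x hx => ?_⟩
      · simp only [List.mem_cons, forall_eq_or_imp]
        exact ⟨s.min'_mem hs, fun c hc => (Finset.mem_filter.1 (h₂ c hc)).1⟩
      · by_cases hx' : s.min' hs + l < x
        · obtain ⟨c, hc, h⟩ := h₃ x (Finset.mem_filter.2 ⟨hx, hx'⟩)
          exact ⟨c, List.mem_cons_of_mem _ hc, h⟩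
        · exact ⟨_, List.mem_cons_self, s.min'_le x hx, by omega⟩

/-- Greedily from the left: the elements within `l` of the minimum form one part, and the elements
beyond have no `n` points with large gaps, since the minimum could be put in front of them. -/
theorem exists_segmentation {l n : ℕ} {s : Finset ℕ} (h : ¬ Spread l (n + 1) s) :
    ∃ p : Finpartition s, IsSegmented l p ∧ p.parts.card ≤ n := by
  induction n generalizing s with
  | zero =>
    have : s = ∅ := by
      by_contra hs
      obtain ⟨x, hx⟩ := Finset.nonempty_iff_ne_empty.2 hs
      exact h ⟨fun _ => x, fun _ _ => hx, by omega⟩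
    subst this
    exact ⟨Finpartition.empty _, fun X hX => by simp at hX, by simp⟩
  | succ n ih =>
    rcases s.eq_empty_or_nonempty with rfl | hs
    · exact ⟨Finpartition.empty _, fun X hX => by simp at hX, by simp⟩
    · obtain ⟨c, hcs, hle⟩ : ∃ c ∈ s, ∀ x ∈ s, c ≤ x :=
        ⟨s.min' hs, s.min'_mem hs, fun x hx => s.min'_le x hx⟩
      obtain ⟨p, h₁, h₂⟩ := ih fun h' => h (h'.filter hcs)
      have hne : s.filter (· ≤ c + l) ≠ ⊥ := by
        refine Finset.nonempty_iff_ne_empty.1 ⟨c, Finset.mem_filter.2 ⟨hcs, by omega⟩⟩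
      have hd : Disjoint (s.filter (c + l < ·)) (s.filter (· ≤ c + l)) :=
        Finset.disjoint_filter.2 fun x _ h => by omega
      have hu : s.filter (c + l < ·) ⊔ s.filter (· ≤ c + l) = s := by
        ext x
        simp only [Finset.sup_eq_union, Finset.mem_union, Finset.mem_filter]
        have := le_or_gt x (c + l)
        tauto
      refine ⟨p.extend hne hd hu, fun X hX i hi j hj => ?_, ?_⟩
      · simp only [Finpartition.extend_parts, Finset.mem_insert] at hX
        rcases hX with rfl | hX
        · simp only [Finset.mem_filter] at hi hj ⊢
          have hi' := hle i hi.1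
          have hj' := hle j hj.1
          refine ⟨by rw [Nat.dist]; omega, fun h hh hih hhj => ⟨hh, by omega⟩⟩
        · have := h₁ X hX i hi j hj
          refine ⟨this.1, fun h hh hih hhj => this.2 h (Finset.mem_filter.2 ⟨hh, ?_⟩) hih hhj⟩
          have := (Finset.mem_filter.1 (p.le hX hi)).2
          omega
      · rw [Finpartition.card_extend]
        omega

/-- Points with gaps larger than `l` lie in different parts of diameter at most `l`. -/
theorem Spread.le_card {l n : ℕ} {s : Finset ℕ} (h : Spread l n s) {p : Finpartition s}
    (hp : IsSegmented l p) : n ≤ p.parts.card := by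
  obtain ⟨f, hf, hf'⟩ := h
  rw [← Finset.card_range n]
  refine Finset.card_le_card_of_injOn (fun i => p.part (f i)) (fun i hi => ?_) ?_
  · exact p.part_mem.2 (hf i (Finset.mem_range.1 hi))
  · intro i hi j hj hij
    simp only [Finset.coe_range, Set.mem_Iio] at hi hj
    have e : p.part (f i) = p.part (f j) := hij
    have h₁ : f i ∈ p.part (f i) := p.mem_part (hf i hi)
    have h₂ : f j ∈ p.part (f i) := e ▸ p.mem_part (hf j hj)
    have := (hp _ (p.part_mem.2 (hf i hi)) _ h₁ _ h₂).1
    rw [Nat.dist] at this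
    by_contra hne
    rcases lt_or_gt_of_ne hne with h | h
    · have := Spread.lt hf' h hj
      omega
    · have := Spread.lt hf' h hi
      omega

/-- A min-max duality. It turns the minimum over partitions into the existence of well-separated
points, which both the strategy and the greedy test use. -/
theorem le_numSegments_iff {l n : ℕ} {s : Finset ℕ} : n ≤ numSegments l s ↔ Spread l n s := by
  constructor
  · intro h
    by_contra hn
    cases n with
    | zero => exact hn ⟨id, by omega, by omega⟩
    | succ n =>
      obtain ⟨p, h₁, h₂⟩ := exists_segmentation hn
      have : numSegments l s ≤ p.parts.card := Nat.sInf_le ⟨p, h₁, rfl⟩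
      omega
  · intro h
    have hne : {c | ∃ p : Finpartition s, IsSegmented l p ∧ p.parts.card = c}.Nonempty := by
      -- The partition into singletons shows that the infimum is attained and not a default value.
      refine ⟨_, ⊥, fun X hX i hi j hj => ?_, rfl⟩
      obtain ⟨a, ha, rfl⟩ := Finpartition.mem_bot_iff.1 hX
      simp only [Finset.mem_singleton] at hi hj ⊢
      subst hi hj
      exact ⟨by simp, fun h _ h₁ h₂ => by omega⟩
    obtain ⟨p, h₁, h₂⟩ := Nat.sInf_mem hne
    rw [numSegments, ← h₂]
    exact h.le_card h₁

/-! ## A strategy for the Duplicator -/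

section Strategy

variable {A : Type} {u v : List A} {m q j r x y : ℕ} {L L' : List (ℕ × ℕ)} {α : List A}

/-- The numbers `x` and `y` differ by at most `d`. -/
def Near (d x y : ℕ) : Prop := x ≤ y + d ∧ y ≤ x + d

/-- The pairs of positions of `u` and `v` have the same distances up to `2 ^ m`, and the same
neighbourhoods of radius `2 ^ m - 1`. -/
structure Inv (u v : List A) (m : ℕ) (L : List (ℕ × ℕ)) : Prop where
  lt : ∀ p ∈ L, p.1 < u.length ∧ p.2 < v.length
  dist₁ : ∀ p ∈ L, ∀ p' ∈ L, Near (2 ^ m) p.1 p'.1 → p'.1 + p.2 = p.1 + p'.2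
  dist₂ : ∀ p ∈ L, ∀ p' ∈ L, Near (2 ^ m) p.2 p'.2 → p'.1 + p.2 = p.1 + p'.2
  label : ∀ p ∈ L, ∀ x y, x + p.2 = y + p.1 → x < p.1 + 2 ^ m → p.1 < x + 2 ^ m → u[x]? = v[y]?

/-- The invariant is symmetric, so it suffices to treat picks of the Spoiler in the first string. -/
theorem Inv.swap (h : Inv u v m L) : Inv v u m (L.map Prod.swap) := by
  refine ⟨?_, ?_, ?_, ?_⟩
  · simp only [List.mem_map, forall_exists_index, and_imp, forall_apply_eq_imp_iff₂]
    exact fun p hp => ⟨(h.lt p hp).2, (h.lt p hp).1⟩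
  · simp only [List.mem_map, forall_exists_index, and_imp, forall_apply_eq_imp_iff₂]
    intro p hp p' hp' hn
    have := h.dist₂ p hp p' hp' hn
    simp only [Prod.fst_swap, Prod.snd_swap]
    omega
  · simp only [List.mem_map, forall_exists_index, and_imp, forall_apply_eq_imp_iff₂]
    intro p hp p' hp' hn
    have := h.dist₁ p hp p' hp' hn
    simp only [Prod.fst_swap, Prod.snd_swap]
    omega
  · simp only [List.mem_map, forall_exists_index, and_imp, forall_apply_eq_imp_iff₂]
    intro p hp x y e h₁ h₂
    simp only [Prod.fst_swap, Prod.snd_swap] at e h₁ h₂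
    exact (h.label p hp y x (by omega) (by omega) (by omega)).symm

theorem Inv.mono (h : Inv u v m L) {m' : ℕ} (hm : m' ≤ m) (hL : ∀ p ∈ L', p ∈ L) :
    Inv u v m' L' := by
  have := Nat.pow_le_pow_right (n := 2) (by omega) hm
  refine ⟨fun p hp => h.lt p (hL p hp), fun p hp p' hp' hn => ?_, fun p hp p' hp' hn => ?_,
    fun p hp x y e h₁ h₂ => h.label p (hL p hp) x y e (by omega) (by omega)⟩
  · exact h.dist₁ p (hL p hp) p' (hL p' hp') ⟨by have := hn.1; omega, by have := hn.2; omega⟩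
  · exact h.dist₂ p (hL p hp) p' (hL p' hp') ⟨by have := hn.1; omega, by have := hn.2; omega⟩

/-- The pairs of constants. -/
def ends (u v : List A) : List (ℕ × ℕ) := [(0, 0), (u.length - 1, v.length - 1)]

theorem map_swap_ends : (ends u v).map Prod.swap = ends v u := rfl

theorem getElem?_eq_none_of_eq {x y : ℕ} (h : u[x]? = v[y]?) : x < u.length ↔ y < v.length := by
  by_cases hx : x < u.length
  · rw [List.getElem?_eq_getElem hx] at h
    have := List.getElem?_eq_some_iff.1 h.symm
    exact ⟨fun _ => this.1, fun _ => hx⟩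
  · rw [List.getElem?_eq_none (by omega)] at h
    have := List.getElem?_eq_none_iff.1 h.symm
    omega

theorem Inv.cons (h : Inv u v m L) (hx : x < u.length) (hy : y < v.length)
    (h₁ : ∀ p ∈ L, Near (2 ^ m) p.1 x → x + p.2 = p.1 + y)
    (h₂ : ∀ p ∈ L, Near (2 ^ m) p.2 y → x + p.2 = p.1 + y)
    (h₃ : ∀ x' y', x' + y = y' + x → x' < x + 2 ^ m → x < x' + 2 ^ m → u[x']? = v[y']?) :
    Inv u v m ((x, y) :: L) := by
  refine ⟨?_, ?_, ?_, ?_⟩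
  · simp only [List.mem_cons, forall_eq_or_imp]
    exact ⟨⟨hx, hy⟩, h.lt⟩
  · simp only [List.mem_cons, forall_eq_or_imp]
    refine ⟨⟨fun _ => trivial, fun p hp hn => ?_⟩, fun p hp => ⟨h₁ p hp, h.dist₁ p hp⟩⟩
    have := h₁ p hp ⟨hn.2, hn.1⟩
    omega
  · simp only [List.mem_cons, forall_eq_or_imp]
    refine ⟨⟨fun _ => trivial, fun p hp hn => ?_⟩, fun p hp => ⟨h₂ p hp, h.dist₂ p hp⟩⟩
    have := h₂ p hp ⟨hn.2, hn.1⟩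
    omega
  · simp only [List.mem_cons, forall_eq_or_imp]
    exact ⟨h₃, h.label⟩

/-- The answer is the translate of `x` by the displacement of the nearby pair. Anything within `2 ^
m` of `x` is within `2 ^ (m + 1)` of `p`, where the old invariant applies. -/
theorem Inv.near (h : Inv u v (m + 1) L) (h₀ : ((0, 0) : ℕ × ℕ) ∈ L) {p : ℕ × ℕ} (hp : p ∈ L)
    (hx : x < u.length) (hn : Near (2 ^ m) p.1 x) :
    ∃ y, x + p.2 = y + p.1 ∧ Inv u v m ((x, y) :: L) := by
  obtain ⟨hn₁, hn₂⟩ := hn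
  have e2 : 2 ^ (m + 1) = 2 * 2 ^ m := by omega
  have hpos := Nat.two_pow_pos m
  -- The translate is not negative: otherwise `p.2` would be close to the left end, which forces
  -- `p.1 = p.2`.
  have hge : p.1 ≤ x + p.2 := by
    by_contra hlt
    have := h.dist₂ _ h₀ p hp ⟨by simp, by simp; omega⟩
    simp at this
    omega
  refine ⟨x + p.2 - p.1, by omega, ?_⟩
  have hl := h.label p hp x (x + p.2 - p.1) (by omega) (by omega) (by omega)
  refine (h.mono (Nat.le_succ m) fun p hp => hp).cons hx ((getElem?_eq_none_of_eq hl).1 hx)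
    (fun p' hp' hn => ?_) (fun p' hp' hn => ?_) fun x' y' e k₁ k₂ => ?_
  · obtain ⟨k₁, k₂⟩ := hn
    have := h.dist₁ p hp p' hp' ⟨by omega, by omega⟩
    omega
  · obtain ⟨k₁, k₂⟩ := hn
    have := h.dist₂ p hp p' hp' ⟨by omega, by omega⟩
    omega
  · exact h.label p hp x' y' (by omega) (by omega) (by omega)

theorem take_drop_eq_iff {l : ℕ} : (u.drop x).take l = (v.drop y).take l ↔
    ∀ k < l, u[x + k]? = v[y + k]? := by
  refine ⟨fun h k hk => ?_, fun h => List.ext_getElem? fun k => ?_⟩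
  · have := congrArg (·[k]?) h
    simpa [List.getElem?_take, hk] using this
  · rw [List.getElem?_take, List.getElem?_take, List.getElem?_drop, List.getElem?_drop]
    split_ifs with hk
    · exact h k hk
    · rfl

theorem mem_freeOcc : x ∈ freeOcc (m + 1) α u ↔ 2 ^ m < x ∧ x + 2 ^ m + 1 < u.length ∧
    (u.drop (x - (2 ^ m - 1))).take (2 ^ (m + 1) - 1) = α := by
  simp only [freeOcc, Finset.mem_filter, Finset.mem_range, Nat.add_sub_cancel]
  have hpos := Nat.two_pow_pos m
  constructor
  · rintro ⟨h₁, h₂, h₃, h₄⟩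
    exact ⟨h₂, by omega, h₄⟩
  · rintro ⟨h₁, h₂, h₃⟩
    exact ⟨by omega, h₁, by omega, h₃⟩

/-- The neighbourhood of `x` is contained in that of `p`, so the translate is again a center of `α`.
It is free because the invariant for the extended list preserves short distances to both ends. -/
theorem Inv.freeOcc_cons (h : Inv u v (m + 1) L) (hL : ∀ p ∈ ends u v, p ∈ L) {p : ℕ × ℕ}
    (hp : p ∈ L) (hx : x ∈ freeOcc (m + 1) α u) (hn : Near (2 ^ m) p.1 x) :
    ∃ y ∈ freeOcc (m + 1) α v, x + p.2 = y + p.1 := by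
  have hpos := Nat.two_pow_pos m
  obtain ⟨hx₁, hx₂, hx₃⟩ := mem_freeOcc.1 hx
  obtain ⟨y, e, hy⟩ := h.near (hL _ (by simp [ends])) hp (by omega) hn
  have e2 : 2 ^ (m + 1) = 2 * 2 ^ m := by omega
  have hlt := (hy.lt (x, y) (by simp)).2
  have k₁ : 2 ^ m < y := by
    by_contra hc
    have := hy.dist₂ (x, y) (by simp) (0, 0) (by simp [hL (0, 0) (by simp [ends])])
      ⟨by simp; omega, by simp⟩
    simp at this
    omega
  have k₂ : y + 2 ^ m + 1 < v.length := by
    by_contra hc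
    have := hy.dist₂ (x, y) (by simp) (u.length - 1, v.length - 1)
      (by simp [hL (u.length - 1, v.length - 1) (by simp [ends])])
      ⟨by simp; omega, by simp; omega⟩
    simp at this
    omega
  refine ⟨y, mem_freeOcc.2 ⟨k₁, k₂, hx₃ ▸ take_drop_eq_iff.2 fun k hk => ?_⟩, e⟩
  obtain ⟨hn₁, hn₂⟩ := hn
  exact (h.label p hp _ _ (by omega) (by omega) (by omega)).symm

/-- Occurrences near picked positions are translated along the pairs. Two of them with the same
image come from pairs at distance at most `2 ^ (m + 1)` in `v`, which have equal displacements, so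
the map is injective. -/
theorem Inv.card_freeOcc_le (h : Inv u v (m + 1) L) (hL : ∀ p ∈ ends u v, p ∈ L)
    (hn : ∀ x ∈ freeOcc (m + 1) α u, ∃ p ∈ L, Near (2 ^ m) p.1 x) {s : Finset ℕ}
    (hs : ∀ y ∈ freeOcc (m + 1) α v, (∃ p ∈ L, Near (2 ^ m) p.2 y) → y ∈ s) :
    (freeOcc (m + 1) α u).card ≤ s.card := by
  have : ∀ x, ∃ y, x ∈ freeOcc (m + 1) α u →
      y ∈ s ∧ ∃ p ∈ L, Near (2 ^ m) p.1 x ∧ x + p.2 = y + p.1 := fun x => by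
    by_cases hx : x ∈ freeOcc (m + 1) α u
    · obtain ⟨p, hp, hn⟩ := hn x hx
      obtain ⟨y, hy, e⟩ := h.freeOcc_cons hL hp hx hn
      refine ⟨y, fun _ => ⟨hs y hy ⟨p, hp, ?_⟩, p, hp, hn, e⟩⟩
      obtain ⟨h₁, h₂⟩ := hn
      exact ⟨by omega, by omega⟩
    · exact ⟨0, fun h => (hx h).elim⟩
  choose f hf using this
  refine Finset.card_le_card_of_injOn f (fun x hx => (hf x hx).1) fun x hx x' hx' e => ?_
  obtain ⟨-, p, hp, ⟨h₁, h₂⟩, e₁⟩ := hf x hx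
  obtain ⟨-, p', hp', ⟨h₁', h₂'⟩, e₁'⟩ := hf x' hx'
  have e2 : 2 ^ (m + 1) = 2 * 2 ^ m := by omega
  have := h.dist₂ p hp p' hp' ⟨by omega, by omega⟩
  omega

/-- Far from all pairs the distance conditions are void, and a common `α` of length `2 ^ (m + 1) -
1` is exactly the required agreement of neighbourhoods. -/
theorem Inv.far (h : Inv u v m L) (hx : x ∈ freeOcc (m + 1) α u) (hy : y ∈ freeOcc (m + 1) α v)
    (hx' : ∀ p ∈ L, ¬ Near (2 ^ m) p.1 x) (hy' : ∀ p ∈ L, ¬ Near (2 ^ m) p.2 y) :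
    Inv u v m ((x, y) :: L) := by
  have hpos := Nat.two_pow_pos m
  obtain ⟨hx₁, hx₂, hx₃⟩ := mem_freeOcc.1 hx
  obtain ⟨hy₁, hy₂, hy₃⟩ := mem_freeOcc.1 hy
  refine h.cons (by omega) (by omega) (fun p hp hn => (hx' p hp hn).elim)
    (fun p hp hn => (hy' p hp hn).elim) fun x' y' e k₁ k₂ => ?_
  have e2 : 2 ^ (m + 1) = 2 * 2 ^ m := by omega
  have := take_drop_eq_iff.1 (hx₃.trans hy₃.symm) (x' - (x - (2 ^ m - 1))) (by omega)
  convert this using 2 <;> omega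

/-- Few points do not come near many points with large gaps. -/
theorem not_spread_of_near {d n : ℕ} {s : Finset ℕ} {l : List ℕ}
    (h : ∀ y ∈ s, ∃ c ∈ l, Near d c y) (hl : l.length ≤ n) : ¬ Spread (2 * d) (n + 1) s := by
  rintro ⟨f, hf, hf'⟩
  have : ∀ i : Fin (n + 1), ∃ c : Fin l.length, Near d l[c] (f i) := fun i => by
    obtain ⟨c, hc, hn⟩ := h (f i) (hf i i.2)
    obtain ⟨k, hk, rfl⟩ := List.mem_iff_getElem.1 hc
    exact ⟨⟨k, hk⟩, hn⟩
  choose g hg using this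
  -- Two of the `n + 1` points share a center, so their distance is at most `2 * d`.
  obtain ⟨a, b, hab, e⟩ := Fintype.exists_ne_map_eq_of_card_lt g (by simp; omega)
  wlog hlt : a < b generalizing a b
  · exact this b a hab.symm e.symm (lt_of_le_of_ne (not_lt.1 hlt) hab.symm)
  have h₁ := Spread.lt hf' (i := a) (j := b) hlt b.2
  obtain ⟨k₁, k₂⟩ := hg a
  obtain ⟨k₃, k₄⟩ := hg b
  rw [e] at k₁ k₂
  omega

/-- No scattering formula tells `u` and `v` apart in `r` rounds. -/
def SameScat (r : ℕ) (u v : List A) : Prop :=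
  -- Only the largest `n` admitted for each `q` is compared. This is all that the strategy needs,
  -- and it removes `n` as a parameter of the search.
  ∀ q α n, 0 < q → n + q = r + 1 → α.length = 2 ^ q - 1 → (α <:+: u ∨ α <:+: v) →
    (Spread (2 ^ q) n (freeOcc q α u) ↔ Spread (2 ^ q) n (freeOcc q α v))

theorem SameScat.symm (h : SameScat r u v) : SameScat r v u :=
  fun q α n hq hn hα hs => (h q α n hq hn hα hs.symm).symm

/-- Strong induction on the number of old picks. If no free occurrence in `v` is far from the old
picks, equal scattering gives a cover of the occurrences in `u` by at most `L.length` intervals. The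
induction hypothesis answers their centers in an auxiliary play, which shows that `v` has at least
as many occurrences as `u`. The actual play shows that it has fewer. -/
theorem Inv.step (hu : u ≠ []) (hS : SameScat r u v) (hr : Inv u v r (ends u v))
    (hj : L.length + m + 1 = r) (h : Inv u v (m + 1) (ends u v ++ L)) (hx : x < u.length) :
    ∃ y < v.length, Inv u v m ((x, y) :: (ends u v ++ L)) := by
  induction hlen : L.length using Nat.strong_induction_on generalizing L m x with
  | _ j ih =>
  subst hlen
  suffices hs : ∃ y, Inv u v m ((x, y) :: (ends u v ++ L)) by
    obtain ⟨y, hy⟩ := hs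
    exact ⟨y, (hy.lt (x, y) (by simp)).2, hy⟩
  by_cases hnear : ∃ p ∈ ends u v ++ L, Near (2 ^ m) p.1 x
  · obtain ⟨p, hp, hn⟩ := hnear
    obtain ⟨y, -, hy⟩ := h.near (by simp [ends]) hp hx hn
    exact ⟨y, hy⟩
  have hpos := Nat.two_pow_pos m
  have e2 : 2 ^ (m + 1) = 2 * 2 ^ m := by omega
  have hlu := List.length_pos_of_ne_nil hu
  push Not at hnear
  have f₀ := hnear (0, 0) (by simp [ends])
  have f₁ := hnear (u.length - 1, v.length - 1) (by simp [ends])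
  simp only [Near] at f₀ f₁
  obtain ⟨α, hα⟩ : ∃ α, (u.drop (x - (2 ^ m - 1))).take (2 ^ (m + 1) - 1) = α := ⟨_, rfl⟩
  have hxα : x ∈ freeOcc (m + 1) α u := mem_freeOcc.2 ⟨by omega, by omega, hα⟩
  by_contra hno
  have hc : ∀ y ∈ freeOcc (m + 1) α v, ∃ p ∈ ends u v ++ L, Near (2 ^ m) p.2 y := by
    intro y hy
    by_contra hc
    push Not at hc
    exact hno ⟨y, (h.mono (Nat.le_succ m) fun p hp => hp).far hxα hy hnear hc⟩
  -- Free occurrences are never near the constants, so only the `L.length` picks count.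
  have hc' : ∀ y ∈ freeOcc (m + 1) α v, ∃ c ∈ L.map Prod.snd, Near (2 ^ m) c y := by
    intro y hy
    obtain ⟨p, hp, hn⟩ := hc y hy
    obtain ⟨h₁, h₂, -⟩ := mem_freeOcc.1 hy
    obtain ⟨n₁, n₂⟩ := hn
    simp only [ends, List.cons_append, List.nil_append, List.mem_cons] at hp
    rcases hp with rfl | rfl | hp
    · simp at n₂; omega
    · simp at n₁; omega
    · exact ⟨p.2, List.mem_map_of_mem hp, n₁, n₂⟩
  have hv := not_spread_of_near hc' (n := L.length) (by simp)
  -- Here `q = m + 1` and `n = L.length + 1`, and `n + q = r + 1` because exactly `m + 1` rounds are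
  -- left.
  rw [← e2, ← hS (m + 1) α (L.length + 1) (by omega) (by omega) ?_ ?_] at hv
  rotate_left
  · rw [← hα, List.length_take, List.length_drop]; omega
  · refine .inl ?_
    rw [← hα]
    exact (List.take_prefix _ _).isInfix.trans (List.drop_suffix _ _).isInfix
  obtain ⟨cs, hcs, hcs', hcov⟩ := exists_cover hv
  -- the Duplicator can answer the centers of the covering intervals
  have key : ∀ l : List ℕ, l.length ≤ L.length → (∀ c ∈ l, c < u.length) →
      ∃ L' : List (ℕ × ℕ), L'.length = l.length ∧ (∀ c ∈ l, ∃ p ∈ L', p.1 = c) ∧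
        Inv u v (r - l.length) (ends u v ++ L') := by
    intro l
    induction l with
    | nil => exact fun _ _ => ⟨[], rfl, by simp, by simpa using hr⟩
    | cons c l ihl =>
      intro hl hc
      simp only [List.length_cons] at hl
      obtain ⟨L', h₁, h₂, h₃⟩ := ihl (by omega) fun c' hc' => hc c' (List.mem_cons_of_mem _ hc')
      have e : r - l.length = (r - (l.length + 1)) + 1 := by omega
      rw [e] at h₃
      -- The auxiliary play so far has fewer than `L.length` picks, so the induction hypothesis
      -- applies.
      obtain ⟨y, -, hy⟩ := ih L'.length (by omega) (by omega) h₃ (hc c List.mem_cons_self) rfl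
      refine ⟨(c, y) :: L', by simp [h₁], ?_, hy.mono le_rfl fun p hp => ?_⟩
      · simp only [List.mem_cons, forall_eq_or_imp]
        refine ⟨⟨_, .inl rfl, rfl⟩, fun c' hc' => ?_⟩
        obtain ⟨p, hp, e⟩ := h₂ c' hc'
        exact ⟨p, .inr hp, e⟩
      · simp only [List.mem_append, List.mem_cons] at hp ⊢
        tauto
  obtain ⟨L', h₁, h₂, h₃⟩ := key (cs.map (· + 2 ^ m)) (by simpa using hcs) (by
    simp only [List.mem_map, forall_exists_index, and_imp, forall_apply_eq_imp_iff₂]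
    intro c hc
    have := (mem_freeOcc.1 (hcs' c hc)).2.1
    omega)
  -- There are at most `L.length` centers, so at least `m + 1` rounds remain in the auxiliary play.
  have h₄ : Inv u v (m + 1) (ends u v ++ L') :=
    h₃.mono (by simp; omega) fun p hp => hp
  have c₁ := h₄.card_freeOcc_le (α := α) (by simp +contextual) (fun z hz => by
    obtain ⟨c, hc, hcz⟩ := hcov z hz
    obtain ⟨p, hp, e⟩ := h₂ (c + 2 ^ m) (List.mem_map_of_mem hc)
    exact ⟨p, by simp [hp], by omega, by omega⟩) (fun y hy _ => hy)
  -- The occurrences in `v` are near the old picks, and so are their images in `u`; as `x` is far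
  -- from these, it is missed.
  have c₂ := (h.swap).card_freeOcc_le (α := α) (s := (freeOcc (m + 1) α u).erase x)
    (fun p hp => by
      rw [List.map_append, map_swap_ends]
      exact List.mem_append_left _ hp) (fun y hy => by
    obtain ⟨p, hp, hn⟩ := hc y hy
    exact ⟨p.swap, List.mem_map_of_mem hp, hn⟩) (fun y hy ⟨p, hp, hn⟩ => by
    obtain ⟨p', hp', rfl⟩ := List.mem_map.1 hp
    refine Finset.mem_erase.2 ⟨?_, hy⟩
    rintro rfl
    exact hnear p' hp' hn)
  have := Finset.card_erase_lt_of_mem hxα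
  omega

/-- With no rounds left, equality of distances up to `2 ^ 0 = 1` preserves equality and successor,
and the neighbourhoods are the letters themselves. -/
theorem Inv.isPartialIso {a : List (Fin u.length)} {b : List (Fin v.length)}
    (hab : a.length = b.length)
    (h : Inv u v 0 (ends u v ++ (a.map Fin.val).zip (b.map Fin.val))) : IsPartialIso u v a b := by
  set Z := ends u v ++ (a.map Fin.val).zip (b.map Fin.val) with hZ
  have e₁ : named u a = Z.map Prod.fst := by
    simp [hZ, named, ends, List.map_fst_zip, hab]
  have e₂ : named v b = Z.map Prod.snd := by
    simp [hZ, named, ends, List.map_snd_zip, hab]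
  refine ⟨by rw [e₁, e₂]; simp, fun i hi j hj => ?_⟩
  rw [e₁] at hi hj ⊢
  rw [e₂]
  rw [List.length_map] at hi hj
  have hpi := List.getElem_mem hi
  have hpj := List.getElem_mem hj
  simp only [List.getD_eq_getElem?_getD, List.getElem?_map, List.getElem?_eq_getElem hi,
    List.getElem?_eq_getElem hj, Option.map_some, Option.getD_some]
  refine ⟨⟨fun e => ?_, fun e => ?_⟩, ⟨fun e => ?_, fun e => ?_⟩, ?_⟩
  · have := h.dist₁ _ hpi _ hpj ⟨by omega, by omega⟩
    omega
  · have := h.dist₂ _ hpi _ hpj ⟨by omega, by omega⟩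
    omega
  · have := h.dist₁ _ hpi _ hpj ⟨by omega, by simp; omega⟩
    omega
  · have := h.dist₂ _ hpi _ hpj ⟨by omega, by simp; omega⟩
    omega
  · exact h.label _ hpi _ _ (by omega) (by simp) (by simp)

theorem Inv.not_spoilerWinsFrom (hu : u ≠ []) (hv : v ≠ []) (hS : SameScat r u v)
    (hr : Inv u v r (ends u v)) {a : List (Fin u.length)} {b : List (Fin v.length)}
    (hab : a.length = b.length) (hm : a.length + m = r)
    (h : Inv u v m (ends u v ++ (a.map Fin.val).zip (b.map Fin.val))) :
    ¬ SpoilerWinsFrom u v m a b := by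
  induction m generalizing a b with
  | zero => exact fun hs => hs (h.isPartialIso hab)
  | succ m ih =>
    have hz (x : Fin u.length) (y : Fin v.length)
        (hi : Inv u v m (((x : ℕ), (y : ℕ)) :: (ends u v ++ (a.map Fin.val).zip (b.map Fin.val)))) :
        ¬ SpoilerWinsFrom u v m (a ++ [x]) (b ++ [y]) := by
      refine ih (by simp [hab]) (by simp; omega) (hi.mono le_rfl fun p hp => ?_)
      rw [List.map_append, List.map_append, List.zip_append (by simp [hab])] at hp
      simp only [List.mem_append, List.map_cons, List.map_nil, List.zip_cons_cons,
        List.zip_nil_right, List.mem_cons] at hp ⊢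
      tauto
    rintro (⟨x, hx⟩ | ⟨y, hy⟩)
    · obtain ⟨y, hy, hi⟩ := Inv.step hu hS hr (by simp [hab] at *; omega) h x.2
      exact hz x ⟨y, hy⟩ hi (hx ⟨y, hy⟩)
    · have hr' := hr.swap
      have h' := h.swap
      rw [List.map_append] at h'
      rw [map_swap_ends] at hr' h'
      obtain ⟨x, hx, hi⟩ := Inv.step hv hS.symm hr' (by simp [hab] at *; omega) h' y.2
      refine hz ⟨x, hx⟩ y (hi.swap.mono le_rfl fun p hp => ?_) (hy ⟨x, hx⟩)
      rw [List.map_cons, List.map_append, List.map_map, map_swap_ends]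
      simpa using hp

end Strategy

/-! ## Distinguishability formulas exist -/

section Features

variable {A : Type} {u v : List A} {r s : ℕ}

/-- The longest length of the prefixes and suffixes that are looked at in `r` rounds. -/
def radius (r : ℕ) (u v : List A) : ℕ := min (2 ^ r) (min u.length v.length)

/-- One of the features that are visible in `r` rounds tells `u` and `v` apart. -/
def Feature (r : ℕ) (u v : List A) : Prop :=
  (u.length ≠ v.length ∧ min u.length v.length ≤ 2 ^ r + 1) ∨
    u.take (radius r u v) ≠ v.take (radius r u v) ∨
    suff (radius r u v) u ≠ suff (radius r u v) v ∨ ¬ SameScat r u v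

/-- If there is no feature, agreement of lengths, prefixes and suffixes is the invariant for the two
constants, and equal scattering carries it through `r` rounds. -/
theorem Feature.of_spoilerWins (hu : u ≠ []) (hv : v ≠ []) (h : SpoilerWins r u v) :
    Feature r u v := by
  by_contra hf
  simp only [Feature, not_or, not_and, not_not] at hf
  obtain ⟨h₁, h₂, h₃, h₄⟩ := hf
  have lu := List.length_pos_of_ne_nil hu
  have lv := List.length_pos_of_ne_nil hv
  have hpos := Nat.two_pow_pos r
  -- Either the lengths agree, or the constants are more than `2 ^ r` apart in both strings and
  -- their distance is unrestricted.
  have e : u.length = v.length ∨ 2 ^ r + 1 < u.length ∧ 2 ^ r + 1 < v.length := by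
    by_cases e : u.length = v.length
    · exact .inl e
    · have := h₁ e
      omega
  have hr : Inv u v r (ends u v) := by
    refine ⟨?_, ?_, ?_, ?_⟩
    · simp [ends]; omega
    · simp only [ends, List.mem_cons, List.not_mem_nil, or_false, forall_eq_or_imp, forall_eq, Near]
      refine ⟨⟨?_, ?_⟩, ?_, ?_⟩ <;> rintro ⟨h, h'⟩ <;>
        first | omega | dsimp only at *
    · simp only [ends, List.mem_cons, List.not_mem_nil, or_false, forall_eq_or_imp, forall_eq, Near]
      refine ⟨⟨?_, ?_⟩, ?_, ?_⟩ <;> rintro ⟨h, h'⟩ <;>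
        first | omega | dsimp only at *
    · simp only [ends, List.mem_cons, List.not_mem_nil, or_false, forall_eq_or_imp, forall_eq]
      refine ⟨fun x y exy k₁ _ => ?_, fun x y exy k₁ k₂ => ?_⟩
      · obtain rfl : x = y := by omega
        by_cases hx : x < radius r u v
        · have := congrArg (·[x]?) h₂
          simpa [List.getElem?_take, hx] using this
        -- As `x < 2 ^ r`, the radius is here the shorter length. Then the lengths agree, and both
        -- positions are out of range.
        · have : u.length ≤ x ∧ v.length ≤ x := by
            unfold radius at hx
            omega
          rw [List.getElem?_eq_none this.1, List.getElem?_eq_none this.2]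
      · by_cases hx : x < u.length
        · have hk : u.length - radius r u v ≤ x := by unfold radius; omega
          have := congrArg (·[x - (u.length - radius r u v)]?) h₃
          have hk' : radius r u v ≤ u.length ∧ radius r u v ≤ v.length := by unfold radius; omega
          simp only [suff, List.getElem?_drop] at this
          convert this using 2 <;> omega
        · rw [List.getElem?_eq_none (by omega), List.getElem?_eq_none (by omega)]
  exact Inv.not_spoilerWinsFrom hu hv h₄ hr rfl (by simp) (by simpa using hr) h

/-- A logarithmic number of rounds always suffices: different strings of equal length differ in
their full prefixes. So the search for the level has a logarithmic range. -/
theorem Feature.of_ne (h : u ≠ v) (hu : u.length ≤ 2 ^ r) (hv : v.length ≤ 2 ^ r) :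
    Feature r u v := by
  by_cases e : u.length = v.length
  · refine .inr (.inl fun h' => h ?_)
    have : radius r u v = u.length := by unfold radius; omega
    rw [this, List.take_length] at h'
    rwa [List.take_of_length_le (by omega)] at h'
  · exact .inl ⟨e, by omega⟩

/-- The Spoiler picks all positions of `u` from left to right. -/
theorem spoilerWinsFrom_of_ne (h : u ≠ v) (hu : u ≠ []) (hv : v ≠ []) {m : ℕ}
    {a : List (Fin u.length)} {b : List (Fin v.length)} (hab : a.length = b.length)
    (hm : a.length + m = u.length) (ha : ∀ (i : ℕ) (x : Fin u.length), a[i]? = some x → x.val = i) :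
    SpoilerWinsFrom u v m a b := by
  induction m generalizing a b with
  | succ m ih =>
    refine .inl ⟨⟨a.length, by omega⟩, fun y => ih (by simp [hab]) (by simp; omega) fun i x hx => ?_⟩
    rcases lt_trichotomy i a.length with hi | rfl | hi
    · rw [List.getElem?_append_left hi] at hx
      exact ha i x hx
    · simp at hx
      simp [← hx]
    · rw [List.getElem?_append_right hi.le, List.getElem?_eq_none (by simp; omega)] at hx
      simp at hx
  | zero =>
    rintro ⟨-, hp⟩
    have lu := List.length_pos_of_ne_nil hu
    have lv := List.length_pos_of_ne_nil hv
    have hl : (named u a).length = u.length + 2 := by simp [named]; omega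
    have hget : ∀ i < u.length, (named u a).getD (i + 2) 0 = i := fun i hi => by
      have e : a[i]? = some a[i] := List.getElem?_eq_getElem (by omega)
      have := ha i _ e
      simp [named, e, this]
    -- The answers are forced, starting from `min` and following successors. The index is shifted by
    -- `2` since the constants come first.
    have hget' : ∀ i < u.length, (named v b).getD (i + 2) 0 = i := fun i hi => by
      induction i with
      | zero =>
        have := (hp 0 (by omega) 2 (by omega)).1.1 (by rw [hget 0 hi]; rfl)
        rw [← this]
        rfl
      | succ i ih =>
        have := (hp (i + 2) (by omega) (i + 1 + 2) (by omega)).2.1.1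
          (by rw [hget _ hi, hget _ (by omega)])
        rw [this, ih (by omega)]
    -- The last pick in `u` coincides with `max`, so its partner does as well.
    have e : u.length = v.length := by
      have := (hp 1 (by omega) (u.length - 1 + 2) (by omega)).1.1
        (by rw [hget _ (by omega)]; rfl)
      rw [hget' _ (by omega)] at this
      have e1 : (named v b).getD 1 0 = v.length - 1 := rfl
      omega
    refine h (List.ext_getElem? fun i => ?_)
    by_cases hi : i < u.length
    · have := (hp (i + 2) (by omega) 0 (by omega)).2.2
      rwa [hget _ hi, hget' _ hi] at this
    · rw [List.getElem?_eq_none (by omega), List.getElem?_eq_none (by omega)]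

/-- The Spoiler wins in some number of rounds, so the infimum that defines the similarity is
attained. -/
theorem Feature.efsim (h : u ≠ v) (hu : u ≠ []) (hv : v ≠ []) : Feature (EFsim u v) u v :=
  .of_spoilerWins hu hv <| Nat.sInf_mem (s := {r | SpoilerWins r u v})
    ⟨u.length, spoilerWinsFrom_of_ne h hu hv rfl (by simp) (by simp)⟩

theorem le_foldr_max {l : List ℕ} {n : ℕ} (h : n ∈ l) : n ≤ l.foldr max 0 := by
  induction l with
  | nil => simp at h
  | cons a l ih =>
    rcases List.mem_cons.1 h with rfl | h
    · exact le_max_left _ _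
    · exact (ih h).trans (le_max_right _ _)

theorem Sample.efsim_le_rank (S : Sample A) (hu : u ∈ S.pos) (hv : v ∈ S.neg) :
    EFsim u v ≤ S.rank :=
  (le_foldr_max (List.mem_map_of_mem (f := fun v => EFsim u v) hv)).trans
    (le_foldr_max (List.mem_map_of_mem
      (f := fun u => (S.neg.map fun v => EFsim u v).foldr max 0) hu))

/-- The level only occurs in upper bounds. This allows a separate, possibly smaller level for each
pair instead of the rank of the sample. -/
theorem Phi_mono (h : r ≤ s) : Phi r u v ⊆ Phi s u v := by
  have h' := Nat.pow_le_pow_right (n := 2) (by omega) h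
  refine Set.union_subset_union (Set.union_subset_union (Set.union_subset_union ?_ ?_) ?_) ?_
  · rintro φ (⟨n, h₁, h₂, h₃, h₄⟩ | ⟨n, h₁, h₂, h₃, h₄⟩)
    · exact .inl ⟨n, h₁, h₂, by omega, h₄⟩
    · exact .inr ⟨n, h₁, h₂, by omega, h₄⟩
  · rintro φ ⟨k, h₁, h₂, h₃⟩
    exact ⟨k, h₁, by omega, h₃⟩
  · rintro φ ⟨k, h₁, h₂, h₃⟩
    exact ⟨k, h₁, by omega, h₃⟩
  · rintro φ ⟨q, α, n, h₁, h₂, h₃, h₄, h₅⟩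
    exact ⟨q, α, n, h₁, h₂, h₃, by omega, h₅⟩

theorem distLE_mem_Phi (hu : u ≠ []) (h : u.length < v.length) (h' : u.length ≤ 2 ^ r + 1) :
    distLE (u.length - 1) tMin tMax ∈ Phi r u v := by
  have lu := List.length_pos_of_ne_nil hu
  exact .inl (.inl (.inl (.inl ⟨_, h, le_rfl, by omega, by omega, rfl⟩)))

theorem not_distLE_mem_Phi (h : v.length < u.length) (h' : v.length ≤ 2 ^ r + 1) :
    ∼(distLE (v.length - 1) tMin tMax) ∈ Phi r u v :=
  .inl (.inl (.inl (.inr ⟨v.length, h, le_rfl, by omega, by omega, rfl⟩)))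

theorem prefEq_mem_Phi (h : u.take (radius r u v) ≠ v.take (radius r u v)) :
    prefEq (u.take (radius r u v)) ∈ Phi r u v :=
  .inl (.inl (.inr ⟨_, h, by unfold radius; omega, by unfold radius; omega, by unfold radius; omega,
    .inl rfl⟩))

theorem suffEq_mem_Phi (h : suff (radius r u v) u ≠ suff (radius r u v) v) :
    suffEq (suff (radius r u v) u) ∈ Phi r u v :=
  .inl (.inr ⟨_, h, by unfold radius; omega, by unfold radius; omega, by unfold radius; omega,
    .inl rfl⟩)

theorem scatGE_mem_Phi {q n : ℕ} {α : List A} (hq : 0 < q) (hα : α.length = 2 ^ q - 1)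
    (hs : α <:+: u ∨ α <:+: v) (hn : n + q = r + 1) (hu : Spread (2 ^ q) n (freeOcc q α u))
    (hv : ¬ Spread (2 ^ q) n (freeOcc q α v)) : scatGE q α n ∈ Phi r u v :=
  .inr ⟨q, α, n, hq, hα, hs, hn.le,
    .inl ⟨not_le.1 fun h => hv (le_numSegments_iff.1 h), le_numSegments_iff.2 hu, rfl⟩⟩

theorem not_scatGE_mem_Phi {q n : ℕ} {α : List A} (hq : 0 < q) (hα : α.length = 2 ^ q - 1)
    (hs : α <:+: u ∨ α <:+: v) (hn : n + q = r + 1) (hu : ¬ Spread (2 ^ q) n (freeOcc q α u))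
    (hv : Spread (2 ^ q) n (freeOcc q α v)) : ∼(scatGE q α n) ∈ Phi r u v :=
  .inr ⟨q, α, n, hq, hα, hs, hn.le,
    .inr (.inl ⟨not_le.1 fun h => hu (le_numSegments_iff.1 h), le_numSegments_iff.2 hv, rfl⟩)⟩

end Features

/-! ## Writing formulas -/

section Terms

variable {A : Type} {k : ℕ}

def funcCode {l : ℕ} : WordFunc l → ℕ
  | .min => 0
  | .max => 1

/-- A number for each term. -/
def code : Tm A k → ℕ
  | Term.var (Sum.inl e) => e.elim
  | Term.var (Sum.inr i) => i + 2
  | Term.func f _ => funcCode f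

def termText (c : ℕ) : List (OutSym A) :=
  if decide (c = 0) then [.min] else if decide (c = 1) then [.max] else encNum (c - 2)

theorem encodeTerm_eq (t : Tm A k) : encodeTerm t = termText (code t) := by
  rcases t with (e | i) | ⟨_ | _, _⟩
  · exact e.elim
  · simp [encodeTerm, code, termText, encNum]
  · rfl
  · rfl

theorem code_le (t : Tm A k) : code t ≤ k + 1 := by
  rcases t with (e | i) | ⟨_ | _, _⟩
  · exact e.elim
  · simp [code]
  · simp [code, funcCode]
  · simp [code, funcCode]

@[simp] theorem code_up (t : Tm A k) : code (up t) = code t := by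
  rcases t with (e | i) | ⟨_ | _, _⟩
  · exact e.elim
  · rfl
  · rfl
  · rfl

@[simp] theorem code_tNew : code (tNew : Tm A (k + 1)) = k + 2 := rfl
@[simp] theorem code_tMin : code (tMin : Tm A k) = 0 := rfl
@[simp] theorem code_tMax : code (tMax : Tm A k) = 1 := rfl

open OutSym in
theorem encodeFormula_not (φ : Fm A k) :
    encodeFormula (∼φ) = [imp] ++ (encodeFormula φ ++ [bot]) := rfl

open OutSym in
theorem encodeFormula_ex (φ : Fm A (k + 1)) :
    encodeFormula (∃' φ) = [imp, all, imp] ++ (encodeFormula φ ++ [bot, bot]) := by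
  have : encodeFormula (∃' φ) = imp :: (all :: imp :: (encodeFormula φ ++ [bot]) ++ [bot]) := rfl
  simp [this]

-- Conjunction abbreviates the negation of `φ → ¬ψ`. In Polish notation it consists of fixed blocks
-- around the codes of the two parts, which are the `tok` items below.
open OutSym in
theorem encodeFormula_inf (φ ψ : Fm A k) : encodeFormula (φ ⊓ ψ) =
    [imp, imp] ++ (encodeFormula φ ++ ([imp] ++ (encodeFormula ψ ++ [bot, bot]))) := by
  have : encodeFormula (φ ⊓ ψ) = imp :: (imp :: (encodeFormula φ ++
    imp :: (encodeFormula ψ ++ [bot])) ++ [bot]) := rfl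
  simp [this]

open OutSym in
theorem encodeFormula_sup (φ ψ : Fm A k) : encodeFormula (φ ⊔ ψ) =
    [imp, imp] ++ (encodeFormula φ ++ ([bot] ++ encodeFormula ψ)) := by
  have : encodeFormula (φ ⊔ ψ) = imp :: (imp :: (encodeFormula φ ++ [bot]) ++ encodeFormula ψ) :=
    rfl
  simp [this]

open OutSym in
theorem encodeFormula_top : encodeFormula (⊤ : Fm A k) = [imp] ++ [bot, bot] := rfl

end Terms

/-! ### Work items -/

/-- Kinds below `4` are terminals, the others nonterminals. Except in `tok`, field `d` is a distance
or length, `a` a position of the input where a letter or string stands, `b` the number of enclosing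
quantifiers; `x` and `y` are codes of terms, but `y` is a counter in `iTail` and `iScat`. In
`iLeft`, `iTail` and `iScat` the string has length `2 * d - 1`. -/
def tok (d : ℕ) : Item := ⟨0, d, 0, 0, 0, 0⟩
def iLetter (a x : ℕ) : Item := ⟨1, 0, a, 0, x, 0⟩
def iSucc (x y : ℕ) : Item := ⟨2, 0, 0, 0, x, y⟩
def iEq (x y : ℕ) : Item := ⟨3, 0, 0, 0, x, y⟩
def iDist (d b x y : ℕ) : Item := ⟨4, d, 0, b, x, y⟩
def iBetween (a d b x y : ℕ) : Item := ⟨5, d, a, b, x, y⟩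
def iAfter (a d b x : ℕ) : Item := ⟨6, d, a, b, x, 0⟩
def iBefore (a d b y : ℕ) : Item := ⟨7, d, a, b, 0, y⟩
def iPref (a d : ℕ) : Item := ⟨8, d, a, 0, 0, 0⟩
def iSuff (a d : ℕ) : Item := ⟨9, d, a, 0, 0, 0⟩
def iOcc (a d b x : ℕ) : Item := ⟨10, d, a, b, x, 0⟩
def iLeft (a d b x : ℕ) : Item := ⟨11, d, a, b, x, 0⟩
def iTail (a d b x y : ℕ) : Item := ⟨12, d, a, b, x, y⟩
def iScat (a d y : ℕ) : Item := ⟨13, d, a, 0, 0, y⟩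

def lInf (l l' : List Item) : List Item := tok 0 :: (l ++ (tok 1 :: (l' ++ [tok 2])))
def lSup (l l' : List Item) : List Item := tok 0 :: (l ++ (tok 4 :: l'))
def lEx (l : List Item) : List Item := tok 3 :: (l ++ [tok 2])
def lNot (l : List Item) : List Item := tok 1 :: (l ++ [tok 4])
def lTop : List Item := [tok 1, tok 2]

/-- The expansion of an item: the distances. -/
def subDist (d b x y : ℕ) : List Item :=
  if decide (d = 0) then [iEq x y] else if decide (d = 1) then lSup [iEq x y] [iSucc x y]
  else lEx (lInf [iDist (d / 2) (b + 1) x (b + 2)] [iDist ((d + 1) / 2) (b + 1) (b + 2) y])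

/-- Since the empty string stands for the successor relation, the formulas for one and two letters
are instances of the general splitting and need no cases of their own. -/
def subBetween (d a b x y : ℕ) : List Item :=
  if decide (d = 0) then [iSucc x y] else
  lEx (lInf (lInf [iLetter (a + ((d + 1) / 2 - 1)) (b + 2)]
    [iBetween a ((d + 1) / 2 - 1) (b + 1) x (b + 2)])
    [iBetween (a + (d + 1) / 2) (d - (d + 1) / 2) (b + 1) (b + 2) y])

def subAfter (d a b x : ℕ) : List Item :=
  if decide (d = 0) then lTop else
  if decide (d = 1) then lEx (lInf [iSucc x (b + 2)] [iLetter a (b + 2)]) else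
  lEx (lInf (lInf [iLetter (a + ((d + 1) / 2 - 1)) (b + 2)]
    [iBetween a ((d + 1) / 2 - 1) (b + 1) x (b + 2)])
    [iAfter (a + (d + 1) / 2) (d - (d + 1) / 2) (b + 1) (b + 2)])

/-- Length two is an exception: its formula lacks the conjunct for the empty string to the left that
the general splitting would produce. -/
def subBefore (d a b y : ℕ) : List Item :=
  if decide (d = 0) then lTop else
  if decide (d = 1) then lEx (lInf [iSucc (b + 2) y] [iLetter a (b + 2)]) else
  if decide (d = 2) then
    lEx (lInf [iLetter a (b + 2)] [iBetween (a + 1) 1 (b + 1) (b + 2) y]) else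
  lEx (lInf (lInf [iLetter (a + ((d + 1) / 2 - 1)) (b + 2)]
    [iBefore a ((d + 1) / 2 - 1) (b + 1) (b + 2)])
    [iBetween (a + (d + 1) / 2) (d - (d + 1) / 2) (b + 1) (b + 2) y])

def subPref (d a : ℕ) : List Item :=
  if decide (d ≤ 1) then [iLetter a 0] else
  if decide (d ≤ 3) then lInf [iLetter a 0] [iAfter (a + 1) (d - 1) 0 0] else
  lInf [iLetter a 0] (lEx (lInf (lInf [iLetter (a + d / 2) 2]
    [iBetween (a + 1) (d / 2 - 1) 1 0 2]) [iAfter (a + d / 2 + 1) (d - (d / 2 + 1)) 1 2]))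

def subSuff (d a : ℕ) : List Item :=
  if decide (d ≤ 1) then [iLetter a 1] else
  if decide (d ≤ 3) then lInf [iLetter (a + (d - 1)) 1] [iBefore a (d - 1) 0 1] else
  lInf [iLetter (a + (d - 1)) 1] (lEx (lInf (lInf [iLetter (a + (d / 2 - 1)) 2]
    [iBefore a (d / 2 - 1) 1 2]) [iBetween (a + d / 2) (d - 1 - d / 2) 1 2 1]))

def subOcc (d a b x : ℕ) : List Item :=
  if decide (d = 0) then lTop else if decide (d = 1) then [iLetter a x] else
  lInf (lInf [iLetter (a + ((d + 1) / 2 - 1)) x] [iBefore a ((d + 1) / 2 - 1) b x])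
    [iAfter (a + (d + 1) / 2) (d - (d + 1) / 2) b x]

def subLeft (d a b x : ℕ) : List Item :=
  lEx (lInf (lInf (lInf (lNot [iDist (d - 1) (b + 1) (b + 2) x]) [iOcc a (d + d - 1) (b + 1) (b + 2)])
    (lNot [iDist d (b + 1) 0 (b + 2)])) (lNot [iDist d (b + 1) (b + 2) 1]))

def subTail (d a b x y : ℕ) : List Item :=
  if decide (y = 0) then
    lEx (lInf (lNot [iDist d (b + 1) x (b + 2)]) [iOcc a (d + d - 1) (b + 1) (b + 2)]) else
  lEx (lInf (lInf (lNot [iDist (d + d) (b + 1) x (b + 2)]) [iLeft a d (b + 1) (b + 2)])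
    [iTail a d (b + 1) (b + 2) (y - 1)])

def subScat (d a y : ℕ) : List Item :=
  if decide (y = 0) then lTop else if decide (y = 1) then lEx [iOcc a (d + d - 1) 1 2] else
  lEx (lInf [iLeft a d 1 2] [iTail a d 1 2 (y - 2)])

/-- The expansion of an item. -/
def sub (t : Item) : List Item :=
  if decide (t.kind < 4) then []
  else if decide (t.kind = 4) then subDist t.d t.b t.x t.y
  else if decide (t.kind = 5) then subBetween t.d t.a t.b t.x t.y
  else if decide (t.kind = 6) then subAfter t.d t.a t.b t.x
  else if decide (t.kind = 7) then subBefore t.d t.a t.b t.y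
  else if decide (t.kind = 8) then subPref t.d t.a
  else if decide (t.kind = 9) then subSuff t.d t.a
  else if decide (t.kind = 10) then subOcc t.d t.a t.b t.x
  else if decide (t.kind = 11) then subLeft t.d t.a t.b t.x
  else if decide (t.kind = 12) then subTail t.d t.a t.b t.x t.y
  else subScat t.d t.a t.y

/-! ### Strings as segments of the input. -/

section Segments

variable {A : Type} {T : List (InSym A)} {a m : ℕ} {w : List A}

/-- The string `w` stands at position `a` of the input. -/
def IsSeg (T : List (InSym A)) (a : ℕ) (w : List A) : Prop :=
  ∀ (i : ℕ) (h : i < w.length), T[a + i]? = some (.letter w[i])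

theorem IsSeg.take (h : IsSeg T a w) (m : ℕ) : IsSeg T a (w.take m) := fun i hi => by
  rw [List.length_take] at hi
  rw [h i (by omega)]
  simp

theorem IsSeg.drop (h : IsSeg T a w) (m : ℕ) : IsSeg T (a + m) (w.drop m) := fun i hi => by
  rw [List.length_drop] at hi
  rw [add_assoc, h (m + i) (by omega)]
  simp

end Segments

section Yields

variable {A : Type}

open OutSym in
def tokText (d : ℕ) : List (OutSym A) :=
  if decide (d = 0) then [imp, imp] else if decide (d = 1) then [imp]
  else if decide (d = 2) then [bot, bot] else if decide (d = 3) then [imp, all, imp] else [bot]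

open Classical in
noncomputable def letterText [Finite A] (T : List (InSym A)) (i : ℕ) : List (OutSym A) :=
  letI := Fintype.ofFinite A
  (Finset.univ.toList : List A).foldr
    (fun a l => if decide (sym T i = letterNum a + 3) then [.letter a] else l) []

theorem letterText_eq [Finite A] {T : List (InSym A)} {i : ℕ} {a : A}
    (h : T[i]? = some (.letter a)) : letterText T i = [.letter a] := by
  unfold letterText
  let _ := Fintype.ofFinite A
  have : a ∈ (Finset.univ.toList : List A) := by simp
  generalize (Finset.univ.toList : List A) = l at this
  induction l with
  | nil => simp at this
  | cons b l ih =>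
    have hs : sym T i = letterNum a + 3 := by rw [sym, h]; rfl
    by_cases hab : a = b
    · subst hab
      simp [hs]
    · have hne : letterNum a ≠ letterNum b := fun h => hab (letterNum_injective h)
      have := ih (by simpa [hab] using this)
      rw [List.foldr_cons, hs, if_neg (by simpa using hne)]
      rwa [hs] at this

/-- The text that an item contributes directly. -/
noncomputable def out [Finite A] (T : List (InSym A)) (t : Item) : List (OutSym A) :=
  if decide (t.kind = 0) then tokText t.d
  else if decide (t.kind = 1) then letterText T t.a ++ termText t.x
  else if decide (t.kind = 2) then [.succ] ++ (termText t.x ++ termText t.y)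
  else if decide (t.kind = 3) then [.eq] ++ (termText t.x ++ termText t.y)
  else []

theorem Item.env_le {t : Item} {B : ℕ} (h₀ : t.kind ≤ B) (h₁ : t.d ≤ B) (h₂ : t.a ≤ B)
    (h₃ : t.b ≤ B) (h₄ : t.x ≤ B) (h₅ : t.y ≤ B) (i : ℕ) : t.env i ≤ B :=
  cons_le h₀ (cons_le h₁ (cons_le h₂ (cons_le h₃ (cons_le h₄ (cons_le h₅ fun _ => Nat.zero_le _)))))
    i

variable [Finite A] {T : List (InSym A)} {B c c' : ℕ} {l l' : List Item} {o o' : List (OutSym A)}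

/-- The items expand to the text `o` in at most `c` steps, with parameters at most `B`. -/
def Yields (T : List (InSym A)) (B : ℕ) (l : List Item) (o : List (OutSym A)) (c : ℕ) : Prop :=
  ∃ n ≤ c, Der (out T) sub B l o n

theorem Yields.mono (h : Yields T B l o c) (hc : c ≤ c') : Yields T B l o c' :=
  let ⟨n, hn, h⟩ := h
  ⟨n, hn.trans hc, h⟩

theorem Yields.append (h : Yields T B l o c) (h' : Yields T B l' o' c') :
    Yields T B (l ++ l') (o ++ o') (c + c') :=
  let ⟨n, hn, h⟩ := h
  let ⟨n', hn', h'⟩ := h'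
  ⟨n + n', by omega, h.append h'⟩

theorem Yields.cons {t : Item} (h : Yields T B [t] o c) (h' : Yields T B l o' c') :
    Yields T B (t :: l) (o ++ o') (c + c') := h.append h'

theorem Yields.expand {t : Item} (ht : ∀ i, t.env i ≤ B) (h : Yields T B (sub t) o c)
    (hk : 4 ≤ t.kind) : Yields T B [t] o (c + 1) := by
  obtain ⟨n, hn, h⟩ := h
  refine ⟨n + 1, by omega, ?_⟩
  have e : out T t = [] := by
    unfold out
    rw [if_neg (by simp; omega), if_neg (by simp; omega), if_neg (by simp; omega),
      if_neg (by simp; omega)]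
  have := Der.cons (out := out T) (sub := sub) ht (l := []) (by simpa using h)
  simpa [e] using this

theorem Yields.atom {t : Item} (ht : ∀ i, t.env i ≤ B) (hk : t.kind < 4) :
    Yields T B [t] (out T t) 1 := by
  have e : sub t = [] := by
    unfold sub
    rw [if_pos (by simpa using hk)]
  have := Der.cons (out := out T) (sub := sub) ht (l := []) (by rw [e]; exact .nil)
  exact ⟨1, le_rfl, by simpa using this⟩

theorem Yields.tok {d : ℕ} (hd : d ≤ 4) (hB : 13 ≤ B) : Yields T B [tok d] (tokText d) 1 :=
  Yields.atom (t := WordLearn.tok d) (Item.env_le (by simp [WordLearn.tok])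
    (by simp [WordLearn.tok]; omega) (by simp [WordLearn.tok]) (by simp [WordLearn.tok])
    (by simp [WordLearn.tok]) (by simp [WordLearn.tok])) (by simp [WordLearn.tok])

variable {k : ℕ} {φ ψ : Fm A k}

theorem Yields.inf (hB : 13 ≤ B) (h : Yields T B l (encodeFormula φ) c)
    (h' : Yields T B l' (encodeFormula ψ) c') :
    Yields T B (lInf l l') (encodeFormula (φ ⊓ ψ)) (c + c' + 3) := by
  rw [encodeFormula_inf]
  exact (Yields.cons (.tok (by omega) hB) (h.append (Yields.cons (.tok (by omega) hB)
    (h'.append (.tok (by omega) hB))))).mono (by omega)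

theorem Yields.sup (hB : 13 ≤ B) (h : Yields T B l (encodeFormula φ) c)
    (h' : Yields T B l' (encodeFormula ψ) c') :
    Yields T B (lSup l l') (encodeFormula (φ ⊔ ψ)) (c + c' + 2) := by
  rw [encodeFormula_sup]
  exact (Yields.cons (.tok (by omega) hB) (h.append (Yields.cons (.tok (by omega) hB)
    h'))).mono (by omega)

theorem Yields.not (hB : 13 ≤ B) (h : Yields T B l (encodeFormula φ) c) :
    Yields T B (lNot l) (encodeFormula (∼φ)) (c + 2) := by
  rw [encodeFormula_not]
  exact (Yields.cons (.tok (by omega) hB) (h.append (.tok (by omega) hB))).mono (by omega)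

theorem Yields.ex (hB : 13 ≤ B) {φ : Fm A (k + 1)} (h : Yields T B l (encodeFormula φ) c) :
    Yields T B (lEx l) (encodeFormula (∃' φ)) (c + 2) := by
  rw [encodeFormula_ex]
  exact (Yields.cons (.tok (by omega) hB) (h.append (.tok (by omega) hB))).mono (by omega)

theorem Yields.top (hB : 13 ≤ B) : Yields T B lTop (encodeFormula (⊤ : Fm A k)) 2 := by
  rw [encodeFormula_top]
  exact Yields.cons (.tok (by omega) hB) (.tok (by omega) hB)

/-! ### The distinguishability formulas -/

theorem Yields.letter {a : ℕ} {x : A} (t : Tm A k) (h : T[a]? = some (.letter x)) (hB : 13 ≤ B)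
    (ha : a ≤ B) (hk : k + 2 ≤ B) : Yields T B [iLetter a (code t)] (encodeFormula (fLetter x t)) 1 := by
  have := code_le t
  have e : out T (iLetter a (code t)) = encodeFormula (fLetter x t) := by
    have : encodeFormula (fLetter x t) = .letter x :: encodeTerm t := rfl
    rw [this, encodeTerm_eq, out]
    simp [iLetter, letterText_eq h]
  rw [← e]
  exact .atom (Item.env_le (by simp [iLetter]; omega) (by simp [iLetter]) (by simpa [iLetter])
    (by simp [iLetter]) (by simp [iLetter]; omega) (by simp [iLetter])) (by simp [iLetter])

theorem Yields.succ (s t : Tm A k) (hB : 13 ≤ B) (hk : k + 2 ≤ B) :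
    Yields T B [iSucc (code s) (code t)] (encodeFormula (fSucc s t)) 1 := by
  have := code_le s
  have := code_le t
  have e : out T (iSucc (code s) (code t)) = encodeFormula (fSucc s t) := by
    have : encodeFormula (fSucc s t) = .succ :: (encodeTerm s ++ encodeTerm t) := rfl
    rw [this, encodeTerm_eq, encodeTerm_eq, out]
    simp [iSucc]
  rw [← e]
  exact .atom (Item.env_le (by simp [iSucc]; omega) (by simp [iSucc]) (by simp [iSucc])
    (by simp [iSucc]) (by simp [iSucc]; omega) (by simp [iSucc]; omega)) (by simp [iSucc])

theorem Yields.eq (s t : Tm A k) (hB : 13 ≤ B) (hk : k + 2 ≤ B) :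
    Yields T B [iEq (code s) (code t)] (encodeFormula (Term.bdEqual s t)) 1 := by
  have := code_le s
  have := code_le t
  have e : out T (iEq (code s) (code t)) = encodeFormula (Term.bdEqual s t) := by
    have : encodeFormula (Term.bdEqual s t) = .eq :: (encodeTerm s ++ encodeTerm t) := rfl
    rw [this, encodeTerm_eq, encodeTerm_eq, out]
    simp [iEq]
  rw [← e]
  exact .atom (Item.env_le (by simp [iEq]; omega) (by simp [iEq]) (by simp [iEq])
    (by simp [iEq]) (by simp [iEq]; omega) (by simp [iEq]; omega)) (by simp [iEq])

/-- Halving produces a binary tree with linearly many nodes. The count `11 * d - 6` for `d ≥ 1`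
solves the recursion, since joining two halves costs `6` further rounds; `d = 0` takes `2`. The
bound `13 ≤ B` covers the kinds of items. -/
theorem yields_distLE (d : ℕ) (s t : Tm A k) (hB : 13 ≤ B) (hk : k + d + 2 ≤ B) (h₁ : 2 ≤ c)
    (h₂ : 11 * d ≤ c + 6) :
    Yields T B [iDist d k (code s) (code t)] (encodeFormula (distLE d s t)) c := by
  induction d using Nat.strong_induction_on generalizing k c with
  | _ d ih =>
  have hs := code_le s
  have ht := code_le t
  suffices h : Yields T B (subDist d k (code s) (code t)) (encodeFormula (distLE d s t)) (c - 1) from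
    (h.expand (t := iDist d k (code s) (code t)) (Item.env_le (by simp [iDist]; omega)
      (by simp [iDist]; omega) (by simp [iDist]) (by simp [iDist]; omega) (by simp [iDist]; omega)
      (by simp [iDist]; omega)) (by simp [iDist])).mono (by omega)
  match d, ih with
  | 0, _ =>
    rw [distLE, subDist, if_pos (by simp)]
    exact (Yields.eq s t hB (by omega)).mono (by omega)
  | 1, _ =>
    rw [distLE, subDist, if_neg (by simp), if_pos (by simp)]
    exact ((Yields.eq s t hB (by omega)).sup hB (.succ s t hB (by omega))).mono (by omega)
  | d + 2, ih =>
    rw [distLE, subDist, if_neg (by simp), if_neg (by simp)]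
    have e₁ := ih ((d + 2) / 2) (by omega) (up s) tNew (c := 11 * ((d + 2) / 2) - 6) (by omega)
      (by omega) (by omega)
    have e₂ := ih ((d + 3) / 2) (by omega) tNew (up t) (c := 11 * ((d + 3) / 2) - 6) (by omega)
      (by omega) (by omega)
    rw [code_up, code_tNew] at e₁ e₂
    exact ((e₁.inf hB e₂).ex hB).mono (by omega)

/-- Splitting off the middle letter takes `10` rounds and leaves two strings with one letter less in
total, so `12` for each letter plus `2` is preserved. -/
theorem yields_between {a : ℕ} {w : List A} (s t : Tm A k) (hw : IsSeg T a w) (hB : 13 ≤ B)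
    (ha : a + w.length ≤ B) (hk : k + w.length + 2 ≤ B) (hc : 12 * w.length + 2 ≤ c) :
    Yields T B [iBetween a w.length k (code s) (code t)] (encodeFormula (between s w t)) c := by
  induction hd : w.length using Nat.strong_induction_on generalizing k a w c with
  | _ d ih =>
  subst hd
  have hs := code_le s
  have ht := code_le t
  suffices h : Yields T B (subBetween w.length a k (code s) (code t))
      (encodeFormula (between s w t)) (c - 1) from
    (h.expand (t := iBetween a w.length k (code s) (code t)) (Item.env_le
      (by simp [iBetween]; omega)
      (by simp [iBetween]; omega) (by simp [iBetween]; omega) (by simp [iBetween]; omega)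
      (by simp [iBetween]; omega)
      (by simp [iBetween]; omega)) (by simp [iBetween])).mono (by omega)
  rcases Nat.eq_zero_or_pos w.length with h0 | hpos
  · obtain rfl := List.eq_nil_of_length_eq_zero h0
    rw [between, subBetween, if_pos (by simp)]
    exact (Yields.succ s t hB (by omega)).mono (by omega)
  have e : between s w t = ∃' (fLetter (w[(w.length + 1) / 2 - 1]'(by omega)) tNew ⊓
      between (up s) (w.take ((w.length + 1) / 2 - 1)) tNew ⊓
      between tNew (w.drop ((w.length + 1) / 2)) (up t)) := by
    match w, hpos with
    | [x], _ => simp [between]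
    | [x, y], _ => simp [between]
    | x :: y :: z :: l, _ =>
      rw [between]
      have : ((x :: y :: z :: l).length + 1) / 2 - 1 + 1 = ((x :: y :: z :: l).length + 1) / 2 := by
        simp; omega
      simp only [this]
  rw [e, subBetween, if_neg (by rw [decide_eq_true_eq]; omega)]
  have e₁ := ih ((w.length + 1) / 2 - 1) (by omega) (up s) tNew
    (c := 12 * ((w.length + 1) / 2 - 1) + 2) (hw.take ((w.length + 1) / 2 - 1)) (by simp; omega)
    (by simp; omega) (by simp) (by simp; omega)
  have e₂ := ih (w.length - (w.length + 1) / 2) (by omega) tNew (up t)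
    (c := 12 * (w.length - (w.length + 1) / 2) + 2) (hw.drop ((w.length + 1) / 2))
    (by simp; omega) (by simp; omega) (by simp) (by simp)
  have e₀ := Yields.letter (tNew : Tm A (k + 1)) (hw ((w.length + 1) / 2 - 1) (by omega)) hB
    (by omega) (by omega)
  rw [code_up, code_tNew] at e₁ e₂
  exact (((e₀.inf hB e₁).inf hB e₂).ex hB).mono (by omega)

end Yields

/-! ### Uniform unfolding equations for the string formulas. -/

section Unfold

variable {A : Type} {k : ℕ} {w : List A}

theorem after_eq (t : Tm A k) (h : 2 ≤ w.length) :
    after t w = ∃' (fLetter (w[(w.length + 1) / 2 - 1]'(by omega)) tNew ⊓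
      between (up t) (w.take ((w.length + 1) / 2 - 1)) tNew ⊓
      after tNew (w.drop ((w.length + 1) / 2))) := by
  match w, h with
  | [x, y], _ => simp [after, between]
  | x :: y :: z :: l, _ =>
    rw [after]
    have : ((x :: y :: z :: l).length + 1) / 2 - 1 + 1 = ((x :: y :: z :: l).length + 1) / 2 := by
      simp; omega
    simp only [this]

theorem before_eq (t : Tm A k) (h : 3 ≤ w.length) :
    before w t = ∃' (fLetter (w[(w.length + 1) / 2 - 1]'(by omega)) tNew ⊓
      before (w.take ((w.length + 1) / 2 - 1)) tNew ⊓
      between tNew (w.drop ((w.length + 1) / 2)) (up t)) := by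
  match w, h with
  | x :: y :: z :: l, _ =>
    rw [before]
    have : ((x :: y :: z :: l).length + 1) / 2 - 1 + 1 = ((x :: y :: z :: l).length + 1) / 2 := by
      simp; omega
    simp only [this]

theorem prefEq_eq (h : 4 ≤ w.length) :
    prefEq w = fLetter (w[0]'(by omega)) tMin ⊓
      ∃' (fLetter (w[w.length / 2]'(by omega)) tNew ⊓
      between tMin ((w.drop 1).take (w.length / 2 - 1)) tNew ⊓
      after tNew (w.drop (w.length / 2 + 1))) := by
  match w, h with
  | x :: y :: z :: z' :: l, _ =>
    rw [prefEq]
    have h₁ : ((x :: y :: z :: z' :: l).length + 2) / 2 - 1 =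
        (x :: y :: z :: z' :: l).length / 2 := by
      simp
    simp only [h₁, List.drop_take]
    rfl

theorem suffEq_eq (h : 4 ≤ w.length) :
    suffEq w = fLetter (w[w.length - 1]'(by omega)) tMax ⊓
      ∃' (fLetter (w[w.length / 2 - 1]'(by omega)) tNew ⊓
      before (w.take (w.length / 2 - 1)) tNew ⊓
      between tNew ((w.drop (w.length / 2)).take (w.length - 1 - w.length / 2)) tMax) := by
  match w, h with
  | x :: y :: z :: z' :: l, _ =>
    rw [suffEq]
    have h₁ : (x :: y :: z :: z' :: l).length / 2 - 1 + 1 =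
        (x :: y :: z :: z' :: l).length / 2 := by
      simp; omega
    simp only [h₁, List.dropLast_eq_take, List.drop_take]

theorem occ_eq (t : Tm A k) (h : 2 ≤ w.length) :
    occ w t = fLetter (w[(w.length + 1) / 2 - 1]'(by omega)) t ⊓
      before (w.take ((w.length + 1) / 2 - 1)) t ⊓
      after t (w.drop ((w.length + 1) / 2)) := by
  match w, h with
  | x :: y :: l, _ =>
    rw [occ]
    have : ((x :: y :: l).length + 1) / 2 - 1 + 1 = ((x :: y :: l).length + 1) / 2 := by
      simp; omega
    simp only [this]

end Unfold

section Yields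

variable {A : Type} [Finite A] {T : List (InSym A)} {B c k : ℕ}

theorem yields_after {a : ℕ} {w : List A} (t : Tm A k) (hw : IsSeg T a w) (hB : 13 ≤ B)
    (ha : a + w.length ≤ B) (hk : k + w.length + 2 ≤ B) (hc : 12 * w.length + 3 ≤ c) :
    Yields T B [iAfter a w.length k (code t)] (encodeFormula (after t w)) c := by
  induction hd : w.length using Nat.strong_induction_on generalizing k a w c with
  | _ d ih =>
  subst hd
  have ht := code_le t
  suffices h : Yields T B (subAfter w.length a k (code t)) (encodeFormula (after t w)) (c - 1) from
    (h.expand (t := iAfter a w.length k (code t)) (Item.env_le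
      (by simp [iAfter]; omega) (by simp [iAfter]; omega) (by simp [iAfter]; omega)
      (by simp [iAfter]; omega) (by simp [iAfter]; omega) (by simp [iAfter]))
      (by simp [iAfter])).mono (by omega)
  by_cases hl : 2 ≤ w.length
  swap
  · match w, hl, hw, ha, hk, hc, ih with
    | [], hl, hw, ha, hk, hc, ih =>
      rw [after, subAfter, if_pos (by simp)]
      exact (Yields.top hB).mono (by simp at hc; omega)
    | [x], hl, hw, ha, hk, hc, ih =>
      rw [after, subAfter, if_neg (by simp), if_pos (by simp)]
      simp only [List.length_singleton] at ha hk hc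
      have e₀ := Yields.letter (tNew : Tm A (k + 1)) (hw 0 (by simp)) hB (by omega) (by omega)
      have e₁ := Yields.succ (T := T) (B := B) (up t) tNew hB (by omega)
      rw [code_up, code_tNew] at e₁
      exact ((e₁.inf hB e₀).ex hB).mono (by omega)
    | x :: y :: w', hl, hw, ha, hk, hc, ih => exact (hl (by simp)).elim
  rw [after_eq t hl, subAfter, if_neg (by rw [decide_eq_true_eq]; omega),
    if_neg (by rw [decide_eq_true_eq]; omega)]
  have e₁ := yields_between (B := B) (c := 12 * ((w.length + 1) / 2 - 1) + 2) (up t) tNew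
    (hw.take ((w.length + 1) / 2 - 1)) hB (by simp; omega) (by simp; omega) (by simp)
  have e₂ := ih (w.length - (w.length + 1) / 2) (by omega) (tNew : Tm A (k + 1))
    (c := 12 * (w.length - (w.length + 1) / 2) + 3) (hw.drop ((w.length + 1) / 2))
    (by simp; omega) (by simp; omega) (by simp) (by simp)
  have e₀ := Yields.letter (tNew : Tm A (k + 1)) (hw ((w.length + 1) / 2 - 1) (by omega)) hB
    (by omega) (by omega)
  rw [code_up, code_tNew, List.length_take, min_eq_left (by omega)] at e₁
  rw [code_tNew] at e₂
  exact (((e₀.inf hB e₁).inf hB e₂).ex hB).mono (by omega)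

theorem yields_before {a : ℕ} {w : List A} (t : Tm A k) (hw : IsSeg T a w) (hB : 13 ≤ B)
    (ha : a + w.length ≤ B) (hk : k + w.length + 2 ≤ B) (hc : 12 * w.length + 3 ≤ c) :
    Yields T B [iBefore a w.length k (code t)] (encodeFormula (before w t)) c := by
  induction hd : w.length using Nat.strong_induction_on generalizing k a w c with
  | _ d ih =>
  subst hd
  have ht := code_le t
  suffices h : Yields T B (subBefore w.length a k (code t)) (encodeFormula (before w t)) (c - 1)
    from (h.expand (t := iBefore a w.length k (code t)) (Item.env_le
      (by simp [iBefore]; omega) (by simp [iBefore]; omega) (by simp [iBefore]; omega)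
      (by simp [iBefore]; omega) (by simp [iBefore]) (by simp [iBefore]; omega))
      (by simp [iBefore])).mono (by omega)
  by_cases hl : 3 ≤ w.length
  swap
  · match w, hl, hw, ha, hk, hc, ih with
    | [], hl, hw, ha, hk, hc, ih =>
      rw [before, subBefore, if_pos (by simp)]
      exact (Yields.top hB).mono (by simp at hc; omega)
    | [x], hl, hw, ha, hk, hc, ih =>
      rw [before, subBefore, if_neg (by simp), if_pos (by simp)]
      simp only [List.length_singleton] at ha hk hc
      have e₀ := Yields.letter (tNew : Tm A (k + 1)) (hw 0 (by simp)) hB (by omega) (by omega)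
      have e₁ := Yields.succ (T := T) (B := B) tNew (up t) hB (by omega)
      rw [code_up, code_tNew] at e₁
      exact ((e₁.inf hB e₀).ex hB).mono (by omega)
    | [x, y], hl, hw, ha, hk, hc, ih =>
      rw [before, subBefore, if_neg (by simp), if_neg (by simp), if_pos (by simp)]
      simp only [List.length_cons, List.length_nil] at ha hk hc
      have e₀ := Yields.letter (tNew : Tm A (k + 1)) (hw 0 (by simp)) hB (by omega) (by omega)
      have e₁ := yields_between (B := B) (c := 14) tNew (up t) (hw.drop 1) hB (by simp; omega)
        (by simp; omega) (by simp)
      rw [code_up, code_tNew] at e₁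
      exact ((e₀.inf hB e₁).ex hB).mono (by omega)
    | x :: y :: z :: l, hl, hw, ha, hk, hc, ih => exact (hl (by simp)).elim
  rw [before_eq t hl, subBefore, if_neg (by rw [decide_eq_true_eq]; omega),
    if_neg (by rw [decide_eq_true_eq]; omega), if_neg (by rw [decide_eq_true_eq]; omega)]
  have e₁ := ih ((w.length + 1) / 2 - 1) (by omega) (tNew : Tm A (k + 1))
    (c := 12 * ((w.length + 1) / 2 - 1) + 3) (hw.take ((w.length + 1) / 2 - 1))
    (by simp; omega) (by simp; omega) (by simp) (by simp; omega)
  have e₂ := yields_between (B := B) (c := 12 * (w.length - (w.length + 1) / 2) + 2) tNew (up t)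
    (hw.drop ((w.length + 1) / 2)) hB (by simp; omega) (by simp; omega) (by simp)
  have e₀ := Yields.letter (tNew : Tm A (k + 1)) (hw ((w.length + 1) / 2 - 1) (by omega)) hB
    (by omega) (by omega)
  rw [code_up, code_tNew, List.length_drop] at e₂
  rw [code_tNew] at e₁
  exact (((e₀.inf hB e₁).inf hB e₂).ex hB).mono (by omega)

theorem yields_prefEq {a : ℕ} {w : List A} (hw : IsSeg T a w) (h0 : w ≠ []) (hB : 13 ≤ B)
    (ha : a + w.length ≤ B) (hk : w.length + 3 ≤ B) :
    Yields T B [iPref a w.length] (encodeFormula (prefEq w)) (12 * w.length + 8) := by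
  suffices h : Yields T B (subPref w.length a) (encodeFormula (prefEq w)) (12 * w.length + 7) from
    (h.expand (t := iPref a w.length) (Item.env_le (by simp [iPref]; omega)
      (by simp [iPref]; omega) (by simp [iPref]; omega) (by simp [iPref]) (by simp [iPref])
      (by simp [iPref])) (by simp [iPref])).mono (by omega)
  have hpos := List.length_pos_of_ne_nil h0
  have e₀ := Yields.letter (B := B) (tMin : Tm A 0) (hw 0 (by omega)) hB (by omega) (by omega)
  have e₁ := yields_after (B := B) (c := 12 * (w.length - 1) + 3) tMin (hw.drop 1) hB (by simp; omega)
    (k := 0) (by simp; omega) (by simp)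
  rw [code_tMin] at e₀ e₁
  by_cases hl : 4 ≤ w.length
  swap
  · match w, hl, h0 with
    | [x], hl, _ =>
      rw [prefEq, subPref, if_pos (by simp)]
      exact e₀.mono (by omega)
    | [x, y], hl, _ =>
      rw [prefEq, subPref, if_neg (by simp), if_pos (by simp)]
      exact (e₀.inf hB e₁).mono (by simp)
    | [x, y, z], hl, _ =>
      rw [prefEq, subPref, if_neg (by simp), if_pos (by simp)]
      exact (e₀.inf hB e₁).mono (by simp)
    | x :: y :: z :: z' :: l, hl, _ => exact (hl (by simp)).elim
  rw [prefEq_eq hl, subPref, if_neg (by rw [decide_eq_true_eq]; omega),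
    if_neg (by rw [decide_eq_true_eq]; omega)]
  have f₀ := Yields.letter (B := B) (tNew : Tm A 1) (hw (w.length / 2) (by omega)) hB
    (by omega) (by omega)
  have f₁ := yields_between (B := B) (c := 12 * (w.length / 2 - 1) + 2) (tMin : Tm A 1) tNew
    ((hw.drop 1).take (w.length / 2 - 1)) hB (by simp; omega) (by simp; omega) (by simp)
  have f₂ := yields_after (B := B) (c := 12 * (w.length - (w.length / 2 + 1)) + 3)
    (tNew : Tm A 1) (hw.drop (w.length / 2 + 1)) hB (by simp; omega) (by simp; omega) (by simp)
  rw [code_tMin, code_tNew, List.length_take, List.length_drop, min_eq_left (by omega)] at f₁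
  rw [code_tNew, List.length_drop] at f₂
  rw [code_tNew] at f₀
  exact (e₀.inf hB (((f₀.inf hB f₁).inf hB f₂).ex hB)).mono (by omega)

theorem yields_suffEq {a : ℕ} {w : List A} (hw : IsSeg T a w) (h0 : w ≠ []) (hB : 13 ≤ B)
    (ha : a + w.length ≤ B) (hk : w.length + 3 ≤ B) :
    Yields T B [iSuff a w.length] (encodeFormula (suffEq w)) (12 * w.length + 8) := by
  suffices h : Yields T B (subSuff w.length a) (encodeFormula (suffEq w)) (12 * w.length + 7) from
    (h.expand (t := iSuff a w.length) (Item.env_le (by simp [iSuff]; omega)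
      (by simp [iSuff]; omega) (by simp [iSuff]; omega) (by simp [iSuff]) (by simp [iSuff])
      (by simp [iSuff])) (by simp [iSuff])).mono (by omega)
  have hpos := List.length_pos_of_ne_nil h0
  have e₀ := Yields.letter (B := B) (tMax : Tm A 0) (hw (w.length - 1) (by omega)) hB (by omega)
    (by omega)
  have e₁ := yields_before (B := B) (c := 12 * (w.length - 1) + 3) tMax (hw.take (w.length - 1)) hB
    (by simp; omega) (k := 0) (by simp; omega) (by simp)
  rw [code_tMax] at e₀ e₁
  rw [List.length_take, min_eq_left (by omega)] at e₁
  by_cases hl : 4 ≤ w.length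
  swap
  · match w, hl, h0 with
    | [x], hl, _ =>
      rw [suffEq, subSuff, if_pos (by simp)]
      exact e₀.mono (by omega)
    | [x, y], hl, _ =>
      rw [suffEq, subSuff, if_neg (by simp), if_pos (by simp)]
      exact (e₀.inf hB e₁).mono (by simp)
    | [x, y, z], hl, _ =>
      rw [suffEq, subSuff, if_neg (by simp), if_pos (by simp)]
      exact (e₀.inf hB e₁).mono (by simp)
    | x :: y :: z :: z' :: l, hl, _ => exact (hl (by simp)).elim
  rw [suffEq_eq hl, subSuff, if_neg (by rw [decide_eq_true_eq]; omega),
    if_neg (by rw [decide_eq_true_eq]; omega)]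
  have f₀ := Yields.letter (B := B) (tNew : Tm A 1) (hw (w.length / 2 - 1) (by omega)) hB
    (by omega) (by omega)
  have f₁ := yields_before (B := B) (c := 12 * (w.length / 2 - 1) + 3) (tNew : Tm A 1)
    (hw.take (w.length / 2 - 1)) hB (by simp; omega) (by simp; omega) (by simp)
  have f₂ := yields_between (B := B) (c := 12 * (w.length - 1 - w.length / 2) + 2)
    (tNew : Tm A 1) tMax ((hw.drop (w.length / 2)).take (w.length - 1 - w.length / 2)) hB
    (by simp; omega) (by simp; omega) (by simp)
  rw [code_tNew, List.length_take, min_eq_left (by omega)] at f₁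
  rw [code_tNew, code_tMax, List.length_take, List.length_drop, min_eq_left (by omega)] at f₂
  rw [code_tNew] at f₀
  exact (e₀.inf hB (((f₀.inf hB f₁).inf hB f₂).ex hB)).mono (by omega)

theorem yields_occ {a : ℕ} {w : List A} (t : Tm A k) (hw : IsSeg T a w) (hB : 13 ≤ B)
    (ha : a + w.length ≤ B) (hk : k + w.length + 2 ≤ B) :
    Yields T B [iOcc a w.length k (code t)] (encodeFormula (occ w t)) (12 * w.length + 3) := by
  have ht := code_le t
  suffices h : Yields T B (subOcc w.length a k (code t)) (encodeFormula (occ w t))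
    (12 * w.length + 2) from (h.expand (t := iOcc a w.length k (code t)) (Item.env_le
      (by simp [iOcc]; omega) (by simp [iOcc]; omega) (by simp [iOcc]; omega)
      (by simp [iOcc]; omega) (by simp [iOcc]; omega) (by simp [iOcc]))
      (by simp [iOcc])).mono (by omega)
  by_cases hl : 2 ≤ w.length
  swap
  · match w, hl, hw, ha, hk with
    | [], hl, hw, ha, hk =>
      rw [occ, subOcc, if_pos (by simp)]
      exact (Yields.top hB).mono (by omega)
    | [x], hl, hw, ha, hk =>
      rw [occ, subOcc, if_neg (by simp), if_pos (by simp)]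
      simp only [List.length_singleton] at ha hk
      exact (Yields.letter t (hw 0 (by simp)) hB (by omega) (by omega)).mono (by omega)
    | x :: y :: w', hl, hw, ha, hk => exact (hl (by simp)).elim
  rw [occ_eq t hl, subOcc, if_neg (by rw [decide_eq_true_eq]; omega),
    if_neg (by rw [decide_eq_true_eq]; omega)]
  have e₁ := yields_before (B := B) (c := 12 * ((w.length + 1) / 2 - 1) + 3) t
    (hw.take ((w.length + 1) / 2 - 1)) hB (by simp; omega) (by simp; omega) (by simp)
  have e₂ := yields_after (B := B) (c := 12 * (w.length - (w.length + 1) / 2) + 3) t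
    (hw.drop ((w.length + 1) / 2)) hB (by simp; omega) (by simp; omega) (by simp)
  have e₀ := Yields.letter (B := B) t (hw ((w.length + 1) / 2 - 1) (by omega)) hB
    (by omega) (by omega)
  rw [List.length_take, min_eq_left (by omega)] at e₁
  rw [List.length_drop] at e₂
  exact ((e₀.inf hB e₁).inf hB e₂).mono (by omega)

variable {q a d : ℕ} {α : List A}

theorem yields_occLeft (t : Tm A k) (hα : IsSeg T a α) (hd : 2 ^ (q - 1) = d)
    (hl : α.length = d + d - 1) (hB : 13 ≤ B) (ha : a + (d + d) ≤ B) (hk : k + 2 * d + 4 ≤ B) :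
    Yields T B [iLeft a d k (code t)] (encodeFormula (occLeft q α t)) (100 * (d + 1)) := by
  have hpos := Nat.two_pow_pos (q - 1)
  have ht := code_le t
  have e₁ := yields_distLE (T := T) (B := B) (c := 11 * d + 2) (d - 1) tNew (up t) hB (by omega)
    (by omega) (by omega)
  have e₂ := yields_occ (B := B) (tNew : Tm A (k + 1)) hα hB (by omega) (by omega)
  have e₃ := yields_distLE (T := T) (B := B) (c := 11 * d + 2) d (tMin : Tm A (k + 1)) tNew hB
    (by omega) (by omega) (by omega)
  have e₄ := yields_distLE (T := T) (B := B) (c := 11 * d + 2) d (tNew : Tm A (k + 1)) tMax hB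
    (by omega) (by omega) (by omega)
  rw [code_tNew, code_up] at e₁
  rw [code_tNew, hl] at e₂
  rw [code_tNew, code_tMin] at e₃
  rw [code_tNew, code_tMax] at e₄
  have h := (((((e₁.not hB).inf hB e₂).inf hB (e₃.not hB)).inf hB (e₄.not hB)).ex hB)
  refine (Yields.expand (t := iLeft a d k (code t)) (Item.env_le
    (by simp [iLeft]; omega) (by simp [iLeft]; omega) (by simp [iLeft]; omega)
    (by simp [iLeft]; omega) (by simp [iLeft]; omega) (by simp [iLeft])) ?_
    (by simp [iLeft])).mono (c := 57 * d + 49 + 1) (by omega)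
  rw [occLeft, hd]
  exact h.mono (by omega)

/-- Each of the `m + 1` quantified positions contributes formulas of size linear in `d`; this
product is the only bound in the construction that is not linear. -/
theorem yields_scatTail (m : ℕ) (t : Tm A k) (hα : IsSeg T a α) (hd : 2 ^ (q - 1) = d)
    (hq : 2 ^ q = d + d)
    (hl : α.length = d + d - 1) (hB : 13 ≤ B) (ha : a + (d + d) ≤ B) (hk : k + m + 2 * d + 5 ≤ B) :
    Yields T B [iTail a d k (code t) m] (encodeFormula (scatTail q α m t))
      ((m + 1) * (200 * (d + 1))) := by
  have hpos := Nat.two_pow_pos (q - 1)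
  induction m generalizing k with
  | zero =>
    have ht := code_le t
    have e₁ := yields_distLE (T := T) (B := B) (c := 11 * d + 2) d (up t) tNew hB (by omega)
      (by omega) (by omega)
    have e₂ := yields_occ (B := B) (tNew : Tm A (k + 1)) hα hB (by omega) (by omega)
    rw [code_tNew, code_up] at e₁
    rw [code_tNew, hl] at e₂
    have h := (((e₁.not hB).inf hB e₂).ex hB)
    refine (Yields.expand (t := iTail a d k (code t) 0) (Item.env_le
      (by simp [iTail]; omega) (by simp [iTail]; omega) (by simp [iTail]; omega)
      (by simp [iTail]; omega) (by simp [iTail]; omega) (by simp [iTail])) ?_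
      (by simp [iTail])).mono (c := 57 * d + 49 + 1) (by omega)
    rw [scatTail, hd]
    exact h.mono (by omega)
  | succ m ih =>
    have ht := code_le t
    have e₁ := yields_distLE (T := T) (B := B) (c := 22 * d + 2) (d + d) (up t) tNew hB (by omega)
      (by omega) (by omega)
    have e₂ := yields_occLeft (B := B) (tNew : Tm A (k + 1)) hα hd hl hB (by omega) (by omega)
    have e₃ := ih (tNew : Tm A (k + 1)) (by omega)
    rw [code_tNew, code_up] at e₁
    rw [code_tNew] at e₂ e₃
    have h := ((((e₁.not hB).inf hB e₂).inf hB e₃).ex hB)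
    refine (Yields.expand (t := iTail a d k (code t) (m + 1)) (Item.env_le
      (by simp [iTail]; omega) (by simp [iTail]; omega) (by simp [iTail]; omega)
      (by simp [iTail]; omega) (by simp [iTail]; omega) (by simp [iTail]; omega)) ?_
      (by simp [iTail])).mono (c := 150 * d + 120 + (m + 1) * (200 * (d + 1)) + 1) (by
        rw [add_mul (m + 1)]; omega)
    rw [scatTail, hq]
    exact h.mono (by omega)

theorem yields_scatGE (n : ℕ) (hα : IsSeg T a α) (hd : 2 ^ (q - 1) = d) (hq : 2 ^ q = d + d)
    (hl : α.length = d + d - 1) (hB : 13 ≤ B) (ha : a + (d + d) ≤ B) (hk : n + 2 * d + 6 ≤ B) :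
    Yields T B [iScat a d n] (encodeFormula (scatGE q α n)) ((n + 1) * (200 * (d + 1))) := by
  have hpos := Nat.two_pow_pos (q - 1)
  have hexp (c) (h : Yields T B (subScat d a n) (encodeFormula (scatGE q α n)) c) :
      Yields T B [iScat a d n] (encodeFormula (scatGE q α n)) (c + 1) :=
    h.expand (t := iScat a d n) (Item.env_le
      (by simp [iScat]; omega) (by simp [iScat]; omega) (by simp [iScat]; omega)
      (by simp [iScat]) (by simp [iScat]) (by simp [iScat]; omega)) (by simp [iScat])
  match n, hexp, hk with
  | 0, hexp, hk =>
    refine (hexp 2 ?_).mono (by omega)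
    exact Yields.top hB
  | 1, hexp, hk =>
    have e₂ := yields_occ (B := B) (tNew : Tm A 1) hα hB (by omega) (by omega)
    rw [code_tNew, hl] at e₂
    exact (hexp _ (e₂.ex hB)).mono (by omega)
  | n + 2, hexp, hk =>
    have e₂ := yields_occLeft (B := B) (tNew : Tm A 1) hα hd hl hB (by omega) (by omega)
    have e₃ := yields_scatTail (B := B) n (tNew : Tm A 1) hα hd hq hl hB (by omega) (by omega)
    rw [code_tNew] at e₂ e₃
    refine (hexp _ ((e₂.inf hB e₃).ex hB)).mono ?_
    simp only [add_mul]
    omega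

end Yields

/-! ### Programs that expand and write work items. -/

section Programs

variable {A : Type} {P : List (InSym A) → (ℕ → ℕ) → Prop} {k j : ℕ} {f : Fun A}

/-- There is no primitive division, so halving is a bounded search. -/
theorem lfind_half (n : ℕ) : lfind (fun h => decide (n < h + h + 2)) (n + 1) = n / 2 := by
  refine lfind_eq (by omega) (fun _ => ?_) fun x hx => ?_
  · rw [decide_eq_true_eq]; omega
  · rw [decide_eq_false_iff_not]; omega

theorem Comp.half (hf : Comp (k + 1) j f) : Comp (k + 1) j fun T e => f T e / 2 := by
  have h : Comp (A := A) (k + 1) j fun T e => lfind (fun h => decide (e 0 < h + h + 2)) (e 0 + 1) :=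
    Comp.find ((Comp.var 0).add (Comp.const 1))
      (CompB.lt (Comp.var 1) (((Comp.var 0).add (Comp.var 0)).add (Comp.const 2)))
  exact Comp.comp₁ (G := fun _ n => n / 2) (h.congr fun T e => lfind_half _) hf

theorem EmitItems.append {l l' : List (InSym A) → (ℕ → ℕ) → List Item} (h : EmitItems P k j l)
    (h' : EmitItems P k j l') : EmitItems P k j fun T e => l T e ++ l' T e :=
  (Emit.append h' h).congr fun T e _ => by simp

theorem Emit.iteB {p : List (InSym A) → (ℕ → ℕ) → Bool} {f₁ f₂ : Text A} {g : Bool}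
    (hp : CompB k j p) (h₁ : Emit P k j g f₁) (h₂ : Emit P k j g f₂) :
    Emit P k j g fun T e => if p T e then f₁ T e else f₂ T e :=
  Emit.ite hp (h₁.weaken fun _ _ h => h.1) (h₂.weaken fun _ _ h => h.1)

/-- All fields of the new items arise from the old ones by addition, subtraction, halving and tests
against constants, so the proof follows the syntax. -/
theorem emitItems_sub : EmitItems (A := A) P 1 0 fun _ e => sub (Item.of e) := by
  unfold sub subDist subBetween subAfter subBefore subPref subSuff subOcc subLeft subTail subScat
    lTop lInf lSup lEx lNot iLetter iSucc iEq iDist iBetween iAfter iBefore iOcc iLeft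
    iTail tok Item.of
  dsimp only
  repeat' first
    | with_reducible exact EmitItems.nil
    | with_reducible apply EmitItems.ite
    | with_reducible apply EmitItems.append
    | with_reducible apply EmitItems.cons
    | with_reducible exact Comp.var _
    | with_reducible exact Comp.const _
    | with_reducible apply Comp.add
    | with_reducible apply Comp.sub
    | with_reducible apply Comp.half
    | with_reducible apply CompB.eq
    | with_reducible apply CompB.lt
    | with_reducible apply CompB.le

theorem emit_termText (hf : Comp (k + 1) j f) :
    Emit P (k + 1) j false fun T e => termText (f T e) := by
  unfold termText encNum
  exact Emit.iteB (CompB.eq hf (Comp.const 0)) (Emit.const _) (Emit.iteB (CompB.eq hf (Comp.const 1))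
    (Emit.const _) ((Emit.replicate (hf.sub (Comp.const 2)) _).append (Emit.const _)))

theorem emit_tokText (hf : Comp k j f) : Emit P k j false fun T e => tokText (f T e) := by
  unfold tokText
  exact Emit.iteB (CompB.eq hf (Comp.const 0)) (Emit.const _)
    (Emit.iteB (CompB.eq hf (Comp.const 1)) (Emit.const _)
    (Emit.iteB (CompB.eq hf (Comp.const 2)) (Emit.const _)
    (Emit.iteB (CompB.eq hf (Comp.const 3)) (Emit.const _) (Emit.const _))))

variable [Finite A]

theorem emit_letterText (hf : Comp k j f) :
    Emit P k j false fun T e => letterText T (f T e) := by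
  unfold letterText
  generalize (@Finset.univ A (Fintype.ofFinite A)).toList = l
  induction l with
  | nil => exact Emit.const []
  | cons a l ih => exact Emit.iteB (CompB.eq hf.symAt (Comp.const _)) (Emit.const _) ih

theorem emit_out : Emit P 1 0 false fun T e => out T (Item.of e) := by
  unfold out Item.of
  dsimp only
  have c (i n) : CompB (A := A) 1 0 fun _ e => decide (e i = n) :=
    CompB.eq (Comp.var i) (Comp.const n)
  exact Emit.iteB (c 0 0) (emit_tokText (Comp.var 1))
    (Emit.iteB (c 0 1) ((emit_letterText (Comp.var 2)).append (emit_termText (Comp.var 4)))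
    (Emit.iteB (c 0 2) ((Emit.const _).append ((emit_termText (Comp.var 4)).append
      (emit_termText (Comp.var 5))))
    (Emit.iteB (c 0 3) ((Emit.const _).append ((emit_termText (Comp.var 4)).append
      (emit_termText (Comp.var 5)))) (Emit.const _))))

/-- A text that items of linear parameters yield in quadratic time can be written. -/
theorem Emit.of_yields {ini : List (InSym A) → (ℕ → ℕ) → List Item} {F : Text A}
    (hini : EmitItems P 3 j ini)
    (hf : ∃ C, ∀ T e, P T e → Yields T (C * bnd T) (ini T e) (F T e) (C * (bnd T * bnd T))) :
    Emit P 3 j false F := by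
  -- One round takes quadratic time, because numbers are halved by search and written in unary.
  -- Quadratically many rounds give `N ^ 4`.
  refine Emit.drain (M := fun T => bnd T * bnd T) (k := 1) (j := 0) (out := out) (sub := fun _ => sub)
    (fun T => ?_) emit_out emitItems_sub hini fun D => ?_
  · refine le_trans (le_of_eq ?_) (wt_mono (k := 3) (j := 0) le_rfl (Nat.zero_le j) T)
    simp only [wt]
    ring
  · obtain ⟨C, hC⟩ := hf
    exact ⟨C, fun T e _ hP => hC T e hP⟩

end Programs

/-! ## Searching for a distinguishability formula -/

section Basic

variable {A : Type} {k j : ℕ} {f g : Fun A}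

theorem Comp.len : Comp (A := A) k j fun T _ => T.length := by
  refine ⟨fun D => ⟨1, fun T e _ => by simp [bnd]⟩, fun loc b hb =>
    ⟨.seq (.loop .inp Option.isSome (.seq (inc b) advance)) restore, fun D => ⟨9, fun s hs => ?_⟩⟩⟩
  have f0 := hs.free b le_rfl
  have r₁ : Run (.loop .inp Option.isSome (.seq (inc b) advance)) s
      { s.set b s.inp.length with inp := [], aux := s.inp.reverse } (s.inp.length * (4 + 1) + 1) := by
    refine (Run.loop (k := Stk.inp) (p := Option.isSome) (fun x => { s.set b x with
      inp := s.inp.drop x, aux := (s.inp.take x).reverse }) s.inp.length 4 (fun x hx => ⟨?_, ?_⟩)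
      ?_).cast ?_ ?_ le_rfl
    · simp [St.toStk, hx]
    · refine ((Run.inc b).seq (run_advance s.inp x rfl rfl)).cast rfl ?_ le_rfl
      ext1 <;> try rfl
      funext l
      simp only [St.set, Function.update_apply]
      split_ifs <;> simp
    · simp [St.toStk]
    · have ha := hs.aux
      cases s
      simp_all [St.set]
    · simp
  refine (r₁.seq run_restore).cast rfl ?_ ?_
  · simp only [List.reverse_reverse, List.append_nil]
    have ha := hs.aux
    cases s
    simp_all [St.set]
  · have h₂ := bnd_le_wt k j s.inp
    have h₄ : s.inp.length + 1 = bnd s.inp := rfl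
    simp only [List.length_reverse]
    omega

theorem Comp.minimum (hf : Comp k j f) (hg : Comp k j g) :
    Comp k j fun T e => min (f T e) (g T e) :=
  (hf.sub (hf.sub hg)).congr fun T e => by omega

/-- The power `2 ^ q`, or a smaller power that is larger than the length of the input. -/
def pow (T : List (InSym A)) (q : ℕ) : ℕ :=
  Nat.rec (motive := fun _ => ℕ) 1 (fun _ x => if decide (x ≤ T.length) then x + x else x) q

theorem pow_succ' (T : List (InSym A)) (q : ℕ) :
    pow T (q + 1) = if decide (pow T q ≤ T.length) then pow T q + pow T q else pow T q := rfl

theorem pow_le (T : List (InSym A)) (q : ℕ) : pow T q ≤ 2 * bnd T := by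
  induction q with
  | zero => simp [pow, bnd]; omega
  | succ q ih =>
    rw [pow_succ']
    split_ifs with h
    · rw [decide_eq_true_eq] at h
      unfold bnd
      omega
    · exact ih

theorem pow_spec (T : List (InSym A)) (q : ℕ) :
    pow T q = 2 ^ q ∨ T.length < pow T q ∧ pow T q ≤ 2 ^ q := by
  induction q with
  | zero => exact .inl rfl
  | succ q ih =>
    have e : 2 ^ (q + 1) = 2 * 2 ^ q := by omega
    rw [pow_succ']
    split_ifs with h <;> rw [decide_eq_true_eq] at h <;> omega

theorem Comp.pow_var : Comp (A := A) (k + 1) j fun T e => pow T (e 0) := by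
  refine rec_core (M := bnd) (S := fun T _ _ x => if decide (x ≤ T.length) then x + x else x)
    (k := k) (j := j) (fun T => (bnd_mul_wt k j T).le) (Comp.var (k := k) (j := j) 0).bdd (.var 0)
    (.const 1) ?_ fun D => ⟨2, fun T e _ i _ => pow_le T i⟩
  exact CompB.ite (.le (.var 1) .len) (.add (.var 1) (.var 1)) (.var 1)

theorem Comp.pow (hf : Comp (k + 1) j f) : Comp (k + 1) j fun T e => pow T (f T e) :=
  Comp.comp₁ (G := WordLearn.pow) Comp.pow_var hf

/-- The least exponent of a power of two that is larger than the length of the input. -/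
def top (T : List (InSym A)) : ℕ :=
  lfind (fun q => decide (T.length < pow T q)) (T.length + 1)

theorem Comp.top : Comp (A := A) (k + 2) j fun T _ => top T :=
  Comp.find (k := k + 1) (.add .len (.const 1)) (.lt .len (.pow (.var 0)))

theorem length_lt_pow (T : List (InSym A)) (q : ℕ) (h : T.length < 2 ^ q) : T.length < pow T q := by
  have := pow_spec T q
  omega

theorem length_lt_two_pow_top (T : List (InSym A)) : T.length < 2 ^ top T := by
  have h : top T < T.length + 1 := by
    refine lfind_lt_iff.2 ⟨T.length, by omega, ?_⟩
    rw [decide_eq_true_eq]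
    exact length_lt_pow T _ Nat.lt_two_pow_self
  have := lfind_spec h
  rw [decide_eq_true_eq] at this
  have := pow_spec T (top T)
  unfold top at *
  omega

/-- This makes every loop bounded by `top` a logarithmic one. -/
theorem top_le_lg (T : List (InSym A)) : top T ≤ lg T := by
  by_contra h
  have h₁ := lfind_min (not_le.1 h)
  rw [decide_eq_false_iff_not] at h₁
  refine h₁ (length_lt_pow T _ ?_)
  have := Nat.lt_pow_succ_log_self (b := 2) (by omega) (bnd T)
  exact lt_of_lt_of_le (Nat.lt_succ_self _) this.le

theorem bddBy_lg_top (n : ℕ) : BddBy lg fun (T : List (InSym A)) _ => top T + n := fun _ =>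
  ⟨n + 1, fun T _ _ => by
    have h₁ := top_le_lg T
    have h₂ := lg_pos T
    nlinarith⟩

variable [Finite A]

/-- The length of the string that starts at `p`. -/
noncomputable def wlen (T : List (InSym A)) (p : ℕ) : ℕ :=
  lfind (fun i => decide (sym T (p + i) ≤ 2)) T.length

theorem wlen_le (T : List (InSym A)) (p : ℕ) : wlen T p ≤ T.length := lfind_le _ _

theorem Comp.wlen (hf : Comp (k + 1) j f) : Comp (k + 1) j fun T e => wlen T (f T e) :=
  Comp.comp₁ (G := WordLearn.wlen)
    (Comp.find .len (.le (.symAt (.add (.var 1) (.var 0))) (.const 2))) hf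

/-- The start of the string number `i` of a list of strings that starts at `s`. -/
noncomputable def wstart (T : List (InSym A)) (s i : ℕ) : ℕ :=
  Nat.rec (motive := fun _ => ℕ) s
    -- The guard only keeps the values linear on arguments that are out of range.
    (fun _ x => if decide (x ≤ T.length) then x + wlen T x + 1 else x) i

theorem wstart_succ (T : List (InSym A)) (s i : ℕ) : wstart T s (i + 1) =
    if decide (wstart T s i ≤ T.length) then wstart T s i + wlen T (wstart T s i) + 1
    else wstart T s i := rfl

theorem wstart_le (T : List (InSym A)) (s i : ℕ) : wstart T s i ≤ s + 2 * bnd T := by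
  induction i with
  | zero => simp [wstart]
  | succ i ih =>
    rw [wstart_succ]
    split_ifs with h
    · rw [decide_eq_true_eq] at h
      have := wlen_le T (wstart T s i)
      unfold bnd
      omega
    · exact ih

theorem Comp.wstart_var : Comp (A := A) (k + 2) j fun T e => wstart T (e 0) (e 1) := by
  refine rec_core (M := bnd)
    (S := fun T _ _ x => if decide (x ≤ T.length) then x + WordLearn.wlen T x + 1 else x)
    (k := k + 1) (j := j) (fun T => (bnd_mul_wt (k + 1) j T).le)
    (Comp.var (k := k) (j := j) 1).bdd (.var 1) (.var 0) ?_
    fun D => ⟨D + 2, fun T e he i _ => (wstart_le T (e 0) i).trans ?_⟩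
  · exact CompB.ite (.le (.var 1) .len) (.add (.add (.var 1) (.wlen (.var 1))) (.const 1)) (.var 1)
  · have := he 0
    rw [add_mul]
    omega

theorem Comp.wstart (hf : Comp (k + 2) j f) (hg : Comp (k + 2) j g) :
    Comp (k + 2) j fun T e => wstart T (f T e) (g T e) :=
  Comp.comp₂ (G := WordLearn.wstart) Comp.wstart_var hf hg

/-- At the starting position after the last positive string stands the end marker of the positive
list; for the negative list it is the end of the input, with number `0`. -/
noncomputable def posNum (T : List (InSym A)) : ℕ :=
  lfind (fun i => decide (sym T (wstart T 0 i) = 2)) T.length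

noncomputable def negStart (T : List (InSym A)) : ℕ := wstart T 0 (posNum T) + 1

noncomputable def negNum (T : List (InSym A)) : ℕ :=
  lfind (fun i => decide (sym T (wstart T (negStart T) i) = 0)) T.length

theorem Comp.posNum : Comp (A := A) (k + 3) j fun T _ => posNum T :=
  Comp.find (k := k + 2) .len (.eq (.symAt (.wstart (.const 0) (.var 0))) (.const 2))

theorem Comp.negStart : Comp (A := A) (k + 3) j fun T _ => negStart T :=
  .add (.wstart (k := k + 1) (.const 0) .posNum) (.const 1)

theorem Comp.negNum : Comp (A := A) (k + 3) j fun T _ => negNum T :=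
  Comp.comp₁ (G := fun T s => lfind (fun i => decide (sym T (WordLearn.wstart T s i) = 0)) T.length)
    (Comp.find (k := k + 2) .len (.eq (.symAt (.wstart (.var 1) (.var 0))) (.const 0)))
    Comp.negStart

end Basic

section Negation

def lNotIf (b : Bool) (t : Item) : List Item := if b then lNot [t] else [t]

variable {A : Type} {k j : ℕ} {P : List (InSym A) → (ℕ → ℕ) → Prop}

theorem emitItems_lNotIf {b : List (InSym A) → (ℕ → ℕ) → Bool} {h₀ h₁ h₂ h₃ h₄ h₅ : Fun A}
    (hb : CompB (k + 1) j b)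
    (hh₀ : Comp (k + 1) j h₀) (hh₁ : Comp (k + 1) j h₁) (hh₂ : Comp (k + 1) j h₂)
    (hh₃ : Comp (k + 1) j h₃) (hh₄ : Comp (k + 1) j h₄) (hh₅ : Comp (k + 1) j h₅) :
    EmitItems P (k + 1) j fun T e =>
      lNotIf (b T e) ⟨h₀ T e, h₁ T e, h₂ T e, h₃ T e, h₄ T e, h₅ T e⟩ := by
  have t (d : ℕ) {l} (h : EmitItems P (k + 1) j l) : EmitItems P (k + 1) j fun T e => tok d :: l T e :=
    .cons (.const _) (.const _) (.const _) (.const _) (.const _) (.const _) h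
  have i {l} (h : EmitItems P (k + 1) j l) := EmitItems.cons hh₀ hh₁ hh₂ hh₃ hh₄ hh₅ h
  exact EmitItems.ite hb (t 1 (i (t 4 .nil))) (i .nil)

end Negation

/-! ### Greedy test of scattering and search for the least feature level. -/

section Search

variable {A : Type} [Finite A] {k j : ℕ}

/-- The string of length `2 * d - 1` at `a` has a free occurrence, with center `x`, in the string
of length `l` at `p`. -/
noncomputable def isFree (T : List (InSym A)) (d a p l x : ℕ) : Bool :=
  decide (d < x) && (decide (x + d + 1 < l) &&
    ball (fun i => decide (sym T (p + (x - (d - 1)) + i) = sym T (a + i))) (d + d - 1))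

/-- The first center of a free occurrence that is not less than `x`. -/
noncomputable def next (T : List (InSym A)) (d a p l x : ℕ) : ℕ :=
  lfind (fun y => decide (x ≤ y) && isFree T d a p l y) l

/-- Greedy: jump from the next occurrence just past the gap that it forbids. A failed search returns
`l`, and then all later ones fail too. -/
noncomputable def leap (T : List (InSym A)) (d a p l n : ℕ) : ℕ :=
  Nat.rec (motive := fun _ => ℕ) 0 (fun _ x => next T d a p l x + (d + d) + 1) n

/-- There are `n` free occurrences with large gaps. -/
noncomputable def spread (T : List (InSym A)) (d a p l n : ℕ) : Bool :=
  -- The bound is the value after a failed search. The cap makes the number of jumps logarithmic; it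
  -- is harmless because only `n ≤ top T` is of interest.
  decide (leap T d a p l (min n (top T)) < l + (d + d) + 1)

theorem compB_isFree : CompB (A := A) (k + 1) j fun T e =>
    isFree T (e 0) (e 1) (e 2) (e 3) (e 4) :=
  .and (.lt (.var 0) (.var 4)) (.and (.lt (.add (.add (.var 4) (.var 0)) (.const 1)) (.var 3))
    (.ball (.sub (.add (.var 0) (.var 0)) (.const 1))
      (.eq (.symAt (.add (.add (.var 3) (.sub (.var 5) (.sub (.var 1) (.const 1)))) (.var 0)))
        (.symAt (.add (.var 2) (.var 0))))))

theorem comp_next : Comp (A := A) (k + 2) j fun T e =>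
    next T (e 0) (e 1) (e 2) (e 3) (e 4) :=
  Comp.find (.var 3) (.and (.le (.var 5) (.var 0))
    (.comp₅ (P := isFree) compB_isFree (.var 1) (.var 2) (.var 3) (.var 4) (.var 0)))

theorem leap_le (T : List (InSym A)) (d a p l n : ℕ) : leap T d a p l n ≤ l + (d + d) + 1 := by
  cases n with
  | zero => exact Nat.zero_le _
  | succ n => exact Nat.add_le_add_right (Nat.add_le_add_right (lfind_le _ _) _) _

theorem compB_spread : CompB (A := A) (k + 2) (j + 1) fun T e =>
    spread T (e 0) (e 1) (e 2) (e 3) (e 4) := by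
  refine .lt ?_ (.add (.add (.var 3) (.add (.var 0) (.var 0))) (.const 1))
  refine Comp.rec_core (M := lg)
    (S := fun T e _ x => next T (e 0) (e 1) (e 2) (e 3) x + (e 0 + e 0) + 1)
    (k := k + 2) (j := j) (fun T => (lg_mul_wt (k + 2) j T).le)
    ((bddBy_lg_top 0).mono_left fun T e => min_le_right _ _) (.minimum (.var 4) .top) (.const 0) ?_
    fun D => ⟨3 * D + 1, fun T e he i _ => (leap_le T _ _ _ _ i).trans ?_⟩
  · exact .add (.add (.comp₅ (G := next) comp_next (.var 2) (.var 3) (.var 4) (.var 5) (.var 1))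
      (.add (.var 2) (.var 2))) (.const 1)
  · have h₀ := he 0
    have h₃ := he 3
    have := bnd_pos T
    rw [add_mul, mul_assoc]
    omega

/-- The string of length `2 * d - 1` at `a` is a part of the string at `p`. -/
noncomputable def isPart (T : List (InSym A)) (d a p : ℕ) : Bool :=
  decide (p ≤ a) && decide (a + (d + d - 1) ≤ p + wlen T p)

noncomputable def telling (T : List (InSym A)) (n d p p' a : ℕ) : Bool :=
  (isPart T d a p || isPart T d a p') &&
    (spread T d a p (wlen T p) n ^^ spread T d a p' (wlen T p') n)

/-- A string that is spread differently in the strings at `p` and `p'`. -/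
noncomputable def findStr (T : List (InSym A)) (n d p p' : ℕ) : ℕ :=
  lfind (fun a => telling T n d p p' a) T.length

/-- The exponent is shifted by one: the value `q` stands for strings of length `2 ^ (q + 1) - 1` and
for the scattering number `r - q`. -/
noncomputable def findLen (T : List (InSym A)) (r p p' : ℕ) : ℕ :=
  lfind (fun q => decide (findStr T (r - q) (pow T q) p p' < T.length)) (min r (top T))

theorem compB_isPart : CompB (A := A) (k + 1) j fun T e => isPart T (e 0) (e 1) (e 2) :=
  .and (.le (.var 2) (.var 1)) (.le (.add (.var 1) (.sub (.add (.var 0) (.var 0)) (.const 1)))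
    (.add (.var 2) (.wlen (.var 2))))

theorem compB_telling : CompB (A := A) (k + 2) (j + 1) fun T e =>
    telling T (e 0) (e 1) (e 2) (e 3) (e 4) :=
  .and (.or (.comp₃ (P := isPart) compB_isPart (.var 1) (.var 4) (.var 2))
      (.comp₃ (P := isPart) compB_isPart (.var 1) (.var 4) (.var 3)))
    (.xor (.comp₅ (P := spread) compB_spread (.var 1) (.var 4) (.var 2) (.wlen (.var 2)) (.var 0))
      (.comp₅ (P := spread) compB_spread (.var 1) (.var 4) (.var 3) (.wlen (.var 3)) (.var 0)))

/-- Comparing at one center costs `N ^ 2`, finding the next center `N ^ 3`, the greedy test `N ^ 3 *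
l`, and trying all start positions `N ^ 4 * l`. -/
theorem comp_findStr : Comp (A := A) (k + 3) (j + 1) fun T e =>
    findStr T (e 0) (e 1) (e 2) (e 3) :=
  Comp.find .len
    (.comp₅ (P := telling) compB_telling (.var 1) (.var 2) (.var 3) (.var 4) (.var 0))

theorem comp_findLen : Comp (A := A) (k + 3) (j + 2) fun T e => findLen T (e 0) (e 1) (e 2) :=
  Comp.find_log (.minimum (.var 0) .top) ((bddBy_lg_top 0).mono_left fun _ _ => min_le_right _ _)
    (.lt (.comp₄ (G := findStr) comp_findStr (.sub (.var 1) (.var 0)) (.pow (.var 0)) (.var 2)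
      (.var 3)) .len)

noncomputable def rad (T : List (InSym A)) (r p p' : ℕ) : ℕ :=
  min (pow T r) (min (wlen T p) (wlen T p'))

noncomputable def lengthDiff (T : List (InSym A)) (r p p' : ℕ) : Bool :=
  !decide (wlen T p = wlen T p') && decide (min (wlen T p) (wlen T p') ≤ pow T r + 1)

noncomputable def prefDiff (T : List (InSym A)) (r p p' : ℕ) : Bool :=
  bex (fun i => !decide (sym T (p + i) = sym T (p' + i))) (rad T r p p')

noncomputable def suffDiff (T : List (InSym A)) (r p p' : ℕ) : Bool :=
  bex (fun i => !decide (sym T (p + wlen T p - rad T r p p' + i) =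
    sym T (p' + wlen T p' - rad T r p p' + i))) (rad T r p p')

noncomputable def scatDiff (T : List (InSym A)) (r p p' : ℕ) : Bool :=
  decide (findLen T r p p' < min r (top T))

/-- The least feature level of the two strings, used in place of their EF-similarity, which it never
exceeds. -/
noncomputable def rank (T : List (InSym A)) (p p' : ℕ) : ℕ :=
  lfind (fun r => lengthDiff T r p p' || (prefDiff T r p p' ||
    (suffDiff T r p p' || scatDiff T r p p'))) (top T + 1)

theorem comp_rad : Comp (A := A) (k + 1) j fun T e => rad T (e 0) (e 1) (e 2) :=
  .minimum (.pow (.var 0)) (.minimum (.wlen (.var 1)) (.wlen (.var 2)))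

theorem compB_lengthDiff : CompB (A := A) (k + 1) j fun T e => lengthDiff T (e 0) (e 1) (e 2) :=
  .and (.not (.eq (.wlen (.var 1)) (.wlen (.var 2))))
    (.le (.minimum (.wlen (.var 1)) (.wlen (.var 2))) (.add (.pow (.var 0)) (.const 1)))

theorem compB_prefDiff : CompB (A := A) (k + 1) j fun T e => prefDiff T (e 0) (e 1) (e 2) :=
  .bex comp_rad (.not (.eq (.symAt (.add (.var 2) (.var 0))) (.symAt (.add (.var 3) (.var 0)))))

theorem compB_suffDiff : CompB (A := A) (k + 2) j fun T e => suffDiff T (e 0) (e 1) (e 2) :=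
  .bex comp_rad (.not (.eq
    (.symAt (.add (.sub (.add (.var 2) (.wlen (.var 2)))
      (.comp₃ (G := rad) comp_rad (.var 1) (.var 2) (.var 3))) (.var 0)))
    (.symAt (.add (.sub (.add (.var 3) (.wlen (.var 3)))
      (.comp₃ (G := rad) comp_rad (.var 1) (.var 2) (.var 3))) (.var 0)))))

theorem compB_scatDiff : CompB (A := A) (k + 3) (j + 2) fun T e => scatDiff T (e 0) (e 1) (e 2) :=
  .lt comp_findLen (.minimum (.var 0) .top)

theorem comp_rank : Comp (A := A) (k + 3) (j + 3) fun T e => rank T (e 0) (e 1) :=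
  Comp.find_log (.add .top (.const 1)) (bddBy_lg_top 1)
    (.or (.comp₃ (P := lengthDiff) compB_lengthDiff (.var 0) (.var 1) (.var 2))
    (.or (.comp₃ (P := prefDiff) compB_prefDiff (.var 0) (.var 1) (.var 2))
    (.or (.comp₃ (P := suffDiff) compB_suffDiff (.var 0) (.var 1) (.var 2))
      (.comp₃ (P := scatDiff) compB_scatDiff (.var 0) (.var 1) (.var 2)))))

/-- The items of a scattering formula, or of its negation. -/
noncomputable def scatItems (T : List (InSym A)) (p n d a : ℕ) : List Item :=
  lNotIf (!spread T d a p (wlen T p) n) (iScat a d n)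

/-- The items of a formula that tells the strings at `p` and `p'` apart. -/
noncomputable def chosen (T : List (InSym A)) (r p p' : ℕ) : List Item :=
  if lengthDiff T r p p' then
    lNotIf (decide (wlen T p' < wlen T p)) (iDist (min (wlen T p) (wlen T p') - 1) 0 0 1)
  else if prefDiff T r p p' then [iPref p (rad T r p p')]
  else if suffDiff T r p p' then [iSuff (p + wlen T p - rad T r p p') (rad T r p p')]
  else scatItems T p (r - findLen T r p p') (pow T (findLen T r p p'))
    (findStr T (r - findLen T r p p') (pow T (findLen T r p p')) p p')

variable {P : List (InSym A) → (ℕ → ℕ) → Prop}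

theorem emitItems_chosen : EmitItems P (k + 3) (j + 2) fun T e => chosen T (e 0) (e 1) (e 2) := by
  have cr : Comp (A := A) (k + 3) (j + 2) fun T e => rad T (e 0) (e 1) (e 2) := comp_rad
  have cl : Comp (A := A) (k + 3) (j + 2) fun T e => findLen T (e 0) (e 1) (e 2) := comp_findLen
  have cn := Comp.sub (.var 0) cl
  have cd := Comp.pow (k := k + 2) cl
  refine EmitItems.ite compB_lengthDiff (emitItems_lNotIf (.lt (.wlen (.var 2)) (.wlen (.var 1)))
    (.const _) (.sub (.minimum (.wlen (.var 1)) (.wlen (.var 2))) (.const 1)) (.const _) (.const _)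
    (.const _) (.const _)) ?_
  refine EmitItems.ite compB_prefDiff (.cons (.const _) cr (.var 1) (.const _) (.const _) (.const _)
    .nil) ?_
  refine EmitItems.ite compB_suffDiff (.cons (.const _) cr (.sub (.add (.var 1) (.wlen (.var 1))) cr)
    (.const _) (.const _) (.const _) .nil) ?_
  exact emitItems_lNotIf (.not (.comp₅ (P := spread) compB_spread cd
    (.comp₄ (G := findStr) comp_findStr cn cd (.var 1) (.var 2)) (.var 1) (.wlen (.var 1)) cn))
    (.const _) cd (.comp₄ (G := findStr) comp_findStr cn cd (.var 1) (.var 2)) (.const _) (.const _)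
    cn

end Search

/-! ### Strings of the input as delimited words. -/

section Segments

variable {A : Type} {T : List (InSym A)} {a b p : ℕ} {u v w : List A}

theorem IsSeg.le_length (h : IsSeg T a w) (h0 : w ≠ []) : a + w.length ≤ T.length := by
  have hpos := List.length_pos_of_ne_nil h0
  have := (List.getElem?_eq_some_iff.1 (h (w.length - 1) (by omega))).1
  omega

theorem two_pow_eq_pow {q : ℕ} (h : 2 ^ q ≤ T.length) : pow T q = 2 ^ q := by
  have := pow_spec T q
  omega

theorem suff_eq (k : ℕ) (w : List A) : suff k w = (w.drop (w.length - k)).take k := by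
  rw [suff, List.take_of_length_le]
  rw [List.length_drop]
  omega

variable [Finite A]

theorem IsSeg.sym (h : IsSeg T a w) {i : ℕ} (hi : i < w.length) :
    sym T (a + i) = letterNum w[i] + 3 := by
  rw [WordLearn.sym, h i hi]; rfl

theorem IsSeg.sym_eq_iff (hu : IsSeg T a u) (hv : IsSeg T b v) {i j : ℕ} (hi : i < u.length)
    (hj : j < v.length) : WordLearn.sym T (a + i) = WordLearn.sym T (b + j) ↔ u[i]? = v[j]? := by
  rw [hu.sym hi, hv.sym hj, List.getElem?_eq_getElem hi, List.getElem?_eq_getElem hj]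
  simp [letterNum_injective.eq_iff]

/-- The string `u` stands at `p`, and is followed by an end marker. -/
structure IsWord (T : List (InSym A)) (p : ℕ) (u : List A) : Prop where
  seg : IsSeg T p u
  end_le : WordLearn.sym T (p + u.length) ≤ 2
  ne_nil : u ≠ []

theorem IsWord.le_length (h : IsWord T p u) : p + u.length ≤ T.length := h.seg.le_length h.ne_nil

theorem IsWord.wlen_eq (h : IsWord T p u) : wlen T p = u.length := by
  have := h.le_length
  refine lfind_eq (by omega) (fun _ => ?_) fun i hi => ?_
  · rw [decide_eq_true_eq]; exact h.end_le
  · rw [decide_eq_false_iff_not, h.seg.sym hi]; omega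

end Segments

/-! ### Correctness of the search. -/

section Spread

variable {A : Type} [Finite A] {T : List (InSym A)} {a p p' m n r d x : ℕ} {u v α : List A}

theorem isFree_iff (hu : IsWord T p u) (hα : IsSeg T a α) (hl : α.length = 2 ^ (m + 1) - 1) :
    isFree T (2 ^ m) a p u.length x = true ↔ x ∈ freeOcc (m + 1) α u := by
  have e2 : 2 ^ (m + 1) = 2 ^ m + 2 ^ m := by omega
  have hpos := Nat.two_pow_pos m
  simp only [isFree, Bool.and_eq_true, decide_eq_true_eq, ball_eq_true, mem_freeOcc]
  refine and_congr_right fun h₁ => and_congr_right fun h₂ => ?_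
  have : (u.drop (x - (2 ^ m - 1))).take (2 ^ (m + 1) - 1) = α ↔
      (u.drop (x - (2 ^ m - 1))).take (2 ^ (m + 1) - 1) = (α.drop 0).take (2 ^ (m + 1) - 1) := by
    rw [List.drop_zero, List.take_of_length_le hl.le]
  rw [this, take_drop_eq_iff, ← e2]
  refine forall₂_congr fun i hi => ?_
  rw [zero_add, add_assoc]
  exact hu.seg.sym_eq_iff hα (by omega) (by omega)

/-- The greedy choice is optimal: by induction, the `i`-th leap does not pass the `i`-th point of
any sequence with large gaps. -/
theorem leap_lt_iff {s : Finset ℕ} {l : ℕ} (hs : ∀ x, isFree T d a p l x = true ↔ x ∈ s)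
    (hl : ∀ x ∈ s, x < l) : leap T d a p l n < l + (d + d) + 1 ↔ Spread (d + d) n s := by
  have hsucc (i) : leap T d a p l (i + 1) = next T d a p l (leap T d a p l i) + (d + d) + 1 := rfl
  have hnext (x) (h : next T d a p l x < l) :
      x ≤ next T d a p l x ∧ next T d a p l x ∈ s := by
    have := lfind_spec h
    rw [Bool.and_eq_true, decide_eq_true_eq, hs] at this
    exact this
  have hle (x y) (hy : y ∈ s) (hxy : x ≤ y) : next T d a p l x ≤ y := by
    by_contra hc
    have := lfind_min (not_le.1 hc)
    rw [Bool.and_eq_false_iff, decide_eq_false_iff_not, ← Bool.not_eq_true, hs] at this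
    tauto
  constructor
  · intro h
    have key : ∀ i < n, next T d a p l (leap T d a p l i) < l := by
      induction n with
      | zero => intro i hi; omega
      | succ n ih =>
        rw [hsucc] at h
        have h₁ : next T d a p l (leap T d a p l n) < l := by omega
        have h₂ := (hnext _ h₁).1
        intro i hi
        rcases (show i < n ∨ i = n by omega) with hi | rfl
        · exact ih (by omega) i hi
        · exact h₁
    refine ⟨fun i => next T d a p l (leap T d a p l i), fun i hi => (hnext _ (key i hi)).2,
      fun i hi => ?_⟩
    have := (hnext _ (key (i + 1) hi)).1
    beta_reduce
    rw [hsucc] at this ⊢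
    omega
  · rintro ⟨f, hf, hf'⟩
    have key : ∀ i < n, leap T d a p l i ≤ f i := by
      intro i
      induction i with
      | zero => exact fun _ => Nat.zero_le _
      | succ i ih =>
        intro hi
        rw [hsucc]
        have := hle _ _ (hf i (by omega)) (ih (by omega))
        have := hf' i hi
        omega
    cases n with
    | zero => exact Nat.succ_pos _
    | succ n =>
      rw [hsucc]
      have := hle _ _ (hf n (by omega)) (key n (by omega))
      have := hl _ (hf n (by omega))
      omega

theorem spread_iff (hu : IsWord T p u) (hα : IsSeg T a α) (hl : α.length = 2 ^ (m + 1) - 1)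
    (hn : n ≤ top T) : spread T (2 ^ m) a p u.length n = true ↔
      Spread (2 ^ (m + 1)) n (freeOcc (m + 1) α u) := by
  have e2 : 2 ^ (m + 1) = 2 ^ m + 2 ^ m := by omega
  rw [spread, decide_eq_true_eq, min_eq_left hn,
    leap_lt_iff (fun x => isFree_iff hu hα hl) fun x hx => ?_, e2]
  have := (mem_freeOcc.1 hx).2.1
  have := Nat.two_pow_pos m
  omega

theorem exists_of_isPart (hu : IsWord T p u) (h : isPart T d a p = true) :
    ∃ α, IsSeg T a α ∧ α.length = d + d - 1 ∧ α <:+: u := by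
  rw [isPart, hu.wlen_eq, Bool.and_eq_true, decide_eq_true_eq, decide_eq_true_eq] at h
  refine ⟨(u.drop (a - p)).take (d + d - 1), ?_, ?_, ?_⟩
  · have := (hu.seg.drop (a - p)).take (d + d - 1)
    rwa [Nat.add_sub_cancel' h.1] at this
  · rw [List.length_take, List.length_drop]
    omega
  · exact (List.take_prefix _ _).isInfix.trans (List.drop_suffix _ _).isInfix

theorem isPart_of_infix (hu : IsWord T p u) (h : α <:+: u) (hα : α.length = d + d - 1) :
    ∃ a, isPart T d a p = true ∧ IsSeg T a α := by
  obtain ⟨s, t, rfl⟩ := h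
  refine ⟨p + s.length, ?_, fun i hi => ?_⟩
  · rw [isPart, hu.wlen_eq, Bool.and_eq_true, decide_eq_true_eq, decide_eq_true_eq]
    simp
    omega
  · rw [add_assoc, hu.seg (s.length + i) (by simp; omega)]
    simp [hi]

theorem exists_of_scatDiff (hu : IsWord T p u) (hv : IsWord T p' v) (hr : r ≤ top T)
    (h : scatDiff T r p p' = true) : ∃ q α, findLen T r p p' = q ∧ q < r ∧ pow T q = 2 ^ q ∧
      IsSeg T (findStr T (r - q) (pow T q) p p') α ∧ α.length = 2 ^ (q + 1) - 1 ∧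
      (α <:+: u ∨ α <:+: v) ∧ ¬ (Spread (2 ^ (q + 1)) (r - q) (freeOcc (q + 1) α u) ↔
        Spread (2 ^ (q + 1)) (r - q) (freeOcc (q + 1) α v)) := by
  rw [scatDiff, decide_eq_true_eq] at h
  have h₁ := lfind_spec h
  rw [min_eq_left hr] at h
  change decide (findStr T (r - findLen T r p p') (pow T (findLen T r p p')) p p' < T.length) = true
    at h₁
  generalize findLen T r p p' = q at *
  rw [decide_eq_true_eq] at h₁
  have h₂ := lfind_spec h₁
  change telling T (r - q) (pow T q) p p' (findStr T (r - q) (pow T q) p p') = true at h₂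
  generalize ha : findStr T (r - q) (pow T q) p p' = a at h₂
  rw [telling, Bool.and_eq_true, Bool.or_eq_true] at h₂
  obtain ⟨h₂, h₃⟩ := h₂
  obtain ⟨α, hα, hl, hinf⟩ : ∃ α, IsSeg T a α ∧ α.length = pow T q + pow T q - 1 ∧
      (α <:+: u ∨ α <:+: v) := by
    rcases h₂ with h₂ | h₂
    · obtain ⟨α, h₁, h₂, h₃⟩ := exists_of_isPart hu h₂
      exact ⟨α, h₁, h₂, .inl h₃⟩
    · obtain ⟨α, h₁, h₂, h₃⟩ := exists_of_isPart hv h₂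
      exact ⟨α, h₁, h₂, .inr h₃⟩
  have hlT : α.length ≤ T.length := by
    have := hu.le_length
    have := hv.le_length
    rcases hinf with h | h <;> have := h.length_le <;> omega
  -- The string found lies inside a word of the input, so the truncated power cannot exceed the
  -- input length.
  have hpow : pow T q = 2 ^ q := by
    have := pow_spec T q
    omega
  have e2 : 2 ^ (q + 1) = 2 ^ q + 2 ^ q := by omega
  rw [hpow, ← e2] at hl
  rw [hpow, hu.wlen_eq, hv.wlen_eq, bne_iff_ne] at h₃
  refine ⟨q, α, rfl, h, hpow, ha ▸ hα, hl, hinf, ?_⟩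
  rw [← spread_iff hu hα hl (by omega), ← spread_iff hv hα hl (by omega), ← Bool.eq_iff_iff]
  exact h₃

theorem scatDiff_of_not_sameScat (hu : IsWord T p u) (hv : IsWord T p' v) (hr : r ≤ top T)
    (h : ¬ SameScat r u v) : scatDiff T r p p' = true := by
  simp only [SameScat, not_forall] at h
  obtain ⟨q, α, n, hq, hn, hl, hinf, h⟩ := h
  obtain ⟨q, rfl⟩ := (⟨q - 1, by omega⟩ : ∃ q', q = q' + 1)
  have e2 : 2 ^ (q + 1) = 2 ^ q + 2 ^ q := by omega
  have hpos := Nat.two_pow_pos q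
  -- For `n = 0` the condition holds for both strings. So `n ≥ 1`, and the exponent lies in the
  -- range of the search.
  have hn0 : n ≠ 0 := by
    rintro rfl
    exact h (iff_of_true ⟨id, by omega, by omega⟩ ⟨id, by omega, by omega⟩)
  have hlT : α.length ≤ T.length := by
    have := hu.le_length
    have := hv.le_length
    rcases hinf with h | h <;> have := h.length_le <;> omega
  have hpow : pow T q = 2 ^ q := two_pow_eq_pow (by omega)
  obtain ⟨a, ha, hα⟩ : ∃ a, (isPart T (2 ^ q) a p = true ∨ isPart T (2 ^ q) a p' = true) ∧
      IsSeg T a α := by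
    rcases hinf with hinf | hinf
    · obtain ⟨a, h₁, h₂⟩ := isPart_of_infix hu hinf (d := 2 ^ q) (by omega)
      exact ⟨a, .inl h₁, h₂⟩
    · obtain ⟨a, h₁, h₂⟩ := isPart_of_infix hv hinf (d := 2 ^ q) (by omega)
      exact ⟨a, .inr h₁, h₂⟩
  have haT := hα.le_length (List.length_pos_iff.1 (by omega))
  rw [scatDiff, decide_eq_true_eq, findLen, lfind_lt_iff]
  refine ⟨q, by omega, ?_⟩
  rw [decide_eq_true_eq, findStr, lfind_lt_iff, hpow, show r - q = n by omega]
  refine ⟨a, by omega, ?_⟩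
  rw [telling, Bool.and_eq_true, Bool.or_eq_true, hu.wlen_eq, hv.wlen_eq, bne_iff_ne]
  refine ⟨ha, fun e => h ?_⟩
  rw [← spread_iff hu hα hl (by omega), ← spread_iff hv hα hl (by omega), e]

theorem rad_eq (hu : IsWord T p u) (hv : IsWord T p' v) : rad T r p p' = radius r u v := by
  rw [rad, radius, hu.wlen_eq, hv.wlen_eq]
  have := pow_spec T r
  have := hu.le_length
  omega

theorem lengthDiff_iff (hu : IsWord T p u) (hv : IsWord T p' v) : lengthDiff T r p p' = true ↔
    u.length ≠ v.length ∧ min u.length v.length ≤ 2 ^ r + 1 := by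
  simp only [lengthDiff, hu.wlen_eq, hv.wlen_eq, Bool.and_eq_true, Bool.not_eq_true',
    decide_eq_false_iff_not, decide_eq_true_eq]
  have := pow_spec T r
  have := hu.le_length
  omega

theorem prefDiff_iff (hu : IsWord T p u) (hv : IsWord T p' v) : prefDiff T r p p' = true ↔
    u.take (radius r u v) ≠ v.take (radius r u v) := by
  have h : radius r u v ≤ u.length ∧ radius r u v ≤ v.length := by unfold radius; omega
  rw [← List.drop_zero (l := u), ← List.drop_zero (l := v), Ne, take_drop_eq_iff, prefDiff,
    rad_eq hu hv, bex_eq_true]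
  simp only [Bool.not_eq_true', decide_eq_false_iff_not, not_forall, exists_prop, List.drop_zero]
  refine exists_congr fun i => and_congr_right fun hi => not_congr ?_
  rw [hu.seg.sym_eq_iff hv.seg (by omega) (by omega), zero_add]

theorem suffDiff_iff (hu : IsWord T p u) (hv : IsWord T p' v) : suffDiff T r p p' = true ↔
    suff (radius r u v) u ≠ suff (radius r u v) v := by
  have h : radius r u v ≤ u.length ∧ radius r u v ≤ v.length := by unfold radius; omega
  rw [suff_eq, suff_eq, Ne, take_drop_eq_iff, suffDiff, rad_eq hu hv, bex_eq_true]
  simp only [Bool.not_eq_true', decide_eq_false_iff_not, not_forall, exists_prop, hu.wlen_eq,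
    hv.wlen_eq]
  refine exists_congr fun i => and_congr_right fun hi => not_congr ?_
  rw [Nat.add_sub_assoc h.1, Nat.add_sub_assoc h.2, add_assoc, add_assoc,
    hu.seg.sym_eq_iff hv.seg (by omega) (by omega)]

theorem feature_iff (hu : IsWord T p u) (hv : IsWord T p' v) (hr : r ≤ top T) :
    (lengthDiff T r p p' || (prefDiff T r p p' || (suffDiff T r p p' || scatDiff T r p p'))) = true ↔
      Feature r u v := by
  rw [Bool.or_eq_true, Bool.or_eq_true, Bool.or_eq_true, lengthDiff_iff hu hv, prefDiff_iff hu hv,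
    suffDiff_iff hu hv]
  refine or_congr_right <| or_congr_right <| or_congr_right
    ⟨fun h hS => ?_, scatDiff_of_not_sameScat hu hv hr⟩
  obtain ⟨q, α, -, hq, -, -, hl, hinf, hne⟩ := exists_of_scatDiff hu hv hr h
  exact hne (hS (q + 1) α (r - q) (by omega) (by omega) hl hinf)

/-- All words of the input are shorter than `2 ^ top T`, so some level up to `top T` has a feature,
and the search finds the least one. -/
theorem rank_spec (hu : IsWord T p u) (hv : IsWord T p' v) (hne : u ≠ v) :
    rank T p p' ≤ top T ∧ Feature (rank T p p') u v ∧ ∀ s, Feature s u v → rank T p p' ≤ s := by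
  have h₁ := hu.le_length
  have h₂ := hv.le_length
  have h₃ := length_lt_two_pow_top T
  have h : rank T p p' < top T + 1 := by
    refine lfind_lt_iff.2 ⟨top T, by omega, (feature_iff hu hv le_rfl).2 ?_⟩
    exact .of_ne hne (by omega) (by omega)
  refine ⟨by omega, (feature_iff hu hv (by omega)).1 (lfind_spec h), fun s hs => ?_⟩
  by_contra hc
  have h₄ := lfind_min (not_le.1 hc)
  rw [(feature_iff hu hv (by omega)).2 hs] at h₄
  simp at h₄

theorem Yields.lNotIf {B c : ℕ} {t : Item} {φ : Fm A 0} (hB : 13 ≤ B)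
    (h : Yields T B [t] (encodeFormula φ) c) (b : Bool) :
    Yields T B (lNotIf b t) (encodeFormula (if b then ∼φ else φ)) (c + 2) := by
  cases b
  · exact h.mono (by omega)
  · exact h.not hB

/-- The tests are made in a fixed order, and the last branch may rely on scattering because some
feature is present. The constant `1000` is generous. -/
theorem exists_of_chosen (hu : IsWord T p u) (hv : IsWord T p' v) (hr : r ≤ top T)
    (hf : Feature r u v) : ∃ φ ∈ Phi r u v,
      Yields T (1000 * bnd T) (chosen T r p p') (encodeFormula φ) (1000 * (bnd T * bnd T)) := by
  have h₁ := hu.le_length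
  have h₂ := hv.le_length
  have hb : bnd T = T.length + 1 := rfl
  have hB : 13 ≤ 1000 * bnd T := by omega
  have hbb : bnd T ≤ bnd T * bnd T := Nat.le_mul_of_pos_left _ (by omega)
  unfold chosen
  split_ifs with c₁ c₂ c₃
  · have c₁' := (lengthDiff_iff hu hv).1 c₁
    rw [hu.wlen_eq, hv.wlen_eq]
    have hy := yields_distLE (T := T) (B := 1000 * bnd T) (min u.length v.length - 1)
      (tMin : Tm A 0) tMax hB (by omega) (c := 11 * T.length + 2) (by omega) (by omega)
    have := (hy.lNotIf hB (decide (v.length < u.length))).mono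
      (c' := 1000 * (bnd T * bnd T)) (by omega)
    refine ⟨_, ?_, this⟩
    split_ifs with h <;> rw [decide_eq_true_eq] at h
    · rw [min_eq_right h.le]
      exact not_distLE_mem_Phi h (by omega)
    · rw [min_eq_left (by omega)]
      exact distLE_mem_Phi hu.ne_nil (by omega) (by omega)
  · have c₂' := (prefDiff_iff hu hv).1 c₂
    have hl : (u.take (radius r u v)).length = radius r u v := by
      rw [List.length_take]; unfold radius; omega
    have hl' : radius r u v ≤ u.length := by unfold radius; omega
    have h0 : u.take (radius r u v) ≠ [] := by
      intro h0
      rw [h0] at hl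
      rw [← hl] at c₂'
      simp at c₂'
    have hy := yields_prefEq (B := 1000 * bnd T) (hu.seg.take (radius r u v)) h0 hB
      (by omega) (by omega)
    rw [hl] at hy
    rw [rad_eq hu hv]
    exact ⟨_, prefEq_mem_Phi c₂', hy.mono (by omega)⟩
  · have c₃' := (suffDiff_iff hu hv).1 c₃
    have hl' : radius r u v ≤ u.length := by unfold radius; omega
    have hl'' : radius r u v ≤ v.length := by unfold radius; omega
    have hl : (suff (radius r u v) u).length = radius r u v := by
      rw [suff, List.length_drop]; omega
    have h0 : suff (radius r u v) u ≠ [] := by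
      intro h0
      rw [h0] at hl
      rw [← hl] at c₃'
      simp [suff] at c₃'
    have hy := yields_suffEq (B := 1000 * bnd T) (hu.seg.drop (u.length - radius r u v)) h0 hB
      (by rw [List.length_drop]; omega) (by rw [List.length_drop]; omega)
    change Yields T _ [iSuff _ (suff (radius r u v) u).length]
      (encodeFormula (suffEq (suff (radius r u v) u))) (12 * (suff (radius r u v) u).length + 8) at hy
    rw [hl] at hy
    rw [rad_eq hu hv, hu.wlen_eq, Nat.add_sub_assoc hl']
    exact ⟨_, suffEq_mem_Phi c₃', hy.mono (by omega)⟩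
  · have c₄ : scatDiff T r p p' = true := by
      have := (feature_iff hu hv hr).2 hf
      simpa [c₁, c₂, c₃] using this
    obtain ⟨q, α, hq, hqr, hpow, hα, hl, hinf, hne⟩ := exists_of_scatDiff hu hv hr c₄
    rw [hq]
    generalize findStr T (r - q) (pow T q) p p' = a at *
    have e2 : 2 ^ (q + 1) = 2 ^ q + 2 ^ q := by omega
    have hpos := Nat.two_pow_pos q
    have hlT : α.length ≤ T.length := by
      rcases hinf with h | h <;> have := h.length_le <;> omega
    have haT := hα.le_length (List.length_pos_iff.1 (by omega))
    have htop : top T ≤ T.length + 1 := lfind_le _ _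
    have hy := yields_scatGE (B := 1000 * bnd T) (q := q + 1) (r - q) hα (d := 2 ^ q) rfl e2
      (by omega) hB (by omega) (by omega)
    rw [hpow, scatItems, hu.wlen_eq]
    refine ⟨_, ?_, (hy.lNotIf hB _).mono ?_⟩
    · have hs := spread_iff hu hα hl (n := r - q) (by omega)
      split_ifs with h
      · have hnu : ¬ Spread (2 ^ (q + 1)) (r - q) (freeOcc (q + 1) α u) := by
          rw [← hs]
          simpa using h
        exact not_scatGE_mem_Phi (by omega) hl hinf (by omega) hnu (by tauto)
      · have hsu : Spread (2 ^ (q + 1)) (r - q) (freeOcc (q + 1) α u) := by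
          rw [← hs]
          simpa using h
        exact scatGE_mem_Phi (by omega) hl hinf (by omega) hsu (by tauto)
    · have : (r - q + 1) * (200 * (2 ^ q + 1)) ≤ (2 * bnd T) * (200 * (2 * bnd T)) :=
        Nat.mul_le_mul (by omega) (Nat.mul_le_mul_left _ (by omega))
      have e : (2 * bnd T) * (200 * (2 * bnd T)) = 800 * (bnd T * bnd T) := by ring
      omega

end Spread

/-! ## The presentation of a sample -/

section Layout

variable {A : Type} {T rest : List (InSym A)} {p s i : ℕ} {u v w : List A} {l : List (List A)}
  (S : Sample A)

theorem encodeStrings_cons (w : List A) (l : List (List A)) :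
    encodeStrings (w :: l) = w.map InSym.letter ++ InSym.endString :: encodeStrings l := by
  simp [encodeStrings]

theorem length_encodeStrings (l : List (List A)) :
    (encodeStrings l).length = (l.map List.length).sum + l.length := by
  induction l with
  | nil => simp [encodeStrings]
  | cons w l ih =>
    rw [encodeStrings_cons]
    simp
    omega

theorem length_le_sum (hl : ∀ w ∈ l, w ≠ []) : l.length ≤ (l.map List.length).sum := by
  induction l with
  | nil => simp
  | cons w l ih =>
    have := List.length_pos_of_ne_nil (hl w (by simp))
    have := ih fun w hw => hl w (by simp [hw])
    simp
    omega

theorem drop_zero_encodeSample : (encodeSample S).drop 0 =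
    encodeStrings S.pos ++ (InSym.endPos :: encodeStrings S.neg) := by
  simp [encodeSample]

/-- Strings are nonempty, so there are at most as many end markers as letters. -/
theorem bnd_encodeSample_le : bnd (encodeSample S) ≤ 2 * S.size + 2 := by
  have h₁ := length_le_sum S.pos_ne_nil
  have h₂ := length_le_sum S.neg_ne_nil
  simp only [bnd, encodeSample, List.length_append, length_encodeStrings, Sample.size,
    List.length_singleton]
  omega

theorem succ_pow_three_le (n : ℕ) : (n + 1) ^ 3 ≤ 8 * 2 ^ n := by
  rcases lt_or_ge n 3 with h | h
  · interval_cases n <;> norm_num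
  · induction n, h using Nat.le_induction with
    | base => norm_num
    | succ n h ih =>
      obtain ⟨m, rfl⟩ := Nat.exists_eq_add_of_le h
      have e : 2 * (3 + m + 1) ^ 3 =
          (3 + m + 1 + 1) ^ 3 + (m ^ 3 + 9 * m ^ 2 + 21 * m + 3) := by ring
      rw [pow_succ 2]
      omega

/-- The cube of the logarithm is absorbed by one linear factor, which turns the exponent `6` into
`7`. -/
theorem wt_le (T : List (InSym A)) : wt 5 3 T ≤ 8 * bnd T ^ 7 := by
  have h : lg T ^ 3 ≤ 8 * bnd T :=
    (succ_pow_three_le _).trans (Nat.mul_le_mul_left _ (Nat.pow_log_le_self _ (bnd_pos T).ne'))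
  calc wt 5 3 T ≤ bnd T ^ 6 * (8 * bnd T) := Nat.mul_le_mul_left _ h
    _ = 8 * bnd T ^ 7 := by ring

theorem wt_encodeSample_le (S : Sample A) :
    wt 5 3 (encodeSample S) ≤ 131072 * (S.size ^ 7 + 1) := by
  refine (wt_le _).trans ?_
  have h₁ := Nat.pow_le_pow_left (bnd_encodeSample_le S) 7
  have h₂ : (2 * S.size + 2) ^ 7 ≤ 16384 * (S.size ^ 7 + 1) := by
    rcases Nat.eq_zero_or_pos S.size with h | h
    · simp [h]
    · calc (2 * S.size + 2) ^ 7 ≤ (4 * S.size) ^ 7 := Nat.pow_le_pow_left (by omega) 7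
        _ = 16384 * S.size ^ 7 := by ring
        _ ≤ _ := Nat.mul_le_mul_left _ (Nat.le_succ _)
  omega

variable [Finite A]

theorem IsWord.unique (hu : IsWord T p u) (hv : IsWord T p v) : u = v := by
  have hl : u.length = v.length := hu.wlen_eq.symm.trans hv.wlen_eq
  refine List.ext_getElem? fun i => ?_
  by_cases hi : i < u.length
  · exact (hu.seg.sym_eq_iff hv.seg hi (hl ▸ hi)).1 rfl
  · rw [List.getElem?_eq_none (by omega), List.getElem?_eq_none (by omega)]

theorem isWord_of_drop (hw : w ≠ [])
    (h : T.drop p = w.map InSym.letter ++ InSym.endString :: rest) : IsWord T p w := by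
  have e (i) : T[p + i]? = (w.map InSym.letter ++ InSym.endString :: rest)[i]? := by
    rw [← h, List.getElem?_drop]
  refine ⟨fun i hi => ?_, ?_, hw⟩
  · rw [e, List.getElem?_append_left (by simpa using hi)]
    simp [hi]
  · rw [sym, e, List.getElem?_append_right (by simp)]
    simp [symNum]

theorem wstart_spec (hl : ∀ w ∈ l, w ≠ []) (h : T.drop s = encodeStrings l ++ rest)
    (hi : i ≤ l.length) : T.drop (wstart T s i) = encodeStrings (l.drop i) ++ rest := by
  induction i with
  | zero => exact h
  | succ i ih =>
    have hi' : i < l.length := hi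
    have ih := ih (by omega)
    rw [List.drop_eq_getElem_cons hi', encodeStrings_cons, List.append_assoc, List.cons_append] at ih
    have hw := isWord_of_drop (hl _ (List.getElem_mem hi')) ih
    have := hw.le_length
    rw [wstart_succ, if_pos (by rw [decide_eq_true_eq]; omega), hw.wlen_eq, add_assoc,
      ← List.drop_drop, ih, ← List.drop_drop, List.drop_left' (by simp)]
    rfl

theorem isWord_wstart (hl : ∀ w ∈ l, w ≠ []) (h : T.drop s = encodeStrings l ++ rest)
    (hi : i < l.length) : IsWord T (wstart T s i) l[i] := by
  have := wstart_spec hl h hi.le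
  rw [List.drop_eq_getElem_cons hi, encodeStrings_cons, List.append_assoc, List.cons_append] at this
  exact isWord_of_drop (hl _ (List.getElem_mem hi)) this

theorem IsWord.three_le_sym (h : IsWord T p u) : 3 ≤ sym T p := by
  have := h.seg.sym (List.length_pos_of_ne_nil h.ne_nil)
  rw [add_zero] at this
  omega

theorem sym_wstart_length (hl : ∀ w ∈ l, w ≠ []) (h : T.drop s = encodeStrings l ++ rest) :
    sym T (wstart T s l.length) = symNum rest[0]? := by
  have := wstart_spec hl h le_rfl
  rw [List.drop_length] at this
  have e : T[wstart T s l.length + 0]? = rest[0]? := by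
    rw [← List.getElem?_drop, this]
    rfl
  rw [sym, ← e, add_zero]

/-- The strings of a list are counted by a search for the symbol that follows the list. -/
theorem lfind_wstart {n : ℕ} (hl : ∀ w ∈ l, w ≠ []) (h : T.drop s = encodeStrings l ++ rest)
    (hr : symNum rest[0]? = n) (hn : n < 3) :
    lfind (fun i => decide (sym T (wstart T s i) = n)) T.length = l.length := by
  refine lfind_eq ?_ (fun _ => ?_) fun i hi => ?_
  · have h₁ := length_encodeStrings l
    have h₂ := congrArg List.length h
    rw [List.length_drop, List.length_append] at h₂
    omega
  · rw [decide_eq_true_eq, sym_wstart_length hl h, hr]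
  · have := (isWord_wstart hl h hi).three_le_sym
    rw [decide_eq_false_iff_not]
    omega

theorem posNum_encodeSample : posNum (encodeSample S) = S.pos.length :=
  lfind_wstart S.pos_ne_nil (drop_zero_encodeSample S) rfl (by omega)

theorem drop_negStart_encodeSample : (encodeSample S).drop (negStart (encodeSample S)) =
    encodeStrings S.neg ++ [] := by
  rw [negStart, posNum_encodeSample, ← List.drop_drop,
    wstart_spec S.pos_ne_nil (drop_zero_encodeSample S) le_rfl, List.drop_length]
  simp [encodeStrings]

theorem negNum_encodeSample : negNum (encodeSample S) = S.neg.length :=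
  lfind_wstart S.neg_ne_nil (drop_negStart_encodeSample S) rfl (by omega)

end Layout

/-! ## The algorithm -/

section Lists

variable {A : Type} {P : List (InSym A) → (ℕ → ℕ) → Prop} {k j : ℕ}

-- The conjunctions are nested to the right, so their closing pairs of `bot` accumulate at the end:
-- `2 * (n - 1)` in all.
open OutSym in
theorem encodeFormula_bigAnd_range (f : ℕ → Fm A 0) (n : ℕ) :
    encodeFormula (bigAnd ((List.range n).map f)) =
      if decide (n = 0) then [imp, bot, bot] else
      ((List.range n).flatMap fun i =>
        if decide (i + 1 < n) then [imp, imp] ++ (encodeFormula (f i) ++ [imp])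
        else encodeFormula (f i)) ++ List.replicate (n + n - 2) bot := by
  induction n generalizing f with
  | zero => simp [bigAnd, encodeFormula_top]
  | succ n ih =>
    cases n with
    | zero => simp [bigAnd]
    | succ n =>
      have ih := ih (fun i => f (i + 1))
      rw [if_neg (by simp)] at ih ⊢
      have e : encodeFormula (bigAnd ((List.range (n + 1 + 1)).map f)) =
          encodeFormula (f 0 ⊓ bigAnd ((List.range (n + 1)).map fun i => f (i + 1))) := by
        simp [List.range_succ_eq_map, bigAnd, Function.comp_def]
      rw [e, encodeFormula_inf, ih, List.range_succ_eq_map (n := n + 1),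
        show n + 1 + 1 + (n + 1 + 1) - 2 = (n + 1 + (n + 1) - 2) + 2 by omega,
        List.replicate_add]
      simp [List.flatMap_map]

open OutSym in
theorem encodeFormula_bigOr_range (f : ℕ → Fm A 0) (n : ℕ) :
    encodeFormula (bigOr ((List.range n).map f)) =
      if decide (n = 0) then [bot] else
      (List.range n).flatMap fun i =>
        if decide (i + 1 < n) then [imp, imp] ++ (encodeFormula (f i) ++ [bot])
        else encodeFormula (f i) := by
  induction n generalizing f with
  | zero => rfl
  | succ n ih =>
    cases n with
    | zero => simp [bigOr]
    | succ n =>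
      have ih := ih (fun i => f (i + 1))
      rw [if_neg (by simp)] at ih ⊢
      have e : encodeFormula (bigOr ((List.range (n + 1 + 1)).map f)) =
          encodeFormula (f 0 ⊔ bigOr ((List.range (n + 1)).map fun i => f (i + 1))) := by
        simp [List.range_succ_eq_map, bigOr, Function.comp_def]
      rw [e, encodeFormula_sup, ih, List.range_succ_eq_map (n := n + 1)]
      simp [List.flatMap_map]

theorem List.map_range_eq {α β : Type} (l : List α) (f : α → β) (g : ℕ → β)
    (h : ∀ i, (hi : i < l.length) → g i = f l[i]) : (List.range l.length).map g = l.map f := by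
  refine List.ext_getElem (by simp) fun i h₁ h₂ => ?_
  simp only [List.getElem_map, List.getElem_range]
  exact h i (by simpa using h₂)

theorem Emit.steps {n : Fun A} {F : List (InSym A) → (ℕ → ℕ) → ℕ → List (OutSym A)}
    (pre post : List (OutSym A)) (hn : Comp k j fun T v => n T fun i => v (i + 1))
    (hF : Emit P k j false fun T v => F T (fun i => v (i + 1)) (v 0)) :
    Emit P k j false fun T v =>
      if decide (v 0 + 1 < n T fun i => v (i + 1)) then
        pre ++ (F T (fun i => v (i + 1)) (v 0) ++ post)
      else F T (fun i => v (i + 1)) (v 0) :=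
  .ite (.lt (.add (.var 0) (.const 1)) hn)
    (((Emit.const _).append (hF.append (.const _))).weaken fun _ _ h => h.1)
    (hF.weaken fun _ _ h => h.1)

end Lists

section Algorithm

variable {A : Type} [Finite A]

/-- The formula that the algorithm chooses for the strings at `p` and `p'`. -/
noncomputable def pick (T : List (InSym A)) (p p' : ℕ) : Fm A 0 :=
  haveI : Nonempty (Fm A 0) := ⟨⊥⟩
  -- Choice only names a formula whose code the items yield; the machine writes the text from
  -- `chosen`. The words are determined by their positions.
  Classical.epsilon fun φ => (∃ u v, IsWord T p u ∧ IsWord T p' v ∧ φ ∈ Phi (rank T p p') u v) ∧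
    Yields T (1000 * bnd T) (chosen T (rank T p p') p p') (encodeFormula φ) (1000 * (bnd T * bnd T))

theorem pick_spec {T : List (InSym A)} {p p' : ℕ} {u v : List A} (hu : IsWord T p u)
    (hv : IsWord T p' v) (h : u ≠ v) : pick T p p' ∈ Phi (rank T p p') u v ∧
    Yields T (1000 * bnd T) (chosen T (rank T p p') p p') (encodeFormula (pick T p p'))
      (1000 * (bnd T * bnd T)) := by
  have hr := rank_spec hu hv h
  obtain ⟨φ, h₁, h₂⟩ := exists_of_chosen hu hv hr.1 hr.2.1
  have hs := Classical.epsilon_spec (p := fun φ => (∃ u v, IsWord T p u ∧ IsWord T p' v ∧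
    φ ∈ Phi (rank T p p') u v) ∧ Yields T (1000 * bnd T) (chosen T (rank T p p') p p')
      (encodeFormula φ) (1000 * (bnd T * bnd T))) ⟨φ, ⟨u, v, hu, hv, h₁⟩, h₂⟩
  obtain ⟨⟨u', v', hu', hv', h₁⟩, h₂⟩ := hs
  rw [hu'.unique hu, hv'.unique hv] at h₁
  exact ⟨h₁, h₂⟩

theorem emit_pick : Emit (A := A)
    (fun T e => ∃ u v, IsWord T (e 0) u ∧ IsWord T (e 1) v ∧ u ≠ v) 3 3 false
    fun T e => encodeFormula (pick T (e 0) (e 1)) := by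
  have h : EmitItems (A := A) (fun T e => ∃ u v, IsWord T (e 0) u ∧ IsWord T (e 1) v ∧ u ≠ v) 3 3
      fun T e => chosen T (rank T (e 0) (e 1)) (e 0) (e 1) :=
    Emit.let_ (P := fun T e => ∃ u v, IsWord T (e 1) u ∧ IsWord T (e 2) v ∧ u ≠ v)
      (comp_rank (k := 0) (j := 0)) (emitItems_chosen (k := 0) (j := 1))
  exact .of_yields h ⟨1000, fun T e ⟨u, v, hu, hv, hne⟩ => (pick_spec hu hv hne).2⟩

/-- The formula for the positive string number `i` and the negative string number `i'`. -/
noncomputable def cell (T : List (InSym A)) (i i' : ℕ) : Fm A 0 :=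
  pick T (wstart T 0 i) (wstart T (negStart T) i')

/-- The least feature level is at most the EF-similarity of the pair, which is at most the rank of
the sample; monotonicity of `Phi` does the rest. -/
theorem Sample.cell_mem (S : Sample A) {i i' : ℕ} (hi : i < S.pos.length) (hi' : i' < S.neg.length) :
    cell (encodeSample S) i i' ∈ Phi S.rank S.pos[i] S.neg[i'] := by
  have hu := isWord_wstart S.pos_ne_nil (drop_zero_encodeSample S) hi
  have hv := isWord_wstart S.neg_ne_nil (drop_negStart_encodeSample S) hi'
  have hm := List.getElem_mem hi
  have hm' := List.getElem_mem hi'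
  have hne : S.pos[i] ≠ S.neg[i'] := fun h => S.disjoint hm (h ▸ hm')
  exact Phi_mono (((rank_spec hu hv hne).2.2 _ (.efsim hne hu.ne_nil hv.ne_nil)).trans
    (S.efsim_le_rank hm hm')) (pick_spec hu hv hne).1

/-- The output of the algorithm. -/
noncomputable def answer (T : List (InSym A)) : Fm A 0 :=
  bigOr ((List.range (posNum T)).map fun i => bigAnd ((List.range (negNum T)).map (cell T i)))

theorem Sample.isOutput_answer (S : Sample A) : S.IsOutput (answer (encodeSample S)) := by
  classical
  -- A choice must depend on the strings rather than on their indices; as the listings have no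
  -- repetitions, the index can be recovered.
  refine ⟨fun u v => cell (encodeSample S) (S.pos.idxOf u) (S.neg.idxOf v), fun u hu v hv => ?_, ?_⟩
  · have := S.cell_mem (List.idxOf_lt_length_of_mem hu) (List.idxOf_lt_length_of_mem hv)
    rwa [List.getElem_idxOf, List.getElem_idxOf] at this
  · rw [answer, posNum_encodeSample, negNum_encodeSample]
    congr 1
    refine List.map_range_eq _ _ _ fun i hi => ?_
    congr 1
    refine List.map_range_eq _ _ _ fun i' hi' => ?_
    beta_reduce
    rw [S.pos_nodup.idxOf_getElem, S.neg_nodup.idxOf_getElem]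

theorem emit_cell : Emit (A := A)
    (fun T e => (∃ S, T = encodeSample S) ∧ e 1 < posNum T ∧ e 0 < negNum T) 3 3 false
    fun T e => encodeFormula (cell T (e 1) (e 0)) := by
  refine (Emit.comp₂ (R := fun T p p' => ∃ u v, IsWord T p u ∧ IsWord T p' v ∧ u ≠ v)
    (G := fun T p p' => encodeFormula (pick T p p')) emit_pick
    (.wstart (k := 1) (.const 0) (.var 1)) (.wstart (k := 1) (.negStart (k := 0)) (.var 0))).weaken ?_
  rintro T e ⟨⟨S, rfl⟩, h₁, h₂⟩
  rw [posNum_encodeSample] at h₁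
  rw [negNum_encodeSample] at h₂
  refine ⟨_, _, isWord_wstart S.pos_ne_nil (drop_zero_encodeSample S) h₁,
    isWord_wstart S.neg_ne_nil (drop_negStart_encodeSample S) h₂, fun h => ?_⟩
  exact S.disjoint (List.getElem_mem h₁) (h ▸ List.getElem_mem h₂)

open OutSym in
theorem emit_row : Emit (A := A) (fun T e => (∃ S, T = encodeSample S) ∧ e 0 < posNum T) 4 3 false
    fun T e => encodeFormula (bigAnd ((List.range (negNum T)).map (cell T (e 0)))) := by
  have hn : Comp (A := A) 3 3 fun T _ => negNum T := .negNum (k := 0)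
  have hn' : Comp (A := A) 4 3 fun T _ => negNum T := .negNum (k := 1)
  refine Emit.congr (Emit.ite (.eq hn' (.const 0)) (.const [imp, bot, bot]) (Emit.append
    (Emit.range (k := 3) (n := fun T _ => negNum T) (F := fun T e i =>
      if decide (i + 1 < negNum T) then [imp, imp] ++ (encodeFormula (cell T (e 0) i) ++ [imp])
        else encodeFormula (cell T (e 0) i)) hn' ?_)
    (Emit.replicate (k := 3) (.sub (.add hn' hn') (.const 2)) bot)))
    fun T e _ => (encodeFormula_bigAnd_range _ _).symm
  exact .steps (n := fun T _ => negNum T) (F := fun T e i => encodeFormula (cell T (e 0) i)) _ _ hn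
    (emit_cell.weaken fun T e h => ⟨h.1.1.1, h.1.1.2, h.2⟩)

-- The loops over negative and over positive strings each add one factor `N` to the cost `N ^ 4 * l
-- ^ 3` of a pair.
open OutSym in
theorem emit_answer : Emit (A := A) (fun T _ => ∃ S, T = encodeSample S) 5 3 false
    fun T _ => encodeFormula (answer T) := by
  have hn : Comp (A := A) 4 3 fun T _ => posNum T := .posNum (k := 1)
  have hn' : Comp (A := A) 5 3 fun T _ => posNum T := .posNum (k := 2)
  refine Emit.congr (Emit.ite (.eq hn' (.const 0)) (.const [bot])
    (Emit.range (k := 4) (n := fun T _ => posNum T) (F := fun T e i =>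
      if decide (i + 1 < posNum T) then
        [imp, imp] ++ (encodeFormula (bigAnd ((List.range (negNum T)).map (cell T i))) ++ [bot])
        else encodeFormula (bigAnd ((List.range (negNum T)).map (cell T i)))) hn' ?_))
    fun T e _ => (encodeFormula_bigOr_range _ _).symm
  exact .steps (n := fun T _ => posNum T)
    (F := fun T e i => encodeFormula (bigAnd ((List.range (negNum T)).map (cell T i)))) _ _ hn
    (emit_row.weaken fun T e h => ⟨h.1.1, h.2⟩)

end Algorithm

end WordLearn

theorem mainTheorem4 (A : Type) [Finite A] :
    ∃ (M : Turing.TM2ComputableAux (WordLearn.InSym A) (WordLearn.OutSym A)) (C : ℕ),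
      ∀ S : WordLearn.Sample A, ∃ φ : (WordLearn.wordLang A).Sentence,
        S.IsOutput φ ∧
        Nonempty (Turing.TM2OutputsInTime M.tm
          ((WordLearn.encodeSample S).map M.inputAlphabet.symm)
          (some ((WordLearn.encodeFormula φ).map M.outputAlphabet.symm))
          (C * S.size ^ 7 + C)) := by
  obtain ⟨M, C, h⟩ := WordLearn.Emit.exists_machine (WordLearn.emit_answer (A := A))
  refine ⟨M, C * 131072, fun S => ⟨_, S.isOutput_answer, ?_⟩⟩
  obtain ⟨out⟩ := h _ ⟨S, rfl⟩
  refine ⟨⟨out.toEvalsTo, out.steps_le_m.trans ?_⟩⟩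
  have := Nat.mul_le_mul_left C (WordLearn.wt_encodeSample_le S)
  rw [← mul_assoc, mul_add, mul_one] at this
  exact this
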